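/- Let $\tau,n_x,n_u\in\mathbb N$, $\bar x_0\in\mathbb R^{n_x}$, $f:\mathbb R^{n_x}\times\mathbb R^{n_u}\to\mathbb R^{n_x}$ and $h_1,\dots,h_\tau:\mathbb R^{n_x}\to\mathbb R$. For $\boldsymbol u=(u_0;\dots;u_{\tau-1})\in\mathbb R^{\tau n_u}$ let $x_0=\bar x_0$, $x_{t+1}=f(x_t,u_t)$, $g(\boldsymbol u)=(x_1;\dots;x_\tau)$, $h(\boldsymbol x)=\sum_{t=1}^\tau h_t(x_t)$, $\mathcal J=h\circ g$ and $\mathcal J^*=\inf\mathcal J$. Gradients are transposed Jacobians, norms are Euclidean (resp. operator) norms, and $\sigma_{\min}(A)=\inf_{\lambda\ne0}\|A\lambda\|_2/\|\lambda\|_2$. **Oracles.** For $\nu\ge 0$ put $A_t=\nabla_xf(x_t,u_t)^\top$, $B_t=\nabla_uf(x_t,u_t)^\top$ $(0\le t<\tau)$, $p_t=\nabla h_t(x_t)$, $P_t=\nabla^2h_t(x_t)$ $(1\le t\le\tau)$; $J_\tau=P_\tau$, $j_\tau=p_\tau$ and, backwards for $1\le t<\tau$, $$J_t=P_t+A_t^\top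 J_{t+1}A_t-A_t^\top J_{t+1}B_t(\nu I+B_t^\top J_{t+1}B_t)^{-1}B_t^\top J_{t+1}A_t,$$ $$j_t=p_t+A_t^\top j_{t+1}-A_t^\top J_{t+1}B_t(\nu I+B_t^\top J_{t+1}B_t)^{-1}B_t^\top j_{t+1};$$ and, for $0\le t<\tau$, $\pi_t(y)=-(\nu I+B_t^\top J_{t+1}B_t)^{-1}B_t^\top(J_{t+1}A_ty+j_{t+1})$ (with an inverse read as $0$ if it does not exist, which under the assumptions below can only happen for $\nu=0$). Then $\mathrm{LQR}_\nu(\boldsymbol u)=(v_0;\dots;v_{\tau-1})$ with $v_t=\pi_t(y_t)$, $y_0=0$, $y_{t+1}=A_ty_t+B_tv_t$, and $\mathrm{DDP}_\nu(\boldsymbol u)=(v_0;\dots;v_{\tau-1})$ with $v_t=\pi_t(y_t)$, $y_0=0$, $y_{t+1}=f(x_t+y_t,u_t+v_t)-f(x_t,u_t)$. **Assumptions.** The $h_t$ are convex and twice continuously differentiable, with $L_h$-Lipschitz gradients and $M_h$-Lipschitz Hessians; $f$ is differentiable and Lipschitz continuous with Lipschitz continuous gradients; $\sigma_{\min}(\nabla_uf(x,u))\ge\sigma_f>0$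 for all $x,u$; $h$ is $\mu_h$-strongly convex with $\mu_h>0$. **Conclusions.** (0) If $l^x,l^u,L^{xx},L^{xu},L^{uu}\geq 0$ are bounds on the Lipschitz constants of $f(\cdot,u)$, $f(x,\cdot)$, $\nabla_xf(\cdot,u)$, $\nabla_uf(\cdot,u)$, $\nabla_uf(x,\cdot)$, uniformly in the frozen variable, and $S=\sum_{t=0}^{\tau-1}(l^x)^t$, then the following condition (C) holds for $l_g=l^uS$, $L_g=S(L^{xx}S\,l_g^2+2L^{xu}l_g+L^{uu})$ and $\sigma_g=\sigma_f/(1+l^x)$: $g$ is $l_g$-Lipschitz continuous, $\nabla g$ is $L_g$-Lipschitz continuous, and $\sigma_{\min}(\nabla g(\boldsymbol u))\ge\sigma_g>0$ for all $\boldsymbol u$. (1) The constant $\eta=\sup_{\boldsymbol u,\ \nu>0}\|\mathrm{DDP}_\nu(\boldsymbol u)-\mathrm{LQR}_\nu(\boldsymbol u)\|_2/\|\mathrm{LQR}_\nu(\boldsymbol u)\|_2^2$ (with $0/0=0$) is finite, and $\|\mathrm{DDP}_\nu(\boldsymbol u)-\mathrm{LQR}_\nu(\boldsymbol u)\|_2\le\eta\|\mathrm{LQR}_\nu(\boldsymbol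 u)\|_2^2$ for all $\boldsymbol u$ and $\nu>0$. Now let $l_g\ge0$, $L_g>0$, $\sigma_g>0$ be any constants satisfying (C), and put $\rho_h=L_h/\mu_h$, $\rho_g=l_g/\sigma_g$, $\theta_h=M_h/(2\mu_h^{3/2})$, $\theta_g=L_g/(\sigma_g^2\sqrt{\mu_h})$, $\chi=l_g\eta/L_g$, $\beta=(1+\rho_h\rho_g)(1+2\chi)+2\rho_g^3\theta_h/(3\theta_g)$ and $$\nu(\boldsymbol u)=L_g\beta\|\nabla h(g(\boldsymbol u))\|_2+\rho_h\sigma_g^2\theta_g^2\chi^2\|\nabla h(g(\boldsymbol u))\|_2^2,$$ $$\bar\lambda=\frac1{4\big(\theta_g\sqrt{\rho_h}(2+2\beta+\sqrt{\rho_h}\chi)+4\theta_h\big)},\qquad\bar\delta=\frac1{32\rho_h\big(\theta_g\sqrt{\rho_h}(2+2\beta+\sqrt{\rho_h}\chi)+4\theta_h\big)^2}.$$ (2) For every $\boldsymbol u$, with $\nu=\nu(\boldsymbol u)$: $\ \mathcal J(\boldsymbol u+\mathrm{DDP}_\nu(\boldsymbol u))\le\mathcal J(\boldsymbol u)+\tfrac12\nabla\mathcal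 J(\boldsymbol u)^\top\mathrm{LQR}_\nu(\boldsymbol u)$. (3) $\bar\delta$ determines the quadratic convergence phase: with the Newton decrement $\lambda_h(\boldsymbol x)=\sqrt{\nabla h(\boldsymbol x)^\top\nabla^2h(\boldsymbol x)^{-1}\nabla h(\boldsymbol x)}$, if $\mathcal J(\boldsymbol u)-\mathcal J^*\le\bar\delta$, then $\lambda_h(g(\boldsymbol u))\le\bar\lambda$ and $\lambda_h\big(g(\boldsymbol u+\mathrm{DDP}_{\nu(\boldsymbol u)}(\boldsymbol u))\big)\le\bar\lambda^{-1}\lambda_h(g(\boldsymbol u))^2$. (4) There is a function $r$ with $r(\varepsilon)=O(\ln\ln(1/\varepsilon))$ as $\varepsilon\to0^+$, independent of the initial command, such that for every $\boldsymbol u^{(0)}$ and every $\varepsilon>0$ the iterates $\boldsymbol u^{(k+1)}=\boldsymbol u^{(k)}+\mathrm{DDP}_{\nu(\boldsymbol u^{(k)})}(\boldsymbol u^{(k)})$ satisfy $\mathcal J(\boldsymbol u^{(m)})-\mathcal J^*\le\varepsilon$ for all $m\ge k$, for some $$k\le2\rho_h\ln\Big(\frac{\delta_0}{\bar\delta}\Big)+4\theta_g\beta\big(\sqrt{\delta_0}-\sqrt{\bar\delta}\big)+2\rho_h\theta_g^2\chi^2(\delta_0-\bar\delta)+r(\varepsilon),$$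 where $\delta_0=\max\{\mathcal J(\boldsymbol u^{(0)})-\mathcal J^*,\ \bar\delta\}$ (so that the first three terms vanish if the initial gap is already at most $\bar\delta$). -/

import Mathlib

open scoped NNReal Topology

noncomputable section

namespace OptControl

/-- `ℝⁿ` with the Euclidean norm. -/
abbrev Vec (n : ℕ) := EuclideanSpace ℝ (Fin n)

/-- `ℝ^{τ n}`, as sequences of `τ` vectors of `ℝⁿ`; its norm is the Euclidean norm of the
concatenation. -/
abbrev Traj (τ n : ℕ) := PiLp 2 (fun _ : Fin τ => Vec n)

/-- A discrete time control problem: horizon `τ`, dynamic `f`, initial state `x₀`, costs `h t`.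
Only the costs `h t` with `1 ≤ t ≤ τ` are part of the objective. -/
structure Problem (τ nx nu : ℕ) where
  f : Vec nx → Vec nu → Vec nx
  x₀ : Vec nx
  h : ℕ → Vec nx → ℝ

variable {τ nx nu : ℕ}

/-- The control `u_t` for `t < τ` (and `0` beyond the horizon, where it is never used). -/
def ctrlAt (u : Traj τ nu) (t : ℕ) : Vec nu := if ht : t < τ then u ⟨t, ht⟩ else 0

namespace Problem

/-! ### The objective and its decomposition -/

/-- The states: `x_0 = x₀` and `x_{t+1} = f (x_t, u_t)`. -/
def state (P : Problem τ nx nu) (u : Traj τ nu) : ℕ → Vec nx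
  | 0 => P.x₀
  | t + 1 => P.f (P.state u t) (ctrlAt u t)

/-- The control of `τ` steps of the dynamic, `g(u) = (x_1; …; x_τ)`. -/
def g (P : Problem τ nx nu) (u : Traj τ nu) : Traj τ nx :=
  WithLp.toLp 2 fun i : Fin τ => P.state u ((i : ℕ) + 1)

/-- The total cost `h(x_1; …; x_τ) = ∑_{t=1}^τ h_t(x_t)`. -/
def totalCost (P : Problem τ nx nu) (x : Traj τ nx) : ℝ :=
  ∑ i : Fin τ, P.h ((i : ℕ) + 1) (x i)

/-- The objective `𝒥 = h ∘ g`. -/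
def obj (P : Problem τ nx nu) (u : Traj τ nu) : ℝ := P.totalCost (P.g u)

/-- The optimal value `𝒥*`. -/
def optVal (P : Problem τ nx nu) : ℝ := ⨅ u : Traj τ nu, P.obj u

/-- The norm `‖∇h(g(u))‖₂`. -/
def gradNorm (P : Problem τ nx nu) (u : Traj τ nu) : ℝ := ‖gradient P.totalCost (P.g u)‖

/-- The Newton decrement `λ_h(x) = √(∇h(x)ᵀ ∇²h(x)⁻¹ ∇h(x))` of the total cost. -/
def newtonDecrement (P : Problem τ nx nu) (x : Traj τ nx) : ℝ :=
  Real.sqrt (inner ℝ (gradient P.totalCost x)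
    ((fderiv ℝ (gradient P.totalCost) x).inverse (gradient P.totalCost x)))

/-! ### Partial derivatives of the dynamic -/

/-- The partial Jacobian `∇_x f(x, u)ᵀ`. -/
def jacX (P : Problem τ nx nu) (x : Vec nx) (u : Vec nu) : Vec nx →L[ℝ] Vec nx :=
  fderiv ℝ (fun z => P.f z u) x

/-- The partial Jacobian `∇_u f(x, u)ᵀ`. -/
def jacU (P : Problem τ nx nu) (x : Vec nx) (u : Vec nu) : Vec nu →L[ℝ] Vec nx :=
  fderiv ℝ (fun w => P.f x w) u

/-! ### The LQR and DDP oracles: forward pass, backward pass, roll-out -/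

/-- `A_t = ∇_x f(x_t, u_t)ᵀ`. -/
def A (P : Problem τ nx nu) (u : Traj τ nu) (t : ℕ) : Vec nx →L[ℝ] Vec nx :=
  P.jacX (P.state u t) (ctrlAt u t)

/-- `B_t = ∇_u f(x_t, u_t)ᵀ`. -/
def B (P : Problem τ nx nu) (u : Traj τ nu) (t : ℕ) : Vec nu →L[ℝ] Vec nx :=
  P.jacU (P.state u t) (ctrlAt u t)

/-- `p_t = ∇h_t(x_t)`. -/
def p (P : Problem τ nx nu) (u : Traj τ nu) (t : ℕ) : Vec nx :=
  gradient (P.h t) (P.state u t)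

/-- `P_t = ∇²h_t(x_t)`. -/
def hess (P : Problem τ nx nu) (u : Traj τ nu) (t : ℕ) : Vec nx →L[ℝ] Vec nx :=
  fderiv ℝ (gradient (P.h t)) (P.state u t)

/-- `(ν I + Bᵀ J B)⁻¹ Bᵀ` for `B = B_t`. -/
def gain (P : Problem τ nx nu) (ν : ℝ) (u : Traj τ nu) (t : ℕ) (J : Vec nx →L[ℝ] Vec nx) :
    Vec nx →L[ℝ] Vec nu :=
  (ν • ContinuousLinearMap.id ℝ (Vec nu)
      + (ContinuousLinearMap.adjoint (P.B u t)).comp (J.comp (P.B u t))).inverse.comp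
    (ContinuousLinearMap.adjoint (P.B u t))

/-- The backward pass, indexed by the number `s` of steps that remain:
`backward P ν u s = (J_{τ-s}, j_{τ-s})`. Only `s < τ` is used by the policies. -/
def backward (P : Problem τ nx nu) (ν : ℝ) (u : Traj τ nu) :
    ℕ → (Vec nx →L[ℝ] Vec nx) × Vec nx
  | 0 => (P.hess u τ, P.p u τ)
  | s + 1 =>
    let t := τ - (s + 1)
    let J := (backward P ν u s).1
    let j := (backward P ν u s).2
    let A := P.A u t
    let B := P.B u t
    let At := ContinuousLinearMap.adjoint A
    (P.hess u t + At.comp (J.comp A)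
        - At.comp (J.comp (B.comp ((P.gain ν u t J).comp (J.comp A)))),
      P.p u t + At j - At (J (B (P.gain ν u t J j))))

/-- The policy `π_t(y) = K_t y + k_t`, with
`K_t = -(ν I + B_tᵀ J_{t+1} B_t)⁻¹ B_tᵀ J_{t+1} A_t` and
`k_t = -(ν I + B_tᵀ J_{t+1} B_t)⁻¹ B_tᵀ j_{t+1}`, for `t < τ`. -/
def policy (P : Problem τ nx nu) (ν : ℝ) (u : Traj τ nu) (t : ℕ) (y : Vec nx) : Vec nu :=
  let J := (P.backward ν u (τ - (t + 1))).1
  let j := (P.backward ν u (τ - (t + 1))).2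
  (-(P.gain ν u t J (J (P.A u t y))) - P.gain ν u t J j)

/-- Roll-out of the policies along the linearized dynamics. -/
def lqrRoll (P : Problem τ nx nu) (ν : ℝ) (u : Traj τ nu) : ℕ → Vec nx
  | 0 => 0
  | t + 1 => P.A u t (P.lqrRoll ν u t) + P.B u t (P.policy ν u t (P.lqrRoll ν u t))

/-- Roll-out of the policies along the original dynamics. -/
def ddpRoll (P : Problem τ nx nu) (ν : ℝ) (u : Traj τ nu) : ℕ → Vec nx
  | 0 => 0
  | t + 1 =>
    P.f (P.state u t + P.ddpRoll ν u t) (ctrlAt u t + P.policy ν u t (P.ddpRoll ν u t))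
      - P.f (P.state u t) (ctrlAt u t)

/-- The oracle `LQR_ν(𝒥)(u)`. -/
def LQR (P : Problem τ nx nu) (ν : ℝ) (u : Traj τ nu) : Traj τ nu :=
  WithLp.toLp 2 fun i : Fin τ => P.policy ν u i (P.lqrRoll ν u i)

/-- The oracle `DDP_ν(𝒥)(u)`. -/
def DDP (P : Problem τ nx nu) (ν : ℝ) (u : Traj τ nu) : Traj τ nu :=
  WithLp.toLp 2 fun i : Fin τ => P.policy ν u i (P.ddpRoll ν u i)

/-- The iterates `u^{(k+1)} = u^{(k)} + DDP_{ν(u^{(k)})}(𝒥)(u^{(k)})`. -/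
def iddp (P : Problem τ nx nu) (ν : Traj τ nu → ℝ) (u₀ : Traj τ nu) : ℕ → Traj τ nu
  | 0 => u₀
  | k + 1 => P.iddp ν u₀ k + P.DDP (ν (P.iddp ν u₀ k)) (P.iddp ν u₀ k)

/-- The ratios `‖DDP_ν(𝒥)(u) - LQR_ν(𝒥)(u)‖ / ‖LQR_ν(𝒥)(u)‖²`, over all `u` and `ν > 0`. -/
def ratios (P : Problem τ nx nu) : Set ℝ :=
  {r | ∃ (u : Traj τ nu) (ν : ℝ), 0 < ν ∧ r = ‖P.DDP ν u - P.LQR ν u‖ / ‖P.LQR ν u‖ ^ 2}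

/-- The constant `η`, the supremum of these ratios. -/
def eta (P : Problem τ nx nu) : ℝ := sSup P.ratios

/-! ### Assumptions and constants -/

/-- Convex costs with `Lh`-Lipschitz gradients and `Mh`-Lipschitz Hessians; a Lipschitz
continuous dynamic with Lipschitz continuous gradients, whose linearizations in the control are
surjective: `σ_min(∇_u f(x, u)) ≥ σf > 0` for all `x, u`. -/
structure StandingHypothesis (P : Problem τ nx nu) (Lh Mh : ℝ≥0) (σf : ℝ) : Prop where
  cost_convex : ∀ t ∈ Finset.Icc 1 τ, ConvexOn ℝ Set.univ (P.h t)
  cost_smooth : ∀ t ∈ Finset.Icc 1 τ, ContDiff ℝ 2 (P.h t)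
  cost_grad : ∀ t ∈ Finset.Icc 1 τ, LipschitzWith Lh (gradient (P.h t))
  cost_hess : ∀ t ∈ Finset.Icc 1 τ, LipschitzWith Mh (fderiv ℝ (gradient (P.h t)))
  dyn_diff : Differentiable ℝ (fun z : Vec nx × Vec nu => P.f z.1 z.2)
  dyn_lip : ∃ K : ℝ≥0, LipschitzWith K (fun z : Vec nx × Vec nu => P.f z.1 z.2)
  dyn_grad : ∃ K : ℝ≥0, LipschitzWith K (fderiv ℝ (fun z : Vec nx × Vec nu => P.f z.1 z.2))
  surj_pos : 0 < σf
  surj : ∀ (x : Vec nx) (u : Vec nu) (z : Vec nx),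
    σf * ‖z‖ ≤ ‖ContinuousLinearMap.adjoint (P.jacU x u) z‖

/-- `lx, lu, Lxx, Lxu, Luu` bound the Lipschitz constants of the partial functions and of the
partial gradients of the dynamic. -/
structure DynConstants (P : Problem τ nx nu) (lx lu Lxx Lxu Luu : ℝ≥0) : Prop where
  lip_x : ∀ u, LipschitzWith lx (fun x => P.f x u)
  lip_u : ∀ x, LipschitzWith lu (fun u => P.f x u)
  smooth_xx : ∀ u, LipschitzWith Lxx (fun x => P.jacX x u)
  smooth_xu : ∀ u, LipschitzWith Lxu (fun x => P.jacU x u)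
  smooth_uu : ∀ x, LipschitzWith Luu (fun u => P.jacU x u)

/-- `g` is `lg`-Lipschitz with `Lg`-Lipschitz gradients and
`σ_min(∇g(u)) ≥ σg > 0` for all `u`. -/
structure TrajConstants (P : Problem τ nx nu) (lg Lg : ℝ≥0) (σg : ℝ) : Prop where
  lip : LipschitzWith lg P.g
  smooth : LipschitzWith Lg (fderiv ℝ P.g)
  surj_pos : 0 < σg
  surj : ∀ (u : Traj τ nu) (z : Traj τ nx),
    σg * ‖z‖ ≤ ‖ContinuousLinearMap.adjoint (fderiv ℝ P.g u) z‖

end Problem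

/-- The constants from which all other ones are computed. -/
structure Consts where
  (μh Lh Mh lg Lg σg η : ℝ)

namespace Consts

/-- `ρ_h = L_h / μ_h`. -/
def ρh (c : Consts) : ℝ := c.Lh / c.μh

/-- `ρ_g = l_g / σ_g`. -/
def ρg (c : Consts) : ℝ := c.lg / c.σg

/-- `θ_h = M_h / (2 μ_h^{3/2})`. -/
def θh (c : Consts) : ℝ := c.Mh / (2 * c.μh ^ (3 / 2 : ℝ))

/-- `θ_g = L_g / (σ_g² √μ_h)`. -/
def θg (c : Consts) : ℝ := c.Lg / (c.σg ^ 2 * Real.sqrt c.μh)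

/-- `χ = l_g η / L_g`. -/
def χ (c : Consts) : ℝ := c.lg * c.η / c.Lg

/-- `β = (1 + ρ_h ρ_g)(1 + 2χ) + ρ_g³ (2θ_h) / (3θ_g)`. -/
def β (c : Consts) : ℝ :=
  (1 + c.ρh * c.ρg) * (1 + 2 * c.χ) + c.ρg ^ 3 * (2 * c.θh) / (3 * c.θg)

/-- The radius of quadratic convergence, in terms of the Newton decrement. -/
def lamBar (c : Consts) : ℝ :=
  1 / (4 * (c.θg * Real.sqrt c.ρh * (2 + 2 * c.β + Real.sqrt c.ρh * c.χ) + 4 * c.θh))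

/-- The value `δ̄` of the gap that determines the quadratic convergence phase. -/
def δBar (c : Consts) : ℝ :=
  1 / (32 * c.ρh *
    (c.θg * Real.sqrt c.ρh * (2 + 2 * c.β + Real.sqrt c.ρh * c.χ) + 4 * c.θh) ^ 2)

/-- The regularization, as a function of `x = ‖∇h(g(u))‖`. -/
def reg (c : Consts) (x : ℝ) : ℝ :=
  c.Lg * c.β * x + c.ρh * c.σg ^ 2 * c.θg ^ 2 * c.χ ^ 2 * x ^ 2

/-- The number of iterations that bring the gap from `δ` to `δ'`. -/
def phase (c : Consts) (δ δ' : ℝ) : ℝ :=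
  2 * c.ρh * Real.log (δ / δ') + 4 * c.θg * c.β * (Real.sqrt δ - Real.sqrt δ')
    + 2 * c.ρh * c.θg ^ 2 * c.χ ^ 2 * (δ - δ')

end Consts

end OptControl

end

open scoped NNReal Topology

open scoped NNReal Topology

/-! Iterative DDP is an approximate, regularized Gauss-Newton method for the composition of `h` with
`g`. Write q, H for the gradient and Hessian of `h` at `g u`, and G for the derivative of `g` at
`u`. The LQR oracle is the exact minimizer v of ⟨q, Gv⟩ + ⟨Gv, HGv⟩/2 + ν|v|²/2: the backward pass
is the elimination of the optimality system, and J y + j along the roll-out is the costate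
(`regStep_LQR`). The DDP oracle w satisfies |w - v| ≤ η|v|² (`norm_DDP_sub_LQR_le`), with η uniform
in u and ν, because the gains are bounded independently of ν by coercivity of J and surjectivity of
B (`norm_gain_le`).

The rest concerns one such step between inner product spaces. Stationarity puts v in the range of
the adjoint of G, where G is bounded below by σ, and gives σ|q + HGv| ≤ ν|v|. It also gives σμ|v| ≤
|q|, so a regularization computed from |q| alone can dominate all Taylor errors: this is the
sufficient decrease (`apply_step_le`, `error_le_reg`). The predicted decrease controls |q|² up to
the factor L + ν/σ², and strong convexity controls the gap by |q|². Hence each step lowers a gap δ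
by at least δ divided by a polynomial in √δ. Integrating this rate produces the potential `phase`,
which drops by at least one per step (`one_le_phase`).

Since ν is O(|q|) and |v| is O(|q|), the residual q + HGv is of second order, as are the
linearization error and |w - v|. The new gradient is therefore of second order too, and the Newton
decrement is squared up to a constant (`quadratic_estimates`, `sqrt_inner_le`). Repeated squaring
costs ln ln(1/ε) steps (`exists_isBigO_log_log`). The passage from a small gap to a small decrement
needs the infimum of the composition to be a lower bound of `h` on its whole space; this follows
from the gap estimate itself (`iInf_le`). -/

namespace OptControl

/-! ### Taylor bounds and strong convexity. -/

section Taylor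

variable {E F : Type*} [NormedAddCommGroup E] [NormedSpace ℝ E] [NormedAddCommGroup F]
  [NormedSpace ℝ F]

/-- The error of the linearization of a function with an `L`-Lipschitz derivative. -/
lemma norm_sub_fderiv_le {g : E → F} {L : ℝ≥0} (hd : Differentiable ℝ g)
    (hL : LipschitzWith L (fderiv ℝ g)) (x v : E) :
    ‖g (x + v) - g x - fderiv ℝ g x v‖ ≤ L / 2 * ‖v‖ ^ 2 := by
  have hline : ∀ t : ℝ, HasDerivAt (fun s : ℝ => x + s • v) v t := fun t => by
    simpa using ((hasDerivAt_id' t).smul_const v).const_add x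
  have hφ : ∀ t : ℝ, HasDerivAt (fun s : ℝ => g (x + s • v) - g x - s • fderiv ℝ g x v)
      (fderiv ℝ g (x + t • v) v - fderiv ℝ g x v) t := fun t => by
    have h1 := (hd (x + t • v)).hasFDerivAt.comp_hasDerivAt t (hline t)
    have h2 := (hasDerivAt_id' t).smul_const (fderiv ℝ g x v)
    exact ((h1.sub_const (g x)).sub h2).congr_deriv (by simp)
  have key := image_norm_le_of_norm_deriv_right_le_deriv_boundary (a := 0) (b := 1)
    (f := fun s : ℝ => g (x + s • v) - g x - s • fderiv ℝ g x v)
    (f' := fun t => fderiv ℝ g (x + t • v) v - fderiv ℝ g x v)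
    (B := fun t => L / 2 * ‖v‖ ^ 2 * t ^ 2) (B' := fun t => L * ‖v‖ ^ 2 * t)
    (fun t _ => (hφ t).continuousAt.continuousWithinAt)
    (fun t _ => (hφ t).hasDerivWithinAt) (by simp)
    (fun t => by
      exact (((hasDerivAt_id' t).pow 2).const_mul (L / 2 * ‖v‖ ^ 2 : ℝ)).congr_deriv
        (by push_cast; ring))
    (fun t ht => by
      have h1 := hL.norm_sub_le (x + t • v) x
      rw [← sub_apply]
      calc _ ≤ ‖fderiv ℝ g (x + t • v) - fderiv ℝ g x‖ * ‖v‖ :=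
            ContinuousLinearMap.le_opNorm _ _
        _ ≤ (L * ‖x + t • v - x‖) * ‖v‖ := by gcongr
        _ = L * ‖v‖ ^ 2 * t := by
            rw [add_sub_cancel_left, norm_smul, Real.norm_of_nonneg ht.1]; ring)
  have := key (x := 1) (by simp)
  simpa using this

end Taylor

section Cost

variable {F : Type*} [NormedAddCommGroup F] [InnerProductSpace ℝ F] [CompleteSpace F]

/-- A `μ`-strongly convex function with an `L`-Lipschitz gradient and an `M`-Lipschitz, symmetric
Hessian. -/
structure SmoothCost (h : F → ℝ) (L M : ℝ≥0) (μ : ℝ) : Prop where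
  diff : Differentiable ℝ h
  grad_diff : Differentiable ℝ (gradient h)
  grad_lip : LipschitzWith L (gradient h)
  hess_lip : LipschitzWith M (fderiv ℝ (gradient h))
  symm : ∀ x a b, inner ℝ (fderiv ℝ (gradient h) x a) b = inner ℝ a (fderiv ℝ (gradient h) x b)
  pos : 0 < μ
  convex : StrongConvexOn Set.univ μ h

lemma hasDerivAt_comp_line {h : F → ℝ} (hd : Differentiable ℝ h) (x b : F) (t : ℝ) :
    HasDerivAt (fun s : ℝ => h (x + s • b)) (inner ℝ (gradient h (x + t • b)) b) t := by
  have hline : HasDerivAt (fun s : ℝ => x + s • b) b t := by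
    simpa using ((hasDerivAt_id' t).smul_const b).const_add x
  have h1 := (hd (x + t • b)).hasGradientAt.hasFDerivAt.comp_hasDerivAt t hline
  exact h1.congr_deriv (by simp [inner_gradient_left])

/-- Upper bounds on `h` along a segment, by integration of upper bounds on its slope. -/
lemma apply_add_le_of_inner_gradient_le {h : F → ℝ} (hd : Differentiable ℝ h) (x b : F)
    {B B' : ℝ → ℝ} (h0 : h x ≤ B 0) (hB : ∀ t, HasDerivAt B (B' t) t)
    (hle : ∀ t ∈ Set.Ico (0 : ℝ) 1, inner ℝ (gradient h (x + t • b)) b ≤ B' t) :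
    h (x + b) ≤ B 1 := by
  have key := image_le_of_deriv_right_le_deriv_boundary (a := 0) (b := 1)
    (f := fun s : ℝ => h (x + s • b)) (f' := fun t => inner ℝ (gradient h (x + t • b)) b)
    (B := B) (B' := B')
    (fun t _ => (hasDerivAt_comp_line hd x b t).continuousAt.continuousWithinAt)
    (fun t _ => (hasDerivAt_comp_line hd x b t).hasDerivWithinAt) (by simpa using h0)
    (fun t _ => (hB t).continuousAt.continuousWithinAt)
    (fun t _ => (hB t).hasDerivWithinAt) hle
  have := key (x := 1) (by simp)
  simpa using this

/-- The descent lemma. -/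
lemma apply_add_le_of_lipschitz_gradient {h : F → ℝ} {L : ℝ≥0} (hd : Differentiable ℝ h)
    (hL : LipschitzWith L (gradient h)) (x b : F) :
    h (x + b) ≤ h x + inner ℝ (gradient h x) b + L / 2 * ‖b‖ ^ 2 := by
  have := apply_add_le_of_inner_gradient_le hd x b
    (B := fun t => h x + t * inner ℝ (gradient h x) b + L / 2 * ‖b‖ ^ 2 * t ^ 2)
    (B' := fun t => inner ℝ (gradient h x) b + L * ‖b‖ ^ 2 * t) (by simp)
    (fun t => by
      have h1 := ((hasDerivAt_id' t).mul_const (inner ℝ (gradient h x) b)).const_add (h x)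
      have h2 := ((hasDerivAt_id' t).pow 2).const_mul (L / 2 * ‖b‖ ^ 2 : ℝ)
      exact (h1.add h2).congr_deriv (by push_cast; ring))
    (fun t ht => by
      have h1 := hL.norm_sub_le (x + t • b) x
      rw [add_sub_cancel_left, norm_smul, Real.norm_of_nonneg ht.1] at h1
      have h2 := real_inner_le_norm (gradient h (x + t • b) - gradient h x) b
      rw [inner_sub_left] at h2
      nlinarith [mul_le_mul_of_nonneg_right h1 (norm_nonneg b)])
  simpa using this

/-- The third order upper bound for a function with an `M`-Lipschitz Hessian. -/
lemma apply_add_le_of_lipschitz_hessian {h : F → ℝ} {M : ℝ≥0} (hd : Differentiable ℝ h)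
    (hg : Differentiable ℝ (gradient h)) (hM : LipschitzWith M (fderiv ℝ (gradient h)))
    (x b : F) :
    h (x + b) ≤ h x + inner ℝ (gradient h x) b
      + 1 / 2 * inner ℝ b (fderiv ℝ (gradient h) x b) + M / 6 * ‖b‖ ^ 3 := by
  have := apply_add_le_of_inner_gradient_le hd x b
    (B := fun t => h x + t * inner ℝ (gradient h x) b
      + 1 / 2 * inner ℝ b (fderiv ℝ (gradient h) x b) * t ^ 2 + M / 6 * ‖b‖ ^ 3 * t ^ 3)
    (B' := fun t => inner ℝ (gradient h x) b + inner ℝ b (fderiv ℝ (gradient h) x b) * t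
      + M / 2 * ‖b‖ ^ 3 * t ^ 2) (by simp)
    (fun t => by
      have h1 := ((hasDerivAt_id' t).mul_const (inner ℝ (gradient h x) b)).const_add (h x)
      have h2 := ((hasDerivAt_id' t).pow 2).const_mul
        (1 / 2 * inner ℝ b (fderiv ℝ (gradient h) x b) : ℝ)
      have h3 := ((hasDerivAt_id' t).pow 3).const_mul (M / 6 * ‖b‖ ^ 3 : ℝ)
      exact ((h1.add h2).add h3).congr_deriv (by push_cast; ring))
    (fun t ht => by
      have h1 := norm_sub_fderiv_le hg hM x (t • b)
      rw [norm_smul, Real.norm_of_nonneg ht.1, map_smul] at h1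
      have h2 := real_inner_le_norm
        (gradient h (x + t • b) - gradient h x - t • fderiv ℝ (gradient h) x b) b
      rw [inner_sub_left, inner_sub_left, real_inner_smul_left,
        real_inner_comm b (fderiv ℝ (gradient h) x b)] at h2
      nlinarith [mul_le_mul_of_nonneg_right h1 (norm_nonneg b)])
  simpa using this

/-- The first order characterization of strong convexity. -/
lemma _root_.StrongConvexOn.add_inner_gradient_le {h : F → ℝ} {μ : ℝ}
    (hc : StrongConvexOn Set.univ μ h) (hd : Differentiable ℝ h) (x y : F) :
    h x + inner ℝ (gradient h x) y + μ / 2 * ‖y‖ ^ 2 ≤ h (x + y) := by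
  have h1 := (hasDerivAt_comp_line hd x y 0).tendsto_slope_zero_right
  simp only [zero_add, zero_smul, add_zero, smul_eq_mul] at h1
  have h2 : Filter.Tendsto (fun t : ℝ => h (x + y) - h x - (1 - t) * (μ / 2 * ‖y‖ ^ 2))
      (𝓝[>] 0) (𝓝 (h (x + y) - h x - (1 - 0) * (μ / 2 * ‖y‖ ^ 2))) := by
    refine Filter.Tendsto.mono_left ?_ nhdsWithin_le_nhds
    exact Continuous.tendsto (by fun_prop) 0
  have h3 := le_of_tendsto_of_tendsto h1 h2 (by
    filter_upwards [Ioo_mem_nhdsGT (show (0 : ℝ) < 1 by norm_num)] with t ht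
    have h4 := hc.2 (Set.mem_univ x) (Set.mem_univ (x + y))
      (show 0 ≤ 1 - t by linarith [ht.2]) ht.1.le (by ring)
    have h5 : (1 - t) • x + t • (x + y) = x + t • y := by module
    rw [h5] at h4
    simp only [smul_eq_mul, sub_add_cancel_left, norm_neg] at h4
    rw [inv_mul_le_iff₀ ht.1]
    nlinarith)
  linarith

namespace SmoothCost

variable {h : F → ℝ} {L M : ℝ≥0} {μ : ℝ}

/-- The first order inequality, written from both ends of the segment from x to x + t y and added,
gives strong monotonicity of the gradient; dividing by t² and letting t tend to 0 gives the Hessian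
bound. -/
lemma le_inner_hess (hh : SmoothCost h L M μ) (x y : F) :
    μ * ‖y‖ ^ 2 ≤ inner ℝ y (fderiv ℝ (gradient h) x y) := by
  have hline : HasDerivAt (fun s : ℝ => x + s • y) y 0 := by
    simpa using ((hasDerivAt_id (0 : ℝ)).smul_const y).const_add x
  have h1 := ((hh.grad_diff (x + (0 : ℝ) • y)).hasFDerivAt.comp_hasDerivAt 0 hline)
  have h2 := h1.tendsto_slope_zero_right
  simp only [zero_add, zero_smul, add_zero, Function.comp_apply] at h2
  have h3 := (tendsto_const_nhds (x := y)).inner (𝕜 := ℝ) h2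
  refine ge_of_tendsto h3 ?_
  filter_upwards [self_mem_nhdsWithin] with t ht
  have ht : 0 < t := ht
  have h4 := hh.convex.add_inner_gradient_le hh.diff x (t • y)
  have h5 := hh.convex.add_inner_gradient_le hh.diff (x + t • y) (-(t • y))
  rw [add_neg_cancel_right, inner_neg_right, norm_neg] at h5
  rw [norm_smul, Real.norm_of_nonneg ht.le, real_inner_smul_right] at h4 h5
  rw [real_inner_smul_right, inner_sub_right, real_inner_comm (gradient h (x + t • y)) y,
    real_inner_comm (gradient h x) y, le_inv_mul_iff₀ ht]
  have h6 : t * (t * (μ * ‖y‖ ^ 2))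
      ≤ t * (inner ℝ (gradient h (x + t • y)) y - inner ℝ (gradient h x) y) := by
    nlinarith
  exact le_of_mul_le_mul_left h6 ht

lemma norm_hess_le (hh : SmoothCost h L M μ) (x : F) : ‖fderiv ℝ (gradient h) x‖ ≤ L :=
  norm_fderiv_le_of_lipschitz ℝ hh.grad_lip

/-- Strong convexity bounds the gap by the norm of the gradient. -/
lemma sub_le_norm_gradient (hh : SmoothCost h L M μ) (x y : F) :
    h x - h y ≤ ‖gradient h x‖ ^ 2 / (2 * μ) := by
  have h1 := hh.convex.add_inner_gradient_le hh.diff x (y - x)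
  rw [add_sub_cancel] at h1
  have h2 := neg_le_of_abs_le (abs_real_inner_le_norm (gradient h x) (y - x))
  have hμ := hh.pos
  rw [le_div_iff₀ (by positivity)]
  nlinarith [sq_nonneg (‖gradient h x‖ - μ * ‖y - x‖)]

end SmoothCost

end Cost

/-! ### Positive semidefinite operators. -/

section Form

variable {F : Type*} [NormedAddCommGroup F] [InnerProductSpace ℝ F]

/-- The Cauchy-Schwarz inequality for a positive semidefinite operator. -/
lemma inner_apply_sq_le {H : F →L[ℝ] F} (hs : ∀ a b, inner ℝ (H a) b = inner ℝ a (H b))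
    (hp : ∀ a, 0 ≤ inner ℝ a (H a)) (a b : F) :
    inner ℝ a (H b) ^ 2 ≤ inner ℝ a (H a) * inner ℝ b (H b) := by
  have hba : inner ℝ b (H a) = inner ℝ a (H b) := by rw [← hs, real_inner_comm]
  have h1 := discrim_le_zero (a := inner ℝ a (H a)) (b := 2 * inner ℝ a (H b))
    (c := inner ℝ b (H b)) (fun t => by
      have := hp (t • a + b)
      simp only [map_add, map_smul, inner_add_left, inner_add_right, real_inner_smul_left,
        real_inner_smul_right, hba] at this
      linarith)
  unfold discrim at h1
  linarith

/-- This is H² ≤ L H as quadratic forms: Cauchy-Schwarz for the form of H, applied to a and H a,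
then division by |H a|². -/
lemma norm_apply_sq_le {H : F →L[ℝ] F} (hs : ∀ a b, inner ℝ (H a) b = inner ℝ a (H b))
    (hp : ∀ a, 0 ≤ inner ℝ a (H a)) {L : ℝ} (hL : ‖H‖ ≤ L) (a : F) :
    ‖H a‖ ^ 2 ≤ L * inner ℝ a (H a) := by
  have h1 := inner_apply_sq_le hs hp a (H a)
  rw [← hs, real_inner_self_eq_norm_sq] at h1
  have h2 : inner ℝ (H a) (H (H a)) ≤ L * ‖H a‖ ^ 2 := by
    calc _ ≤ ‖H a‖ * ‖H (H a)‖ := real_inner_le_norm _ _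
      _ ≤ ‖H a‖ * (L * ‖H a‖) := by gcongr; exact H.le_of_opNorm_le hL _
      _ = _ := by ring
  rcases eq_or_ne (H a) 0 with h0 | h0
  · simp [h0]
  · have : 0 < ‖H a‖ ^ 2 := by positivity
    have h3 := mul_le_mul_of_nonneg_left h2 (hp a)
    refine le_of_mul_le_mul_right ?_ this
    nlinarith

end Form

end OptControl

namespace OptControl

/-! ### A single regularized Gauss-Newton step. -/

section Step

variable {E F : Type*} [NormedAddCommGroup E] [InnerProductSpace ℝ E] [CompleteSpace E]
  [NormedAddCommGroup F] [InnerProductSpace ℝ F] [CompleteSpace F]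

/-- G may have a kernel, but on the range of its adjoint it is bounded below: for y = G* z, |y|² =
⟨z, G y⟩ ≤ |z||G y|, and σ|z| ≤ |y|. -/
lemma mul_norm_adjoint_le {G : E →L[ℝ] F} {σ : ℝ}
    (hσ : ∀ z, σ * ‖z‖ ≤ ‖ContinuousLinearMap.adjoint G z‖) (z : F) :
    σ * ‖ContinuousLinearMap.adjoint G z‖ ≤ ‖G (ContinuousLinearMap.adjoint G z)‖ := by
  set y := ContinuousLinearMap.adjoint G z with hy
  rcases (norm_nonneg y).eq_or_lt with h0 | h0
  · rw [← h0, mul_zero]; exact norm_nonneg _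
  have h1 : ‖y‖ ^ 2 ≤ ‖z‖ * ‖G y‖ := by
    rw [← real_inner_self_eq_norm_sq]
    nth_rewrite 1 [hy]
    rw [ContinuousLinearMap.adjoint_inner_left]
    exact real_inner_le_norm _ _
  have h2 := hσ z
  rw [← hy] at h2
  rcases le_or_gt σ 0 with h3 | h3
  · exact (mul_nonpos_of_nonpos_of_nonneg h3 (norm_nonneg _)).trans (norm_nonneg _)
  refine le_of_mul_le_mul_right (a := ‖y‖) ?_ h0
  nlinarith [norm_nonneg (G y), mul_le_mul_of_nonneg_right h2 (norm_nonneg (G y))]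

/-- `v` is the minimizer of the regularized quadratic model
`⟨q, G v⟩ + ⟨G v, H G v⟩ / 2 + ν ‖v‖² / 2`. -/
structure RegStep (G : E →L[ℝ] F) (H : F →L[ℝ] F) (q : F) (ν : ℝ) (v : E) : Prop where
  reg_pos : 0 < ν
  stationary : ν • v + ContinuousLinearMap.adjoint G (q + H (G v)) = 0

namespace RegStep

variable {G : E →L[ℝ] F} {H : F →L[ℝ] F} {q : F} {ν σ μ : ℝ} {v : E}

/-- Stationarity with ν > 0 exhibits v as an element of the range of the adjoint of G. -/
lemma mul_norm_le (hv : RegStep G H q ν v)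
    (hσ : ∀ z, σ * ‖z‖ ≤ ‖ContinuousLinearMap.adjoint G z‖) : σ * ‖v‖ ≤ ‖G v‖ := by
  have hν := hv.reg_pos
  have h1 : v = ContinuousLinearMap.adjoint G (-(ν⁻¹ • (q + H (G v)))) := by
    rw [map_neg, map_smul, eq_neg_of_add_eq_zero_right hv.stationary, smul_neg, neg_neg,
      smul_smul, inv_mul_cancel₀ hν.ne', one_smul]
  rw [h1]
  exact mul_norm_adjoint_le hσ _

/-- Pairing the stationarity equation with v. All estimates of the predicted decrease start from
this identity. -/
lemma inner_eq (hv : RegStep G H q ν v) :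
    inner ℝ q (G v) = -(ν * ‖v‖ ^ 2) - inner ℝ (G v) (H (G v)) := by
  have h1 : inner ℝ (ν • v + ContinuousLinearMap.adjoint G (q + H (G v))) v = 0 := by
    rw [hv.stationary, inner_zero_left]
  rw [inner_add_left, ContinuousLinearMap.adjoint_inner_left, inner_add_left,
    real_inner_smul_left, real_inner_self_eq_norm_sq, real_inner_comm (G v) (H (G v))] at h1
  linarith

/-- The adjoint of G sends the residual to -ν v, and it is bounded below by σ. When ν is itself
small, the residual is of second order. -/
lemma norm_residual_le (hv : RegStep G H q ν v)
    (hσ : ∀ z, σ * ‖z‖ ≤ ‖ContinuousLinearMap.adjoint G z‖) :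
    σ * ‖q + H (G v)‖ ≤ ν * ‖v‖ := by
  refine (hσ _).trans_eq ?_
  rw [eq_neg_of_add_eq_zero_right hv.stationary, norm_neg, norm_smul,
    Real.norm_of_nonneg hv.reg_pos.le]

lemma norm_image_le (hv : RegStep G H q ν v)
    (hμ : ∀ y, μ * ‖y‖ ^ 2 ≤ inner ℝ y (H y)) : μ * ‖G v‖ ≤ ‖q‖ := by
  have h1 := hv.inner_eq
  have h2 := hμ (G v)
  have h3 := neg_le_of_abs_le (abs_real_inner_le_norm q (G v))
  have h4 := mul_nonneg hv.reg_pos.le (sq_nonneg ‖v‖)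
  rcases (norm_nonneg (G v)).eq_or_lt with h0 | h0
  · rw [← h0, mul_zero]; exact norm_nonneg _
  refine le_of_mul_le_mul_right (a := ‖G v‖) ?_ h0
  nlinarith

/-- The bound on the step does not involve ν. It allows ν to be chosen from |q| before v is known,
and it later keeps the gains bounded as ν tends to 0. -/
lemma norm_le_of_gradient (hv : RegStep G H q ν v) (hμ0 : 0 < μ)
    (hμ : ∀ y, μ * ‖y‖ ^ 2 ≤ inner ℝ y (H y))
    (hσ : ∀ z, σ * ‖z‖ ≤ ‖ContinuousLinearMap.adjoint G z‖) : σ * μ * ‖v‖ ≤ ‖q‖ := by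
  have h1 := mul_le_mul_of_nonneg_left (hv.mul_norm_le hσ) hμ0.le
  linarith [hv.norm_image_le hμ]

/-- The squared local norm of the linearized displacement is at most the squared decrement. -/
lemma inner_image_le (hv : RegStep G H q ν v)
    (hs : ∀ a b, inner ℝ (H a) b = inner ℝ a (H b)) (hp : ∀ a, 0 ≤ inner ℝ a (H a))
    {m : F} (hm : H m = q) : inner ℝ (G v) (H (G v)) ≤ inner ℝ q m := by
  have h1 := inner_apply_sq_le hs hp (G v) m
  have h2 := hv.inner_eq
  have h3 := mul_nonneg hv.reg_pos.le (sq_nonneg ‖v‖)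
  rw [hm, real_inner_comm q m, real_inner_comm q (G v)] at h1
  rcases (hp (G v)).eq_or_lt with h0 | h0
  · rw [← h0, ← hm, real_inner_comm]; exact hp m
  refine le_of_mul_le_mul_left (a := inner ℝ (G v) (H (G v))) ?_ h0
  nlinarith

/-- The predicted decrease dominates the squared norm of the gradient. -/
lemma norm_gradient_sq_le (hv : RegStep G H q ν v) (hσ0 : 0 < σ)
    (hσ : ∀ z, σ * ‖z‖ ≤ ‖ContinuousLinearMap.adjoint G z‖)
    (hs : ∀ a b, inner ℝ (H a) b = inner ℝ a (H b)) (hp : ∀ a, 0 ≤ inner ℝ a (H a))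
    {L : ℝ} (hL : ‖H‖ ≤ L) :
    ‖q‖ ^ 2 ≤ (L + ν / σ ^ 2) * -inner ℝ q (G v) := by
  have hν := hv.reg_pos
  have h1 := norm_apply_sq_le hs hp hL (G v)
  have h2 : ‖q + H (G v)‖ ^ 2 ≤ ν / σ ^ 2 * (ν * ‖v‖ ^ 2) := by
    have h := pow_le_pow_left₀ (by positivity) (hv.norm_residual_le hσ) 2
    rw [div_mul_eq_mul_div, le_div_iff₀ (by positivity)]
    nlinarith
  have h3 : ‖q‖ ≤ ‖q + H (G v)‖ + ‖H (G v)‖ := by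
    simpa using norm_sub_le (q + H (G v)) (H (G v))
  rw [hv.inner_eq]
  set a := inner ℝ (G v) (H (G v))
  set X := ‖q + H (G v)‖
  set Y := ‖H (G v)‖
  set b := ν * ‖v‖ ^ 2
  set k := ν / σ ^ 2
  have ha : 0 ≤ a := hp _
  have hb : 0 ≤ b := by positivity
  have hk : 0 ≤ k := by positivity
  have hL0 : 0 ≤ L := (norm_nonneg _).trans hL
  have hX : 0 ≤ X := norm_nonneg _
  have hY : 0 ≤ Y := norm_nonneg _
  -- From X² ≤ k b and Y² ≤ L a, the arithmetic-geometric mean inequality gives 2XY ≤ k a + L b. So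
  -- (X + Y)² ≤ (L + k)(a + b), and a + b is the predicted decrease.
  have h4 : (X * Y) ^ 2 ≤ (k * b) * (L * a) := by
    rw [mul_pow]; exact mul_le_mul h2 h1 (by positivity) (by positivity)
  have h5 : 2 * (X * Y) ≤ k * a + L * b := by
    refine abs_le_of_sq_le_sq' (b := k * a + L * b) ?_ (by positivity) |>.2
    nlinarith [sq_nonneg (k * a - L * b)]
  have h6 : ‖q‖ ^ 2 ≤ (X + Y) ^ 2 := pow_le_pow_left₀ (norm_nonneg _) h3 2
  nlinarith

end RegStep

/-- A differentiable, `lg`-Lipschitz map with an `Lg`-Lipschitz derivative, whose derivatives are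
surjective, uniformly. -/
structure SmoothSubmersion (g : E → F) (lg Lg : ℝ≥0) (σ : ℝ) : Prop where
  diff : Differentiable ℝ g
  lip : LipschitzWith lg g
  smooth : LipschitzWith Lg (fderiv ℝ g)
  pos : 0 < σ
  surj : ∀ u z, σ * ‖z‖ ≤ ‖ContinuousLinearMap.adjoint (fderiv ℝ g u) z‖

variable {g : E → F} {h : F → ℝ} {lg Lg L M : ℝ≥0} {σ μ ν η : ℝ} {u v w : E}

lemma SmoothSubmersion.norm_sub_le_of_near (hg : SmoothSubmersion g lg Lg σ)
    (hw : ‖w - v‖ ≤ η * ‖v‖ ^ 2) :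
    ‖g (u + w) - g (u + v)‖ ≤ lg * η * ‖v‖ ^ 2 := by
  calc _ ≤ lg * ‖u + w - (u + v)‖ := hg.lip.norm_sub_le _ _
    _ ≤ lg * (η * ‖v‖ ^ 2) := by rw [add_sub_add_left_eq_sub]; gcongr
    _ = _ := by ring

/-- Sufficient decrease of the composition `h ∘ g`, for a step `w` close to the minimizer `v` of
the regularized model. -/
lemma apply_step_le (hh : SmoothCost h L M μ) (hg : SmoothSubmersion g lg Lg σ)
    (hv : RegStep (fderiv ℝ g u) (fderiv ℝ (gradient h) (g u)) (gradient h (g u)) ν v)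
    (hw : ‖w - v‖ ≤ η * ‖v‖ ^ 2)
    (hν : (Lg + 2 * (lg * η)) * (‖gradient h (g u)‖ + L * (lg * ‖v‖)) + M * lg ^ 3 * ‖v‖ / 3
      + L * (lg * η) ^ 2 * ‖v‖ ^ 2 ≤ ν) :
    h (g (u + w)) ≤ h (g u) + 1 / 2 * inner ℝ (gradient h (g u)) (fderiv ℝ g u v) := by
  set q := gradient h (g u)
  set H := fderiv ℝ (gradient h) (g u)
  set a := fderiv ℝ g u v with ha
  set b := g (u + v) - g u with hb
  set c := g (u + w) - g (u + v) with hc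
  set V := ‖v‖
  have hV : 0 ≤ V := norm_nonneg _
  have hc1 : ‖c‖ ≤ lg * η * V ^ 2 := hg.norm_sub_le_of_near hw
  have hb1 : ‖b‖ ≤ lg * V := by simpa using hg.lip.norm_sub_le (u + v) u
  have ha1 : ‖a‖ ≤ lg * V :=
    ContinuousLinearMap.le_of_opNorm_le _ (norm_fderiv_le_of_lipschitz ℝ hg.lip) _
  have hab : ‖b - a‖ ≤ Lg / 2 * V ^ 2 := norm_sub_fderiv_le hg.diff hg.smooth u v
  have hx1 : g u + b = g (u + v) := by rw [hb]; abel
  have hx2 : g (u + v) + c = g (u + w) := by rw [hc]; abel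
  -- The displacement of the exact step, b, is of first order and needs the third order expansion of
  -- `h`. The correction c is already O(V²), so the descent lemma suffices for it.
  have e1 := apply_add_le_of_lipschitz_hessian hh.diff hh.grad_diff hh.hess_lip (g u) b
  have e2 := apply_add_le_of_lipschitz_gradient hh.diff hh.grad_lip (g (u + v)) c
  rw [hx1] at e1
  rw [hx2] at e2
  clear_value b c
  have e3 : inner ℝ (gradient h (g (u + v))) c ≤ (‖q‖ + L * (lg * V)) * (lg * η * V ^ 2) := by
    have h1 : ‖gradient h (g (u + v))‖ ≤ ‖q‖ + L * (lg * V) := by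
      have h2 := hh.grad_lip.norm_sub_le (g (u + v)) (g u)
      have h3 := norm_le_norm_add_norm_sub' (gradient h (g (u + v))) q
      have h4 : (L : ℝ) * ‖g (u + v) - g u‖ ≤ L * (lg * V) := by rw [← hb]; gcongr
      linarith
    exact (real_inner_le_norm _ _).trans (by gcongr)
  have e4 : inner ℝ q b ≤ inner ℝ q a + ‖q‖ * (Lg / 2 * V ^ 2) := by
    have h1 := real_inner_le_norm q (b - a)
    rw [inner_sub_right] at h1
    have h2 : ‖q‖ * ‖b - a‖ ≤ ‖q‖ * (Lg / 2 * V ^ 2) := by gcongr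
    linarith
  have e5 : inner ℝ b (H b) ≤ inner ℝ a (H a) + L * (Lg * lg) * V ^ 3 := by
    have h1 : inner ℝ b (H b) - inner ℝ a (H a) = inner ℝ (b - a) (H (b + a)) := by
      rw [map_add, inner_sub_left, inner_add_right, inner_add_right, ← hh.symm (g u) b a,
        real_inner_comm a (H b)]
      ring
    have h2 : ‖H (b + a)‖ ≤ L * (lg * V + lg * V) :=
      ContinuousLinearMap.le_of_opNorm_le_of_le _ (hh.norm_hess_le _) (norm_add_le_of_le hb1 ha1)
    have h3 := real_inner_le_norm (b - a) (H (b + a))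
    have h4 : ‖b - a‖ * ‖H (b + a)‖ ≤ (Lg / 2 * V ^ 2) * (L * (lg * V + lg * V)) := by gcongr
    linarith
  have e6 : M / 6 * ‖b‖ ^ 3 ≤ M / 6 * (lg * V) ^ 3 := by gcongr
  have e7 : (L / 2 : ℝ) * ‖c‖ ^ 2 ≤ L / 2 * (lg * η * V ^ 2) ^ 2 := by gcongr
  have e8 := hv.inner_eq
  -- By `inner_eq`, the value of the model at a is ⟨q, a⟩/2 - ν V²/2. The errors collected above sum
  -- exactly to V²/2 times the left side of `hν`, so the term -ν V²/2 absorbs them.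
  have e9 := mul_le_mul_of_nonneg_right hν (sq_nonneg V)
  simp only [← ha] at e8 e1
  nlinarith

/-- The contraction of the decrement, in terms of the residual `ψ` of the regularized model, of the
error `r` of the linearization, and of the displacement `d`. -/
lemma sqrt_inner_le (hh : SmoothCost h L M μ) {x a r m' : F}
    (hm' : fderiv ℝ (gradient h) (x + (a + r)) m' = gradient h (x + (a + r)))
    (hd : M * ‖a + r‖ ≤ 3 / 4 * μ) :
    √(inner ℝ (gradient h (x + (a + r))) m')
      ≤ 2 * ((‖gradient h x + fderiv ℝ (gradient h) x a‖ + M / 2 * ‖a + r‖ ^ 2) / √μ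
        + √L * ‖r‖) := by
  have hμ := hh.pos
  set q := gradient h x
  set q' := gradient h (x + (a + r))
  set H := fderiv ℝ (gradient h) x
  set H' := fderiv ℝ (gradient h) (x + (a + r))
  set N := √(inner ℝ m' (H m'))
  set Λ := √(inner ℝ q' m')
  have hp : ∀ y, 0 ≤ inner ℝ y (H y) := fun y =>
    (mul_nonneg hμ.le (sq_nonneg _)).trans (hh.le_inner_hess x y)
  have hN : N ^ 2 = inner ℝ m' (H m') := Real.sq_sqrt (hp m')
  have hN0 : 0 ≤ N := Real.sqrt_nonneg _
  have hΛ0 : 0 ≤ Λ := Real.sqrt_nonneg _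
  have hin : inner ℝ q' m' = inner ℝ m' (H' m') := by rw [hm', real_inner_comm]
  have hΛ : Λ ^ 2 = inner ℝ m' (H' m') := by
    rw [← hin]
    exact Real.sq_sqrt (hin ▸ (mul_nonneg hμ.le (sq_nonneg _)).trans (hh.le_inner_hess _ m'))
  have hmN : √μ * ‖m'‖ ≤ N := by
    refine Real.le_sqrt_of_sq_le ?_
    rw [mul_pow, Real.sq_sqrt hμ.le]
    exact hh.le_inner_hess x m'
  have hμ' : 0 < √μ := Real.sqrt_pos.2 hμ
  -- comparison of the two local norms
  have hcmp : N ≤ 2 * Λ := by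
    have h1 : inner ℝ m' (H m') - inner ℝ m' (H' m') ≤ M * ‖a + r‖ * ‖m'‖ ^ 2 := by
      rw [← inner_sub_right, ← sub_apply]
      have h2 := hh.hess_lip.norm_sub_le x (x + (a + r))
      rw [sub_add_cancel_left, norm_neg] at h2
      calc _ ≤ ‖m'‖ * ‖(H - H') m'‖ := real_inner_le_norm _ _
        _ ≤ ‖m'‖ * (M * ‖a + r‖ * ‖m'‖) := by
          gcongr; exact ContinuousLinearMap.le_of_opNorm_le _ h2 _
        _ = _ := by ring
    -- H - H' is at most 3μ/4, hence at most 3H/4, as a form at m'. So H ≤ 4 H' there, which is the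
    -- factor 2 between N and Λ.
    have h3 := mul_le_mul_of_nonneg_right hd (sq_nonneg ‖m'‖)
    have h4 := hh.le_inner_hess x m'
    refine abs_le_of_sq_le_sq' ?_ (by positivity) |>.2
    nlinarith
  -- the new gradient
  set R := q' - q - H (a + r) with hR
  have hR1 : ‖R‖ ≤ M / 2 * ‖a + r‖ ^ 2 :=
    norm_sub_fderiv_le hh.grad_diff hh.hess_lip x (a + r)
  have hq' : q' = (q + H a) + R + H r := by rw [hR, map_add]; abel
  -- The decomposition of q' is tested against m'. The term H r is moved to the other side as ⟨r, H
  -- m'⟩, where |H m'| ≤ √L N costs only √L instead of L/√μ.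
  have h5 : Λ ^ 2 ≤ (‖q + H a‖ + M / 2 * ‖a + r‖ ^ 2) * ‖m'‖ + ‖r‖ * (√L * N) := by
    rw [hΛ, ← hin, hq', inner_add_left, hh.symm x r m']
    have h6 : ‖q + H a + R‖ ≤ ‖q + H a‖ + M / 2 * ‖a + r‖ ^ 2 := norm_add_le_of_le le_rfl hR1
    have h7 : ‖H m'‖ ≤ √L * N := by
      refine abs_le_of_sq_le_sq' ?_ (by positivity) |>.2
      rw [mul_pow, Real.sq_sqrt L.coe_nonneg, hN]
      exact norm_apply_sq_le (hh.symm x) hp (hh.norm_hess_le x) m'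
    exact add_le_add ((real_inner_le_norm _ _).trans (by gcongr))
      ((real_inner_le_norm _ _).trans (by gcongr))
  have h8 : (‖q + H a‖ + M / 2 * ‖a + r‖ ^ 2) * ‖m'‖
      ≤ (‖q + H a‖ + M / 2 * ‖a + r‖ ^ 2) / √μ * N := by
    rw [div_mul_eq_mul_div _ (√μ), le_div_iff₀ hμ', mul_assoc]
    gcongr
    linarith
  set K := (‖q + H a‖ + M / 2 * ‖a + r‖ ^ 2) / √μ
  have hK : 0 ≤ K + √L * ‖r‖ := by positivity
  have h9 : Λ ^ 2 ≤ (K + √L * ‖r‖) * (2 * Λ) := by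
    calc Λ ^ 2 ≤ (K + √L * ‖r‖) * N := by nlinarith
      _ ≤ _ := by gcongr
  rcases hΛ0.eq_or_lt with h0 | h0
  · rw [← h0]; positivity
  · refine le_of_mul_le_mul_right (a := Λ) ?_ h0
    nlinarith

end Step

end OptControl

namespace OptControl

/-! ### Algebra of the normalized constants. -/

namespace Consts

/-- The sign conditions on the constants. -/
structure Admissible (c : Consts) : Prop where
  μh_pos : 0 < c.μh
  Lh_nonneg : 0 ≤ c.Lh
  Mh_nonneg : 0 ≤ c.Mh
  lg_nonneg : 0 ≤ c.lg
  Lg_pos : 0 < c.Lg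
  σg_pos : 0 < c.σg
  η_nonneg : 0 ≤ c.η

lemma rpow_three_halves {x : ℝ} (hx : 0 ≤ x) : x ^ (3 / 2 : ℝ) = √x ^ 3 := by
  rw [Real.sqrt_eq_rpow, ← Real.rpow_natCast, ← Real.rpow_mul hx]
  norm_num

namespace Admissible

variable {c : Consts}

lemma ρh_nonneg (hc : c.Admissible) : 0 ≤ c.ρh := div_nonneg hc.Lh_nonneg hc.μh_pos.le

lemma ρg_nonneg (hc : c.Admissible) : 0 ≤ c.ρg := div_nonneg hc.lg_nonneg hc.σg_pos.le

lemma θh_nonneg (hc : c.Admissible) : 0 ≤ c.θh :=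
  div_nonneg hc.Mh_nonneg (mul_nonneg zero_le_two (Real.rpow_nonneg hc.μh_pos.le _))

lemma sqrt_μh_pos (hc : c.Admissible) : 0 < √c.μh := Real.sqrt_pos.2 hc.μh_pos

lemma θg_pos (hc : c.Admissible) : 0 < c.θg :=
  div_pos hc.Lg_pos (mul_pos (pow_pos hc.σg_pos 2) hc.sqrt_μh_pos)

lemma χ_nonneg (hc : c.Admissible) : 0 ≤ c.χ :=
  div_nonneg (mul_nonneg hc.lg_nonneg hc.η_nonneg) hc.Lg_pos.le

lemma one_add_le_β (hc : c.Admissible) : 1 + 2 * c.χ ≤ c.β := by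
  have h1 := hc.ρh_nonneg
  have h2 := hc.ρg_nonneg
  have h3 := hc.χ_nonneg
  have h4 := hc.θh_nonneg
  have h5 := hc.θg_pos
  have h6 : 0 ≤ c.ρg ^ 3 * (2 * c.θh) / (3 * c.θg) := by positivity
  have h7 : 0 ≤ c.ρh * c.ρg * (1 + 2 * c.χ) := by positivity
  unfold β
  linarith

lemma β_pos (hc : c.Admissible) : 0 < c.β := by
  linarith [hc.one_add_le_β, hc.χ_nonneg]

lemma reg_nonneg (hc : c.Admissible) {x : ℝ} (hx : 0 ≤ x) : 0 ≤ c.reg x := by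
  have h1 := hc.ρh_nonneg
  have h2 := hc.β_pos
  have h3 := hc.Lg_pos
  unfold reg
  positivity

lemma reg_pos (hc : c.Admissible) {x : ℝ} (hx : 0 < x) : 0 < c.reg x := by
  have h1 := hc.ρh_nonneg
  have h2 := hc.β_pos
  have h3 := hc.Lg_pos
  unfold reg
  positivity

/-- Removes the normalization: β is what the part of the Taylor error linear in V becomes once V is
replaced by its bound x/(σμ). `quad_coeff` is its counterpart for the part quadratic in V. -/
lemma Lg_mul_β (hc : c.Admissible) :
    c.Lg * c.β = (c.Lg + 2 * (c.lg * c.η)) * (1 + c.Lh * c.lg / (c.σg * c.μh))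
      + c.Mh * c.lg ^ 3 / (3 * (c.σg * c.μh)) := by
  have h1 := hc.sqrt_μh_pos
  have h2 := hc.Lg_pos
  have h3 := hc.σg_pos
  unfold β ρh ρg χ θh θg
  rw [rpow_three_halves hc.μh_pos.le]
  rw [show c.μh = √c.μh ^ 2 from (Real.sq_sqrt hc.μh_pos.le).symm]
  rw [Real.sqrt_sq h1.le]
  generalize √c.μh = s at *
  field_simp

lemma quad_coeff (hc : c.Admissible) :
    c.ρh * c.σg ^ 2 * c.θg ^ 2 * c.χ ^ 2 = c.Lh * (c.lg * c.η) ^ 2 / (c.σg * c.μh) ^ 2 := by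
  have h1 := hc.sqrt_μh_pos
  have h2 := hc.Lg_pos
  have h3 := hc.σg_pos
  unfold ρh χ θg
  rw [show c.μh = √c.μh ^ 2 from (Real.sq_sqrt hc.μh_pos.le).symm]
  rw [Real.sqrt_sq h1.le]
  generalize √c.μh = s at *
  field_simp

/-- The regularization dominates the error terms of the regularized model. -/
lemma error_le_reg (hc : c.Admissible) {x V : ℝ} (hV : 0 ≤ V) (hVx : c.σg * c.μh * V ≤ x) :
    (c.Lg + 2 * (c.lg * c.η)) * (x + c.Lh * (c.lg * V)) + c.Mh * c.lg ^ 3 * V / 3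
      + c.Lh * (c.lg * c.η) ^ 2 * V ^ 2 ≤ c.reg x := by
  have h0 : 0 < c.σg * c.μh := mul_pos hc.σg_pos hc.μh_pos
  have hVx' : V ≤ x / (c.σg * c.μh) := by rw [le_div_iff₀ h0]; linarith
  have h1 := hc.Lh_nonneg
  have h2 := hc.Mh_nonneg
  have h3 := hc.lg_nonneg
  have h4 := hc.Lg_pos
  have h5 := hc.η_nonneg
  unfold reg
  rw [hc.Lg_mul_β, hc.quad_coeff]
  set W := x / (c.σg * c.μh)
  calc _ ≤ (c.Lg + 2 * (c.lg * c.η)) * (x + c.Lh * (c.lg * W)) + c.Mh * c.lg ^ 3 * W / 3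
      + c.Lh * (c.lg * c.η) ^ 2 * W ^ 2 := by gcongr
    _ = _ := by simp only [W]; ring

/-- In terms of x/√μ the factor becomes a polynomial in the dimensionless constants. This is the
scale of √(2δ), since 2δ ≤ x²/μ. -/
lemma reg_div (hc : c.Admissible) (x : ℝ) :
    c.Lh + c.reg x / c.σg ^ 2 = c.μh * (c.ρh + c.θg * c.β * (x / √c.μh)
      + c.ρh * c.θg ^ 2 * c.χ ^ 2 * (x / √c.μh) ^ 2) := by
  have h1 := hc.sqrt_μh_pos
  have h2 := hc.Lg_pos
  have h3 := hc.σg_pos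
  unfold reg
  generalize c.β = b
  generalize c.χ = χ
  unfold ρh θg
  rw [show c.μh = √c.μh ^ 2 from (Real.sq_sqrt hc.μh_pos.le).symm]
  rw [Real.sqrt_sq h1.le]
  generalize √c.μh = s at *
  field_simp
  ring

/-- The decrease `D` of the objective in terms of the gap `δ`, if `x` is the norm of the
gradient. -/
lemma gap_le (hc : c.Admissible) {x δ D : ℝ} (hx : 0 ≤ x) (hδ : 0 ≤ δ)
    (hδx : δ ≤ x ^ 2 / (2 * c.μh)) (hD : x ^ 2 ≤ (c.Lh + c.reg x / c.σg ^ 2) * (2 * D)) :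
    δ ≤ (c.ρh + c.θg * c.β * √(2 * δ) + c.ρh * c.θg ^ 2 * c.χ ^ 2 * (2 * δ)) * D := by
  have h1 := hc.sqrt_μh_pos
  have hμ := hc.μh_pos
  rw [hc.reg_div] at hD
  set X := x / √c.μh with hX
  have hxX : x = √c.μh * X := by rw [hX]; field_simp
  have hx2 : x ^ 2 = c.μh * X ^ 2 := by rw [hxX, mul_pow, Real.sq_sqrt hμ.le]
  have hX0 : 0 ≤ X := by positivity
  set t := √(2 * δ)
  have ht0 : 0 ≤ t := Real.sqrt_nonneg _
  have ht2 : t ^ 2 = 2 * δ := Real.sq_sqrt (by positivity)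
  rw [hx2] at hD hδx
  have htX : t ≤ X := by
    refine abs_le_of_sq_le_sq' ?_ hX0 |>.2
    rw [ht2]
    rw [le_div_iff₀ (by positivity)] at hδx
    nlinarith
  have hb : 0 < c.θg * c.β := mul_pos hc.θg_pos hc.β_pos
  have hr := hc.ρh_nonneg
  have hk : 0 ≤ c.ρh * c.θg ^ 2 * c.χ ^ 2 := by positivity
  rw [← ht2]
  set b := c.θg * c.β
  set k := c.ρh * c.θg ^ 2 * c.χ ^ 2
  have hD' : X ^ 2 ≤ (c.ρh + b * X + k * X ^ 2) * (2 * D) := by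
    refine le_of_mul_le_mul_left ?_ hμ
    linarith
  rcases hX0.eq_or_lt with h0 | h0
  · have : t = 0 := le_antisymm (h0 ▸ htX) ht0
    rw [this] at ht2 ⊢
    have hδ0 : δ = 0 := by linarith
    rw [hδ0]
    have hxx : x = 0 := by rw [hxX, ← h0, mul_zero]
    rcases hr.eq_or_lt with h | h
    · rw [← h]; simp
    · have : 0 ≤ c.ρh * (2 * D) := by simpa [← h0] using hD'
      simp only [ne_eq, OfNat.ofNat_ne_zero, not_false_eq_true, zero_pow, mul_zero, add_zero]
      linarith
  · have hpos : 0 < c.ρh + b * X + k * X ^ 2 := by positivity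
    -- X ↦ X²/(ρ + bX + kX²) is nondecreasing and t ≤ X, so the gradient norm can be replaced by its
    -- lower bound √(2δ).
    have h3 : t ^ 2 * (c.ρh + b * X + k * X ^ 2) ≤ X ^ 2 * (c.ρh + b * t + k * t ^ 2) := by
      have e1 : t ^ 2 * c.ρh ≤ X ^ 2 * c.ρh := by gcongr
      have e2 : b * (t * X) * t ≤ b * (t * X) * X := by gcongr
      nlinarith
    have h4 : X ^ 2 * (c.ρh + b * t + k * t ^ 2)
        ≤ (c.ρh + b * X + k * X ^ 2) * (2 * D) * (c.ρh + b * t + k * t ^ 2) := by gcongr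
    have h5 : (c.ρh + b * X + k * X ^ 2) * t ^ 2
        ≤ (c.ρh + b * X + k * X ^ 2) * ((2 * D) * (c.ρh + b * t + k * t ^ 2)) := by linarith
    have h6 := le_of_mul_le_mul_left h5 hpos
    linarith

/-- The denominator of the radii of quadratic convergence. -/
lemma denom_pos (hc : c.Admissible) (hρ : 0 < c.ρh) :
    0 < c.θg * √c.ρh * (2 + 2 * c.β + √c.ρh * c.χ) + 4 * c.θh := by
  have h1 := hc.θg_pos
  have h2 := hc.β_pos
  have h3 := hc.χ_nonneg
  have h4 := hc.θh_nonneg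
  have h5 := Real.sqrt_pos.2 hρ
  positivity

lemma lamBar_nonneg (hc : c.Admissible) : 0 ≤ c.lamBar := by
  have h1 := hc.θg_pos
  have h2 := hc.β_pos
  have h3 := hc.χ_nonneg
  have h4 := hc.θh_nonneg
  unfold lamBar
  positivity

lemma lamBar_pos (hc : c.Admissible) (hρ : 0 < c.ρh) : 0 < c.lamBar := by
  have := hc.denom_pos hρ
  unfold lamBar
  positivity

lemma δBar_pos (hc : c.Admissible) (hρ : 0 < c.ρh) : 0 < c.δBar := by
  have := hc.denom_pos hρ
  unfold δBar
  positivity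

/-- δ̄ is calibrated for this identity: the squared decrement is at most 2ρ_h times the gap. -/
lemma lamBar_sq (hc : c.Admissible) (hρ : 0 < c.ρh) : c.lamBar ^ 2 = 2 * c.ρh * c.δBar := by
  have := hc.denom_pos hρ
  unfold lamBar δBar
  generalize c.θg * √c.ρh * (2 + 2 * c.β + √c.ρh * c.χ) + 4 * c.θh = D at *
  field_simp
  norm_num

/-- The estimates behind the quadratic convergence, where `V`, `ψ`, `r` and `d` bound the norms of
the step, of the residual of the model, of the linearization error and of the displacement. -/
lemma quadratic_estimates (hc : c.Admissible) (hρ : 1 ≤ c.ρh) {x l V ψ r d : ℝ} (hx : 0 ≤ x)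
    (hl : 0 ≤ l) (hV0 : 0 ≤ V) (hr0 : 0 ≤ r) (hd0 : 0 ≤ d) (hlb : l ≤ c.lamBar)
    (hxl : x ^ 2 ≤ c.Lh * l ^ 2)
    (hV : c.σg * √c.μh * V ≤ l) (hψ : c.σg * ψ ≤ c.reg x * V)
    (hr : r ≤ (c.Lg / 2 + c.lg * c.η) * V ^ 2) (hd : d ≤ l / √c.μh + r) :
    c.Mh * d ≤ 3 / 4 * c.μh ∧
      2 * ((ψ + c.Mh / 2 * d ^ 2) / √c.μh + √c.Lh * r) ≤ l ^ 2 / (2 * c.lamBar) := by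
  have hs := hc.sqrt_μh_pos
  have hμ := hc.μh_pos
  have hσ := hc.σg_pos
  have hLg := hc.Lg_pos
  have hM := hc.Mh_nonneg
  have hL := hc.Lh_nonneg
  have hθg := hc.θg_pos
  have hθh := hc.θh_nonneg
  have hχ := hc.χ_nonneg
  have hβ := hc.one_add_le_β
  have hD := hc.denom_pos (by linarith)
  have hρ1 : 1 ≤ √c.ρh := Real.one_le_sqrt.2 hρ
  set s := √c.μh with hsdef
  set R := √c.ρh with hR
  have hR2 : R ^ 2 = c.ρh := Real.sq_sqrt hc.ρh_nonneg
  have hs2 : s ^ 2 = c.μh := Real.sq_sqrt hμ.le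
  have hLR : √c.Lh = R * s := by
    rw [hR, hsdef, ← Real.sqrt_mul hc.ρh_nonneg, ρh, div_mul_cancel₀ _ hμ.ne']
  set D := c.θg * R * (2 + 2 * c.β + R * c.χ) + 4 * c.θh with hDdef
  have hlam : c.lamBar = 1 / (4 * D) := rfl
  have hlD : 4 * (l * D) ≤ 1 := by
    rw [hlam, le_div_iff₀ (by positivity)] at hlb
    linarith
  -- the constants in terms of the normalized ones
  have eLg : c.Lg = c.θg * (c.σg ^ 2 * s) := by
    unfold θg; rw [← hsdef]; field_simp
  have eη : c.lg * c.η = c.χ * c.Lg := by unfold χ; field_simp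
  have eM : c.Mh = 2 * c.θh * s ^ 3 := by
    unfold θh
    rw [rpow_three_halves hμ.le, ← hsdef]; field_simp
  have hβ0 : 0 < c.β := hc.β_pos
  -- pieces of `D`
  have p1 : 0 ≤ c.θg * R := by positivity
  have d1 : c.θg * R * (2 * c.β) ≤ D := by
    have : 0 ≤ c.θg * R * (2 + R * c.χ) := by positivity
    rw [hDdef]; linarith
  have d2 : c.θg * R * (R * c.χ) ≤ D := by
    have : 0 ≤ c.θg * R * (2 + 2 * c.β) := by positivity
    rw [hDdef]; linarith
  have d3 : 4 * c.θh ≤ D := by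
    have : 0 ≤ c.θg * R * (2 + 2 * c.β + R * c.χ) := by positivity
    linarith
  -- the step
  have hV2 : c.σg ^ 2 * s ^ 2 * V ^ 2 ≤ l ^ 2 := by
    have := pow_le_pow_left₀ (by positivity) hV 2
    linarith [mul_pow (c.σg * s) V 2, mul_pow c.σg s 2]
  -- the linearization error
  have hrs : s * r ≤ c.θg * (1 / 2 + c.χ) * l ^ 2 := by
    have h1 : s * r ≤ s * ((c.Lg / 2 + c.lg * c.η) * V ^ 2) := by gcongr
    have h2 : s * ((c.Lg / 2 + c.lg * c.η) * V ^ 2)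
        = c.θg * (1 / 2 + c.χ) * (c.σg ^ 2 * s ^ 2 * V ^ 2) := by
      rw [eη, eLg]; ring
    have h3 : c.θg * (1 / 2 + c.χ) * (c.σg ^ 2 * s ^ 2 * V ^ 2)
        ≤ c.θg * (1 / 2 + c.χ) * l ^ 2 := by gcongr
    exact h1.trans (h2.trans_le h3)
  have hrs' : R * (s * r) ≤ c.θg * R * (c.β / 2) * l ^ 2 := by
    calc R * (s * r) ≤ R * (c.θg * (1 / 2 + c.χ) * l ^ 2) := by gcongr
      _ = c.θg * R * (1 / 2 + c.χ) * l ^ 2 := by ring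
      _ ≤ c.θg * R * (c.β / 2) * l ^ 2 := by gcongr; linarith
  -- The coefficient θ_g R β/2 of the bound above is a quarter of a summand of D, and l D ≤ 1/4. So
  -- r is a small perturbation of the linear displacement.
  have hsr16 : s * r ≤ l / 16 := by
    have h1 : s * r ≤ R * (s * r) := le_mul_of_one_le_left (by positivity) hρ1
    have h2 : c.θg * R * (2 * c.β) * l ^ 2 ≤ D * l ^ 2 := by gcongr
    have h3 : l * (4 * (l * D)) ≤ l * 1 := by gcongr
    linarith only [h1, h2, h3, hrs']
  have hsd : s * d ≤ 5 / 4 * l := by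
    have h1 : s * d ≤ s * (l / s + r) := by gcongr
    have h2 : s * (l / s + r) = l + s * r := by field_simp
    linarith only [h1, h2, hsr16, hl]
  have hsd0 : 0 ≤ s * d := by positivity
  have hθl : c.θh * l ≤ 1 / 16 := by
    have : 4 * c.θh * l ≤ D * l := by gcongr
    linarith
  refine ⟨?_, ?_⟩
  · have h1 : c.Mh * d = 2 * (c.θh * (s * d)) * s ^ 2 := by rw [eM]; ring
    have h2 : c.θh * (s * d) ≤ c.θh * (5 / 4 * l) := by gcongr
    rw [h1, hs2]
    have h3 : 2 * (c.θh * (s * d)) ≤ 3 / 4 := by linarith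
    gcongr
  · -- the residual
    have hxs : x ≤ R * s * l := by
      refine abs_le_of_sq_le_sq' ?_ (by positivity) |>.2
      rw [mul_pow, ← hLR, Real.sq_sqrt hL]
      exact hxl
    -- The quadratic term of the regularization is the square of θ_g R² χ l. One of its factors is
    -- at most 1/4 because l ≤ λ̄, so it becomes linear in l.
    have hreg : c.reg x ≤ c.θg * R * (c.β + R * c.χ / 4) * l * (c.σg ^ 2 * s ^ 2) := by
      have h1 : c.reg x ≤ c.Lg * c.β * (R * s * l)
          + c.ρh * c.σg ^ 2 * c.θg ^ 2 * c.χ ^ 2 * (R * s * l) ^ 2 := by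
        have := hc.ρh_nonneg
        unfold reg
        gcongr
      have h2 : c.Lg * c.β * (R * s * l)
          + c.ρh * c.σg ^ 2 * c.θg ^ 2 * c.χ ^ 2 * (R * s * l) ^ 2
          = (c.θg * R * c.β * l + (c.θg * R * (R * c.χ)) * (R * l) * (c.θg * R * c.χ) * l)
            * (c.σg ^ 2 * s ^ 2) := by
        rw [eLg, ← hR2]; ring
      have h3 : c.θg * R * (R * c.χ) * l ≤ 1 / 4 := by
        have : c.θg * R * (R * c.χ) * l ≤ D * l := by gcongr
        linarith only [this, hlD]
      have h4 : (c.θg * R * (R * c.χ)) * (R * l) * (c.θg * R * c.χ) * l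
          = (c.θg * R * (R * c.χ) * l) * (c.θg * R * (R * c.χ) * l) := by ring
      have h5 : (c.θg * R * (R * c.χ) * l) * (c.θg * R * (R * c.χ) * l)
          ≤ 1 / 4 * (c.θg * R * (R * c.χ) * l) := by gcongr
      rw [h2, h4] at h1
      refine h1.trans ?_
      have h6 : c.θg * R * c.β * l + (c.θg * R * (R * c.χ) * l) * (c.θg * R * (R * c.χ) * l)
          ≤ c.θg * R * (c.β + R * c.χ / 4) * l := by linarith only [h5]
      gcongr
    have hψs : ψ / s ≤ c.θg * R * (c.β + R * c.χ / 4) * l ^ 2 := by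
      rw [div_le_iff₀ hs]
      refine le_of_mul_le_mul_left ?_ hσ
      have hK : 0 ≤ c.θg * R * (c.β + R * c.χ / 4) := by positivity
      generalize c.θg * R * (c.β + R * c.χ / 4) = K at hreg hK ⊢
      calc c.σg * ψ ≤ c.reg x * V := hψ
        _ ≤ K * l * (c.σg ^ 2 * s ^ 2) * V := by gcongr
        _ = K * l * (c.σg * s) * (c.σg * s * V) := by ring
        _ ≤ K * l * (c.σg * s) * l := by gcongr
        _ = c.σg * (K * l ^ 2 * s) := by ring
    have hRs : c.Mh / 2 * d ^ 2 / s ≤ 2 * c.θh * l ^ 2 := by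
      have h1 : c.Mh / 2 * d ^ 2 / s = c.θh * (s * d) ^ 2 := by
        rw [eM]; field_simp
      have h2 : c.θh * (s * d) ^ 2 ≤ c.θh * (5 / 4 * l) ^ 2 := by gcongr
      have h3 : 0 ≤ c.θh * l ^ 2 := by positivity
      rw [h1]
      linarith only [h2, h3]
    have h7 : l ^ 2 / (2 * c.lamBar) = 2 * (D * l ^ 2) := by
      rw [hlam]; field_simp; ring
    rw [h7, hLR, add_div]
    -- The coefficients of l² from the residual, from the Hessian variation and from the
    -- linearization error, in this order.
    have h8 : c.θg * R * (c.β + R * c.χ / 4) + 2 * c.θh + c.θg * R * (c.β / 2) ≤ D := by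
      have h9 : 0 ≤ c.θg * R * (2 + c.β / 2 + R * c.χ * (3 / 4)) + 2 * c.θh := by positivity
      rw [hDdef]; linarith only [h9]
    have h9 := mul_le_mul_of_nonneg_right h8 (sq_nonneg l)
    rw [add_mul, add_mul] at h9
    rw [mul_assoc R s r]
    exact mul_le_mul_of_nonneg_left ((add_le_add (add_le_add hψs hRs) hrs').trans h9) zero_le_two

end Admissible

end Consts

end OptControl

namespace OptControl

/-! ### Counting iterations. -/

namespace Consts

/-- For positive gaps, `phase` is a difference of values of one potential, hence telescopes along
the iterates. -/
lemma phase_add (c : Consts) {δ₀ δ₁ δ₂ : ℝ} (h₀ : 0 < δ₀) (h₁ : 0 < δ₁) (h₂ : 0 < δ₂) :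
    c.phase δ₀ δ₁ + c.phase δ₁ δ₂ = c.phase δ₀ δ₂ := by
  unfold phase
  rw [Real.log_div h₀.ne' h₁.ne', Real.log_div h₁.ne' h₂.ne', Real.log_div h₀.ne' h₂.ne']
  ring

namespace Admissible

variable {c : Consts}

lemma phase_nonneg (hc : c.Admissible) {δ δ' : ℝ} (h' : 0 < δ') (h : δ' ≤ δ) :
    0 ≤ c.phase δ δ' := by
  have h1 := hc.ρh_nonneg
  have h2 := hc.β_pos
  have h3 := hc.θg_pos
  have h4 : 0 ≤ Real.log (δ / δ') := Real.log_nonneg (by rwa [one_le_div h'])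
  have h5 : 0 ≤ √δ - √δ' := sub_nonneg.2 (Real.sqrt_le_sqrt h)
  have h6 : 0 ≤ δ - δ' := sub_nonneg.2 h
  unfold phase
  positivity

/-- One step of the first phase. -/
lemma one_le_phase (hc : c.Admissible) {δ δ' : ℝ} (h' : 0 < δ') (h : δ' ≤ δ)
    (hD : δ ≤ (c.ρh + c.θg * c.β * √(2 * δ) + c.ρh * c.θg ^ 2 * c.χ ^ 2 * (2 * δ)) * (δ - δ')) :
    1 ≤ c.phase δ δ' := by
  have h1 := hc.ρh_nonneg
  have h2 : 0 < c.θg * c.β := mul_pos hc.θg_pos hc.β_pos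
  have hδ : 0 < δ := h'.trans_le h
  -- The logarithm and the square root are concave, so their increments from δ' to δ are at least
  -- the derivative at δ times δ - δ'. The three terms then add up to the decrease rate divided by
  -- δ.
  have h4 : (δ - δ') / δ ≤ Real.log (δ / δ') := by
    have := Real.one_sub_inv_le_log_of_pos (div_pos hδ h')
    rw [inv_div] at this
    rwa [sub_div, div_self hδ.ne']
  have hs : 0 < √δ := Real.sqrt_pos.2 hδ
  have h5 : (δ - δ') / (2 * √δ) ≤ √δ - √δ' := by
    rw [div_le_iff₀ (by positivity)]
    nlinarith [sq_nonneg (√δ - √δ'), Real.sq_sqrt hδ.le, Real.sq_sqrt h'.le]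
  have h6 : 0 ≤ δ - δ' := sub_nonneg.2 h
  have h7 : √(2 * δ) ≤ 2 * √δ := by
    rw [Real.sqrt_le_left (by positivity), mul_pow, Real.sq_sqrt hδ.le]
    linarith
  have h8 : δ ≤ (2 * c.ρh + c.θg * c.β * (2 * √δ) + c.ρh * c.θg ^ 2 * c.χ ^ 2 * (2 * δ))
      * (δ - δ') := by
    refine hD.trans ?_
    gcongr
    linarith
  have h9 : 2 * c.ρh * ((δ - δ') / δ) + 4 * c.θg * c.β * ((δ - δ') / (2 * √δ))
      + 2 * c.ρh * c.θg ^ 2 * c.χ ^ 2 * (δ - δ')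
      = (2 * c.ρh + c.θg * c.β * (2 * √δ) + c.ρh * c.θg ^ 2 * c.χ ^ 2 * (2 * δ))
        * (δ - δ') / δ := by
    have : δ = √δ ^ 2 := (Real.sq_sqrt hδ.le).symm
    have e : (δ - δ') / (2 * √δ) = √δ * (δ - δ') / (2 * δ) := by
      rw [div_eq_div_iff (by positivity) (by positivity)]
      nth_rewrite 2 [this]
      ring
    rw [e]
    field_simp
    ring
  have h10 : 1 ≤ (2 * c.ρh + c.θg * c.β * (2 * √δ) + c.ρh * c.θg ^ 2 * c.χ ^ 2 * (2 * δ))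
        * (δ - δ') / δ := (one_le_div hδ).2 h8
  rw [← h9] at h10
  refine h10.trans ?_
  have h11 : 0 ≤ 4 * c.θg * c.β := by linarith
  unfold phase
  gcongr

/-- The number of steps of the first phase. -/
lemma exists_gap_le (hc : c.Admissible) (hρ : 0 < c.ρh) {δ : ℕ → ℝ} (hanti : Antitone δ)
    (hgap : ∀ k, δ k ≤ (c.ρh + c.θg * c.β * √(2 * δ k)
      + c.ρh * c.θg ^ 2 * c.χ ^ 2 * (2 * δ k)) * (δ k - δ (k + 1))) :
    ∃ K : ℕ, δ K ≤ c.δBar ∧ (K : ℝ) ≤ c.phase (max (δ 0) c.δBar) c.δBar + 1 := by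
  have hb := hc.δBar_pos hρ
  have hcount : ∀ n : ℕ, (∀ j ≤ n, c.δBar < δ j) → (n : ℝ) ≤ c.phase (δ 0) (δ n) := by
    intro n
    induction n with
    | zero =>
      intro h
      have h0 := h 0 le_rfl
      simpa using hc.phase_nonneg (hb.trans h0) le_rfl
    | succ n ih =>
      intro h
      have hp : ∀ j ≤ n + 1, 0 < δ j := fun j hj => hb.trans (h j hj)
      rw [← phase_add c (hp 0 (by simp)) (hp n (by simp)) (hp (n + 1) le_rfl)]
      push_cast
      exact add_le_add (ih fun j hj => h j (by omega))
        (hc.one_le_phase (hp (n + 1) le_rfl) (hanti (Nat.le_succ n)) (hgap n))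
  have hcount' : ∀ n : ℕ, (∀ j ≤ n, c.δBar < δ j) →
      (n : ℝ) ≤ c.phase (max (δ 0) c.δBar) c.δBar := by
    intro n h
    have h0 := h 0 n.zero_le
    have hn := h n le_rfl
    rw [max_eq_left h0.le, ← phase_add c (hb.trans h0) (hb.trans hn) hb]
    linarith [hcount n h, hc.phase_nonneg hb hn.le]
  have hex : ∃ K, δ K ≤ c.δBar := by
    by_contra! h
    obtain ⟨n, hn⟩ := exists_nat_gt (c.phase (max (δ 0) c.δBar) c.δBar)
    exact absurd (hcount' n fun j _ => h j) (not_le.2 hn)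
  classical
  -- The first index with gap at most δ̄ is 0 or some n + 1 for which all gaps up to n exceed δ̄.
  -- The count bounds n, whence the extra 1, later absorbed in r.
  refine ⟨Nat.find hex, Nat.find_spec hex, ?_⟩
  rcases hK : Nat.find hex with _ | n
  · have := hc.phase_nonneg hb (le_max_right (δ 0) c.δBar)
    push_cast
    linarith
  · push_cast
    have := hcount' n fun j hj => not_le.1 (Nat.find_min hex (m := j) (by omega))
    linarith

end Admissible

end Consts

/-- Doubly exponential convergence takes a doubly logarithmic number of steps. -/
lemma exists_isBigO_log_log (C : ℝ) :
    ∃ N : ℝ → ℕ, (∀ ε, 0 < ε → C * (1 / 4) ^ 2 ^ N ε ≤ ε) ∧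
      (fun ε => (N ε : ℝ) + 1) =O[𝓝[>] 0] (fun ε : ℝ => Real.log (Real.log (1 / ε))) := by
  have hex : ∀ ε : ℝ, 0 < ε → {i : ℕ | C * (1 / 4 : ℝ) ^ 2 ^ i ≤ ε}.Nonempty := by
    intro ε hε
    have h1 : Filter.Tendsto (fun i : ℕ => C * (1 / 4 : ℝ) ^ 2 ^ i) Filter.atTop (𝓝 (C * 0)) :=
      ((tendsto_pow_atTop_nhds_zero_of_lt_one (by norm_num) (by norm_num)).comp
        (tendsto_pow_atTop_atTop_of_one_lt (by norm_num : 1 < 2))).const_mul C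
    rw [mul_zero] at h1
    exact (h1.eventually_le_const hε).exists
  refine ⟨fun ε => sInf {i : ℕ | C * (1 / 4 : ℝ) ^ 2 ^ i ≤ ε}, fun ε hε => Nat.sInf_mem (hex ε hε),
    ?_⟩
  have hlim : Filter.Tendsto (fun ε : ℝ => Real.log (1 / ε)) (𝓝[>] 0) Filter.atTop := by
    simp only [one_div]
    exact Real.tendsto_log_atTop.comp tendsto_inv_nhdsGT_zero
  have hlim2 := Real.tendsto_log_atTop.comp hlim
  refine Asymptotics.IsBigO.of_bound 5 ?_
  filter_upwards [self_mem_nhdsWithin, hlim.eventually_ge_atTop (max 1 (Real.log (max C 1))),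
    hlim2.eventually_ge_atTop 1] with ε hε h1 h2
  have hε : 0 < ε := hε
  simp only [Function.comp_apply] at h2
  set y := Real.log (1 / ε) with hy
  have hy1 : 1 ≤ y := (le_max_left _ _).trans h1
  have hCy : C ≤ Real.exp y := by
    have h3 : Real.log (max C 1) ≤ y := (le_max_right _ _).trans h1
    have h4 := (Real.log_le_iff_le_exp (by positivity)).1 h3
    exact (le_max_left _ _).trans h4
  have hεy : ε = Real.exp (-y) := by
    rw [hy, Real.exp_neg, Real.exp_log (by positivity)]; simp
  -- Since 2 ln 2 > 1, this makes 2^i ≥ 2y, so (1/4)^(2^i) ≤ exp(-2y) = ε². One factor ε pays for C,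
  -- which is at most exp y = 1/ε for small ε.
  set i := ⌈2 * Real.log y⌉₊ + 1 with hi
  have hmem : C * (1 / 4 : ℝ) ^ 2 ^ i ≤ ε := by
    have h3 : 2 * y ≤ (2 : ℝ) ^ i := by
      rw [hi, pow_succ]
      have h4 : y ≤ (2 : ℝ) ^ ⌈2 * Real.log y⌉₊ := by
        have h5 : Real.log y ≤ ⌈2 * Real.log y⌉₊ * Real.log 2 := by
          have h6 := Nat.le_ceil (2 * Real.log y)
          have h7 := Real.log_two_gt_d9
          nlinarith
        rw [← Real.log_pow] at h5
        exact (Real.log_le_log_iff (by linarith) (by positivity)).1 h5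
      linarith
    have h4 : (1 / 4 : ℝ) ^ 2 ^ i ≤ Real.exp (-(2 * y)) := by
      rw [← Real.log_le_iff_le_exp (by positivity), Real.log_pow, one_div, Real.log_inv,
        show (4 : ℝ) = 2 ^ 2 by norm_num, Real.log_pow]
      have h7 := Real.log_two_gt_d9
      push_cast
      nlinarith
    calc C * (1 / 4 : ℝ) ^ 2 ^ i ≤ Real.exp y * (1 / 4 : ℝ) ^ 2 ^ i := by gcongr
      _ ≤ Real.exp y * Real.exp (-(2 * y)) := by gcongr
      _ = ε := by rw [hεy, ← Real.exp_add]; ring_nf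
  have h3 : ((sInf {i : ℕ | C * (1 / 4 : ℝ) ^ 2 ^ i ≤ ε} : ℕ) : ℝ) ≤ i :=
    Nat.cast_le.2 (Nat.sInf_le hmem)
  have h4 : (i : ℝ) ≤ 2 * Real.log y + 2 := by
    have := Nat.ceil_lt_add_one (show 0 ≤ 2 * Real.log y by linarith)
    rw [hi]; push_cast; linarith
  rw [Real.norm_of_nonneg (by positivity), Real.norm_of_nonneg (by linarith)]
  linarith

/-- The number of steps of a sequence of gaps that satisfies a gap dependent decrease, and that is
controlled by a quadratically convergent sequence `l` once the gap is at most `δ̄`. -/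
lemma Consts.Admissible.exists_complexity {c : Consts} (hc : c.Admissible) (hρ : 0 < c.ρh) :
    ∃ r : ℝ → ℝ, r =O[𝓝[>] 0] (fun ε : ℝ => Real.log (Real.log (1 / ε))) ∧
      ∀ δ l : ℕ → ℝ, Antitone δ → (∀ k, 0 ≤ l k) →
        (∀ k, δ k ≤ (c.ρh + c.θg * c.β * √(2 * δ k)
          + c.ρh * c.θg ^ 2 * c.χ ^ 2 * (2 * δ k)) * (δ k - δ (k + 1))) →
        (∀ k, δ k ≤ c.ρh / 2 * l k ^ 2) →
        (∀ k, δ k ≤ c.δBar → l k ≤ c.lamBar ∧ l (k + 1) ≤ l k ^ 2 / (2 * c.lamBar)) →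
        ∀ ε, 0 < ε → ∃ k : ℕ, (k : ℝ) ≤ c.phase (max (δ 0) c.δBar) c.δBar + r ε ∧
          ∀ m, k ≤ m → δ m ≤ ε := by
  obtain ⟨N, hN, hO⟩ := exists_isBigO_log_log (2 * c.ρh * c.lamBar ^ 2)
  refine ⟨fun ε => N ε + 1, hO, fun δ l hanti hl0 hgap hδl hquad ε hε => ?_⟩
  obtain ⟨K, hK, hK'⟩ := hc.exists_gap_le hρ hanti hgap
  have hlam := hc.lamBar_pos hρ
  -- Normalized by 2λ̄, the decrement is squared at each step, starting from at most 1/2. The factor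
  -- 2 in the contraction is what makes this start smaller than 1.
  have hl : ∀ i : ℕ, l (K + i) ≤ 2 * c.lamBar * (1 / 2) ^ 2 ^ i := by
    intro i
    induction i with
    | zero => simpa [mul_right_comm] using (hquad K hK).1
    | succ i ih =>
      have h1 := (hquad (K + i) ((hanti (Nat.le_add_right K i)).trans hK)).2
      rw [← add_assoc]
      refine h1.trans ?_
      rw [div_le_iff₀ (by positivity)]
      calc l (K + i) ^ 2 ≤ (2 * c.lamBar * (1 / 2) ^ 2 ^ i) ^ 2 :=
            pow_le_pow_left₀ (hl0 _) ih 2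
        _ = _ := by rw [mul_pow, ← pow_mul, ← pow_succ]; ring
  refine ⟨K + N ε, by push_cast; linarith, fun m hm => (hanti hm).trans ?_⟩
  refine (hδl _).trans (le_trans ?_ (hN ε hε))
  calc c.ρh / 2 * l (K + N ε) ^ 2 ≤ c.ρh / 2 * (2 * c.lamBar * (1 / 2) ^ 2 ^ N ε) ^ 2 := by
        have := pow_le_pow_left₀ (hl0 _) (hl (N ε)) 2
        gcongr
    _ = 2 * c.ρh * c.lamBar ^ 2 * ((1 / 2) ^ 2) ^ 2 ^ N ε := by
        rw [← pow_mul, mul_comm 2 (2 ^ N ε), pow_mul]; ring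
    _ = _ := by norm_num

end OptControl

namespace OptControl

/-! ### Inverse Hessians and the Newton decrement. -/

section Invert

variable {F : Type*} [NormedAddCommGroup F] [InnerProductSpace ℝ F] [FiniteDimensional ℝ F]

/-- A coercive operator of a finite dimensional space is inverted by `ContinuousLinearMap.inverse`. -/
lemma apply_inverse_of_coercive {H : F →L[ℝ] F} {μ : ℝ} (hμ : 0 < μ)
    (hH : ∀ y, μ * ‖y‖ ^ 2 ≤ inner ℝ y (H y)) (y : F) : H (H.inverse y) = y := by
  have hinj : Function.Injective (H : F →ₗ[ℝ] F) := by
    rw [← LinearMap.ker_eq_bot, LinearMap.ker_eq_bot']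
    intro y hy
    have h1 := hH y
    have hy : H y = 0 := hy
    rw [hy, inner_zero_right] at h1
    have h2 : ‖y‖ ^ 2 ≤ 0 := by nlinarith [sq_nonneg ‖y‖]
    simpa using h2.antisymm (sq_nonneg _)
  have hinv : H.IsInvertible :=
    ⟨(LinearEquiv.ofInjectiveEndo (H : F →ₗ[ℝ] F) hinj).toContinuousLinearEquiv, by ext; rfl⟩
  exact hinv.self_apply_inverse y

end Invert

section Decrement

variable {F : Type*} [NormedAddCommGroup F] [InnerProductSpace ℝ F] [FiniteDimensional ℝ F]

/-- The Newton decrement of a function. -/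
noncomputable def decrement (h : F → ℝ) (x : F) : ℝ :=
  √(inner ℝ (gradient h x) ((fderiv ℝ (gradient h) x).inverse (gradient h x)))

variable {h : F → ℝ} {L M : ℝ≥0} {μ : ℝ}

namespace SmoothCost

lemma hess_apply_inverse (hh : SmoothCost h L M μ) (x y : F) :
    fderiv ℝ (gradient h) x ((fderiv ℝ (gradient h) x).inverse y) = y :=
  apply_inverse_of_coercive hh.pos (hh.le_inner_hess x) y

lemma decrement_sq (hh : SmoothCost h L M μ) (x : F) :
    decrement h x ^ 2
      = inner ℝ (gradient h x) ((fderiv ℝ (gradient h) x).inverse (gradient h x)) := by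
  refine Real.sq_sqrt ?_
  nth_rewrite 1 [← hh.hess_apply_inverse x (gradient h x)]
  rw [real_inner_comm]
  exact (mul_nonneg hh.pos.le (sq_nonneg _)).trans (hh.le_inner_hess x _)

lemma norm_gradient_sq_le_decrement (hh : SmoothCost h L M μ) (x : F) :
    ‖gradient h x‖ ^ 2 ≤ L * decrement h x ^ 2 := by
  have h1 := norm_apply_sq_le (hh.symm x)
    (fun y => (mul_nonneg hh.pos.le (sq_nonneg _)).trans (hh.le_inner_hess x y))
    (hh.norm_hess_le x) ((fderiv ℝ (gradient h) x).inverse (gradient h x))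
  rwa [hh.hess_apply_inverse, real_inner_comm, ← hh.decrement_sq] at h1

lemma decrement_sq_le (hh : SmoothCost h L M μ) (x : F) :
    μ * decrement h x ^ 2 ≤ ‖gradient h x‖ ^ 2 := by
  have hμ := hh.pos
  rw [hh.decrement_sq]
  set m := (fderiv ℝ (gradient h) x).inverse (gradient h x)
  have h1 := hh.le_inner_hess x m
  rw [hh.hess_apply_inverse] at h1
  have h2 := real_inner_le_norm m (gradient h x)
  rw [real_inner_comm m (gradient h x)]
  have h3 : μ * ‖m‖ ≤ ‖gradient h x‖ := by
    rcases (norm_nonneg m).eq_or_lt with h0 | h0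
    · rw [← h0]; simp
    · refine le_of_mul_le_mul_right (a := ‖m‖) ?_ h0
      linarith
  nlinarith [norm_nonneg (gradient h x)]

/-- A gradient step of length 1/L, by the descent lemma, cannot go below J. The step leaves the
range of `g`, which is why J must bound `h` everywhere. For L = 0 the gradient vanishes. -/
lemma norm_gradient_sq_le_gap (hh : SmoothCost h L M μ) {J : ℝ} (hJ : ∀ y, J ≤ h y) (x : F) :
    ‖gradient h x‖ ^ 2 ≤ 2 * L * (h x - J) := by
  rcases eq_or_ne L 0 with h0 | h0
  · have := hh.norm_gradient_sq_le_decrement x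
    simp only [h0, NNReal.coe_zero, zero_mul] at this
    simpa [h0] using this
  have hL : (0 : ℝ) < L := NNReal.coe_pos.2 (pos_iff_ne_zero.2 h0)
  have h1 := apply_add_le_of_lipschitz_gradient hh.diff hh.grad_lip x
    (-((L : ℝ)⁻¹ • gradient h x))
  have h2 := (hJ _).trans h1
  rw [norm_neg, norm_smul, inner_neg_right, real_inner_smul_right, real_inner_self_eq_norm_sq,
    Real.norm_of_nonneg (by positivity)] at h2
  have h3 : (L : ℝ) / 2 * ((L : ℝ)⁻¹ * ‖gradient h x‖) ^ 2
      = (L : ℝ)⁻¹ * ‖gradient h x‖ ^ 2 / 2 := by field_simp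
  have h4 : (L : ℝ)⁻¹ * ‖gradient h x‖ ^ 2 ≤ 2 * (h x - J) := by linarith
  rw [inv_mul_le_iff₀ hL] at h4
  linarith

/-- On the zero space μ and L are unrelated and L may be 0. So that space is treated apart wherever
ρ_h ≥ 1 or ρ_h > 0 is needed. -/
lemma le_of_nontrivial [Nontrivial F] (hh : SmoothCost h L M μ) : μ ≤ L := by
  obtain ⟨y, hy⟩ := exists_ne (0 : F)
  have h1 := hh.le_inner_hess 0 y
  have h2 := (real_inner_le_norm y _).trans (mul_le_mul_of_nonneg_left
    (ContinuousLinearMap.le_of_opNorm_le _ (hh.norm_hess_le 0) y) (norm_nonneg y))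
  have h3 : 0 < ‖y‖ ^ 2 := by positivity
  refine le_of_mul_le_mul_right ?_ h3
  linarith

end SmoothCost

end Decrement

/-! ### The approximate Gauss-Newton method. -/

section Method

variable {E F : Type*} [NormedAddCommGroup E] [InnerProductSpace ℝ E] [CompleteSpace E]
  [NormedAddCommGroup F] [InnerProductSpace ℝ F] [FiniteDimensional ℝ F]

lemma inner_gradient_comp {g : E → F} {h : F → ℝ} {u : E} (hg : DifferentiableAt ℝ g u)
    (hh : DifferentiableAt ℝ h (g u)) (v : E) :
    inner ℝ (gradient (fun u => h (g u)) u) v = inner ℝ (gradient h (g u)) (fderiv ℝ g u v) := by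
  simp only [inner_gradient_left]
  rw [show (fun u => h (g u)) = h ∘ g from rfl, fderiv_comp u hh hg]
  rfl

/-- Approximate regularized Gauss-Newton steps `w u`, at distance at most `η ‖v u‖²` of the exact
steps `v u`, for the regularization `c.reg ‖∇h(g u)‖`. -/
structure GaussNewton (h : F → ℝ) (g : E → F) (L M lg Lg : ℝ≥0) (μ σ η : ℝ) (c : Consts)
    (v w : E → E) : Prop where
  consts : c = ⟨μ, L, M, lg, Lg, σ, η⟩
  cost : SmoothCost h L M μ
  map : SmoothSubmersion g lg Lg σ
  Lg_pos : 0 < Lg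
  η_nonneg : 0 ≤ η
  step : ∀ u, gradient h (g u) ≠ 0 → RegStep (fderiv ℝ g u) (fderiv ℝ (gradient h) (g u))
    (gradient h (g u)) (c.reg ‖gradient h (g u)‖) (v u)
  near : ∀ u, gradient h (g u) ≠ 0 → ‖w u - v u‖ ≤ η * ‖v u‖ ^ 2
  -- Here the regularization is 0 and the model has no `RegStep`, so stationary points are required
  -- to be fixed.
  near_zero : ∀ u, gradient h (g u) = 0 → w u = 0

namespace GaussNewton

variable {h : F → ℝ} {g : E → F} {L M lg Lg : ℝ≥0} {μ σ η : ℝ} {c : Consts} {v w : E → E}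

lemma admissible (H : GaussNewton h g L M lg Lg μ σ η c v w) : c.Admissible := by
  rw [H.consts]
  exact ⟨H.cost.pos, L.2, M.2, lg.2, H.Lg_pos, H.map.pos, H.η_nonneg⟩

lemma decrease (H : GaussNewton h g L M lg Lg μ σ η c v w) (u : E) :
    h (g (u + w u)) ≤ h (g u) + 1 / 2 * inner ℝ (gradient h (g u)) (fderiv ℝ g u (v u)) := by
  rcases eq_or_ne (gradient h (g u)) 0 with h0 | h0
  · rw [H.near_zero u h0, h0, inner_zero_left, add_zero, mul_zero, add_zero]
  refine apply_step_le H.cost H.map (H.step u h0) (H.near u h0) ?_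
  have h1 := (H.step u h0).norm_le_of_gradient H.cost.pos (H.cost.le_inner_hess _) (H.map.surj u)
  have h2 := H.admissible.error_le_reg (x := ‖gradient h (g u)‖) (norm_nonneg (v u))
    (by rw [H.consts]; exact h1)
  rw [H.consts] at h2 ⊢
  exact h2

lemma norm_gradient_sq_le (H : GaussNewton h g L M lg Lg μ σ η c v w) (u : E) :
    ‖gradient h (g u)‖ ^ 2 ≤ (c.Lh + c.reg ‖gradient h (g u)‖ / c.σg ^ 2)
      * (2 * (h (g u) - h (g (u + w u)))) := by
  have h1 := H.decrease u
  have hc := H.admissible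
  rcases eq_or_ne (gradient h (g u)) 0 with h0 | h0
  · rw [H.near_zero u h0, h0]; simp
  have h2 := (H.step u h0).norm_gradient_sq_le H.map.pos (H.map.surj u) (H.cost.symm _)
    (fun y => (mul_nonneg H.cost.pos.le (sq_nonneg _)).trans (H.cost.le_inner_hess _ y))
    (H.cost.norm_hess_le _)
  have e1 : c.Lh = L := by rw [H.consts]
  have e2 : c.σg = σ := by rw [H.consts]
  rw [← e1, ← e2] at h2
  have h3 : 0 ≤ c.Lh + c.reg ‖gradient h (g u)‖ / c.σg ^ 2 :=
    add_nonneg hc.Lh_nonneg (div_nonneg (hc.reg_nonneg (norm_nonneg _)) (sq_nonneg _))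
  refine h2.trans (mul_le_mul_of_nonneg_left ?_ h3)
  linarith

lemma apply_step_le (H : GaussNewton h g L M lg Lg μ σ η c v w) (u : E) :
    h (g (u + w u)) ≤ h (g u) := by
  have h1 := H.norm_gradient_sq_le u
  have hc := H.admissible
  rcases eq_or_ne (gradient h (g u)) 0 with h0 | h0
  · rw [H.near_zero u h0, add_zero]
  have h3 : 0 ≤ c.Lh + c.reg ‖gradient h (g u)‖ / c.σg ^ 2 :=
    add_nonneg hc.Lh_nonneg (div_nonneg (hc.reg_nonneg (norm_nonneg _)) (sq_nonneg _))
  have h4 : 0 < ‖gradient h (g u)‖ ^ 2 := by positivity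
  have := pos_of_mul_pos_right (h4.trans_le h1) h3
  linarith

/-- The gap with respect to any lower value is controlled by the decrease. -/
lemma gap_le (H : GaussNewton h g L M lg Lg μ σ η c v w) (u : E) {δ : ℝ} (hδ : 0 ≤ δ)
    (hδu : δ ≤ ‖gradient h (g u)‖ ^ 2 / (2 * μ)) :
    δ ≤ (c.ρh + c.θg * c.β * √(2 * δ) + c.ρh * c.θg ^ 2 * c.χ ^ 2 * (2 * δ))
      * (h (g u) - h (g (u + w u))) := by
  refine H.admissible.gap_le (norm_nonneg _) hδ ?_ (H.norm_gradient_sq_le u)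
  rw [H.consts]
  exact hδu

lemma bddBelow (H : GaussNewton h g L M lg Lg μ σ η c v w) :
    BddBelow (Set.range fun u => h (g u)) := by
  refine ⟨h (g 0) - ‖gradient h (g 0)‖ ^ 2 / (2 * μ), ?_⟩
  rintro _ ⟨u, rfl⟩
  have := H.cost.sub_le_norm_gradient (g 0) (g u)
  simp only
  linarith

/-- The infimum of `h ∘ g` is a lower bound of `h`. -/
lemma iInf_le (H : GaussNewton h g L M lg Lg μ σ η c v w) (y : F) : ⨅ u, h (g u) ≤ h y := by
  by_contra! hlt
  set J := ⨅ u, h (g u) with hJ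
  have hc := H.admissible
  set κ := J - h y with hκ
  have hκ0 : 0 < κ := sub_pos.2 hlt
  set A := c.ρh + c.θg * c.β * √(2 * (κ + 1)) + c.ρh * c.θg ^ 2 * c.χ ^ 2 * (2 * (κ + 1)) with hA
  have h1 := hc.ρh_nonneg
  have h2 := hc.θg_pos
  have h3 := hc.β_pos
  have hA0 : 0 < A := by positivity
  -- If J exceeded h y by κ, every point would keep a gap of at least κ to h y. Where that gap is at
  -- most κ + 1, a step decreases the value by at least κ/A, which is impossible within κ/(2A) of
  -- the infimum J.
  set τ := min 1 (κ / (2 * A))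
  have hτ : 0 < τ := by positivity
  obtain ⟨u, hu⟩ := exists_lt_of_ciInf_lt (show ⨅ u, h (g u) < J + τ by rw [← hJ]; linarith)
  have hJu : J ≤ h (g u) := ciInf_le H.bddBelow u
  have hJu' : J ≤ h (g (u + w u)) := ciInf_le H.bddBelow (u + w u)
  have hτ1 : τ ≤ 1 := min_le_left _ _
  have h4 := H.gap_le u (δ := h (g u) - h y) (by linarith) (H.cost.sub_le_norm_gradient _ _)
  have h5 : h (g u) - h y ≤ κ + 1 := by linarith
  have h6 : (c.ρh + c.θg * c.β * √(2 * (h (g u) - h y))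
      + c.ρh * c.θg ^ 2 * c.χ ^ 2 * (2 * (h (g u) - h y))) ≤ A := by
    rw [hA]; gcongr
  have h7 : 0 ≤ h (g u) - h (g (u + w u)) := sub_nonneg.2 (H.apply_step_le u)
  have h8 := h4.trans (mul_le_mul_of_nonneg_right h6 h7)
  have h9 : A * (h (g u) - h (g (u + w u))) ≤ A * (κ / (2 * A)) := by
    have : τ ≤ κ / (2 * A) := min_le_right _ _
    gcongr
    linarith
  have h10 : A * (κ / (2 * A)) = κ / 2 := by field_simp
  linarith

lemma gap_nonneg (H : GaussNewton h g L M lg Lg μ σ η c v w) (u : E) :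
    0 ≤ h (g u) - ⨅ u, h (g u) := sub_nonneg.2 (ciInf_le H.bddBelow u)

lemma gap_le_norm_gradient (H : GaussNewton h g L M lg Lg μ σ η c v w) (u : E) :
    h (g u) - ⨅ u, h (g u) ≤ ‖gradient h (g u)‖ ^ 2 / (2 * μ) := by
  have : h (g u) - ‖gradient h (g u)‖ ^ 2 / (2 * μ) ≤ ⨅ u, h (g u) :=
    le_ciInf fun u' => by linarith [H.cost.sub_le_norm_gradient (g u) (g u')]
  linarith

lemma gap_le_decrement (H : GaussNewton h g L M lg Lg μ σ η c v w) (u : E) :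
    h (g u) - ⨅ u, h (g u) ≤ c.ρh / 2 * decrement h (g u) ^ 2 := by
  have hμ := H.cost.pos
  refine (H.gap_le_norm_gradient u).trans ?_
  rw [div_le_iff₀ (by positivity), H.consts]
  refine (H.cost.norm_gradient_sq_le_decrement _).trans_eq ?_
  simp only [Consts.ρh]
  field_simp

lemma one_le_ρh [Nontrivial F] (H : GaussNewton h g L M lg Lg μ σ η c v w) : 1 ≤ c.ρh := by
  rw [H.consts]
  exact (one_le_div H.cost.pos).2 H.cost.le_of_nontrivial

/-- The chain is λ² ≤ |q|²/μ ≤ 2ρ_h · gap ≤ 2ρ_h δ̄ = λ̄². Its second link uses `iInf_le`. -/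
lemma decrement_le (H : GaussNewton h g L M lg Lg μ σ η c v w) {u : E}
    (hu : h (g u) - ⨅ u, h (g u) ≤ c.δBar) : decrement h (g u) ≤ c.lamBar := by
  have hμ := H.cost.pos
  rcases subsingleton_or_nontrivial F with hF | hF
  · have : decrement h (g u) = 0 := by
      rw [decrement, Subsingleton.elim (gradient h (g u)) 0]; simp
    rw [this]
    exact H.admissible.lamBar_nonneg
  have hρ : 0 < c.ρh := by linarith [H.one_le_ρh]
  refine abs_le_of_sq_le_sq' ?_ H.admissible.lamBar_nonneg |>.2
  rw [H.admissible.lamBar_sq hρ]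
  have h1 := H.cost.decrement_sq_le (g u)
  have h2 := H.cost.norm_gradient_sq_le_gap H.iInf_le (g u)
  have h3 : decrement h (g u) ^ 2 ≤ 2 * c.ρh * (h (g u) - ⨅ u, h (g u)) := by
    have e : c.ρh = L / μ := by rw [H.consts]; rfl
    rw [e]
    have : 2 * (L / μ) * (h (g u) - ⨅ u, h (g u)) = 2 * L * (h (g u) - ⨅ u, h (g u)) / μ := by
      ring
    rw [this, le_div_iff₀ hμ]
    linarith
  refine h3.trans ?_
  gcongr

/-- Quadratic convergence of the decrement. -/
lemma decrement_step_le (H : GaussNewton h g L M lg Lg μ σ η c v w) {u : E}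
    (hu : decrement h (g u) ≤ c.lamBar) :
    decrement h (g (u + w u)) ≤ decrement h (g u) ^ 2 / (2 * c.lamBar) := by
  have hμ := H.cost.pos
  have hσ := H.map.pos
  rcases eq_or_ne (gradient h (g u)) 0 with h0 | h0
  · have : decrement h (g u) = 0 := by rw [decrement, h0]; simp
    rw [H.near_zero u h0, add_zero, this]; simp
  have hF : Nontrivial F := ⟨_, _, h0⟩
  have hv := H.step u h0
  have hw := H.near u h0
  set a := fderiv ℝ g u (v u)
  set r := g (u + w u) - g u - a with hr
  have hs : 0 < √μ := Real.sqrt_pos.2 hμ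
  have hx : g (u + w u) = g u + (a + r) := by rw [hr]; abel
  have hp : ∀ y, 0 ≤ inner ℝ y (fderiv ℝ (gradient h) (g u) y) := fun y =>
    (mul_nonneg hμ.le (sq_nonneg _)).trans (H.cost.le_inner_hess _ y)
  have hl0 : 0 ≤ decrement h (g u) := Real.sqrt_nonneg _
  have ha : √μ * ‖a‖ ≤ decrement h (g u) := by
    refine abs_le_of_sq_le_sq' ?_ hl0 |>.2
    rw [mul_pow, Real.sq_sqrt hμ.le, H.cost.decrement_sq]
    exact (H.cost.le_inner_hess (g u) a).trans
      (hv.inner_image_le (H.cost.symm _) hp (H.cost.hess_apply_inverse _ _))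
  have hV : σ * √μ * ‖v u‖ ≤ decrement h (g u) := by
    refine le_trans ?_ ha
    have := mul_le_mul_of_nonneg_left (hv.mul_norm_le (H.map.surj u)) hs.le
    linarith
  -- r gathers the linearization error of `g` along the exact step and the effect of replacing v by
  -- w, both quadratic in v.
  have hr1 : ‖r‖ ≤ (Lg / 2 + lg * η) * ‖v u‖ ^ 2 := by
    have e : r = (g (u + v u) - g u - a) + (g (u + w u) - g (u + v u)) := by rw [hr]; abel
    rw [e, add_mul]
    exact norm_add_le_of_le (norm_sub_fderiv_le H.map.diff H.map.smooth u (v u))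
      (H.map.norm_sub_le_of_near hw)
  have hd : ‖a + r‖ ≤ decrement h (g u) / √μ + ‖r‖ := by
    refine norm_add_le_of_le ?_ le_rfl
    rw [le_div_iff₀ hs]
    linarith
  have hc := H.admissible
  have hest := hc.quadratic_estimates H.one_le_ρh (x := ‖gradient h (g u)‖)
    (l := decrement h (g u)) (V := ‖v u‖)
    (ψ := ‖gradient h (g u) + fderiv ℝ (gradient h) (g u) a‖) (r := ‖r‖) (d := ‖a + r‖)
    (norm_nonneg _) hl0 (norm_nonneg _) (norm_nonneg _) (norm_nonneg _) hu
    (by rw [H.consts]; exact H.cost.norm_gradient_sq_le_decrement _)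
    (by rw [H.consts]; exact hV)
    (by
      have := hv.norm_residual_le (H.map.surj u)
      rw [H.consts] at this ⊢; exact this)
    (by rw [H.consts]; exact hr1) (by rw [H.consts]; exact hd)
  have e1 : c.Mh = M := by rw [H.consts]
  have e2 : c.μh = μ := by rw [H.consts]
  have e3 : c.Lh = L := by rw [H.consts]
  rw [e1, e2, e3] at hest
  refine le_trans ?_ hest.2
  rw [hx]
  exact sqrt_inner_le H.cost (H.cost.hess_apply_inverse _ _) hest.1

/-- The complexity of the method, from any sequence of iterates. -/
lemma exists_complexity (H : GaussNewton h g L M lg Lg μ σ η c v w) :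
    ∃ r : ℝ → ℝ, r =O[𝓝[>] 0] (fun ε : ℝ => Real.log (Real.log (1 / ε))) ∧
      ∀ u : ℕ → E, (∀ k, u (k + 1) = u k + w (u k)) → ∀ ε, 0 < ε → ∃ k : ℕ,
        (k : ℝ) ≤ c.phase (max (h (g (u 0)) - ⨅ u, h (g u)) c.δBar) c.δBar + r ε ∧
          ∀ m, k ≤ m → h (g (u m)) - ⨅ u, h (g u) ≤ ε := by
  rcases subsingleton_or_nontrivial F with hF | hF
  · refine ⟨fun _ => 0, Asymptotics.isBigO_zero _ _, fun u _ ε hε => ⟨0, ?_, fun m _ => ?_⟩⟩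
    all_goals
      have hz : ∀ u', h (g u') - ⨅ u, h (g u) = 0 := fun u' => by
        have : ∀ u, h (g u) = h (g u') := fun u => by rw [Subsingleton.elim (g u) (g u')]
        simp [this]
      rw [hz]
    · have hδ : 0 ≤ c.δBar := by
        have := H.admissible.ρh_nonneg
        unfold Consts.δBar
        positivity
      rw [max_eq_right hδ]
      -- On the zero space δ̄ may be 0, as a quotient by 0 when L = 0. `phase` from δ̄ to δ̄
      -- vanishes in either case.
      rcases hδ.eq_or_lt with h0 | h0
      · simp [Consts.phase, ← h0]
      · simp [Consts.phase, h0.ne']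
    · exact hε.le
  · have hρ : 0 < c.ρh := by linarith [H.one_le_ρh]
    obtain ⟨r, hr, hmain⟩ := H.admissible.exists_complexity hρ
    refine ⟨r, hr, fun u hu => ?_⟩
    refine hmain (fun k => h (g (u k)) - ⨅ u, h (g u)) (fun k => decrement h (g (u k)))
      (antitone_nat_of_succ_le fun k => ?_) (fun k => Real.sqrt_nonneg _) (fun k => ?_)
      (fun k => H.gap_le_decrement (u k)) (fun k hk => ⟨H.decrement_le hk, ?_⟩)
    · simp only [hu k]
      exact sub_le_sub_right (H.apply_step_le (u k)) _
    · simp only [hu k, sub_sub_sub_cancel_right]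
      exact H.gap_le (u k) (H.gap_nonneg _) (H.gap_le_norm_gradient _)
    · simp only [hu k]
      exact H.decrement_step_le (H.decrement_le hk)

end GaussNewton

end Method

end OptControl

namespace OptControl

/-! ### Calculus of the control problem and identification of the LQR oracle. -/

section Gradient

variable {F : Type*} [NormedAddCommGroup F] [InnerProductSpace ℝ F] [CompleteSpace F]

lemma differentiable_gradient {h : F → ℝ} (hh : ContDiff ℝ 2 h) :
    Differentiable ℝ (gradient h) := by
  have h1 : Differentiable ℝ (fderiv ℝ h) :=
    (hh.fderiv_right (m := 1) (by norm_num)).differentiable (by norm_num)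
  exact (InnerProductSpace.toDual ℝ F).symm.toContinuousLinearEquiv.differentiable.comp h1

lemma inner_fderiv_gradient {h : F → ℝ} (hh : ContDiff ℝ 2 h) (x a b : F) :
    inner ℝ (fderiv ℝ (gradient h) x a) b = fderiv ℝ (fderiv ℝ h) x a b := by
  have h1 : Differentiable ℝ (fderiv ℝ h) :=
    (hh.fderiv_right (m := 1) (by norm_num)).differentiable (by norm_num)
  have h2 : HasFDerivAt (gradient h)
      ((InnerProductSpace.toDual ℝ F).symm.toContinuousLinearEquiv.toContinuousLinearMap.comp
        (fderiv ℝ (fderiv ℝ h) x)) x :=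
    ((InnerProductSpace.toDual ℝ F).symm.toContinuousLinearEquiv.hasFDerivAt.comp x
      (h1 x).hasFDerivAt :)
  rw [h2.fderiv]
  simp

/-- Through the Riesz isomorphism this is the symmetry of the second derivative. -/
lemma inner_fderiv_gradient_symm {h : F → ℝ} (hh : ContDiff ℝ 2 h) (x a b : F) :
    inner ℝ (fderiv ℝ (gradient h) x a) b = inner ℝ a (fderiv ℝ (gradient h) x b) := by
  rw [real_inner_comm (fderiv ℝ (gradient h) x b), inner_fderiv_gradient hh,
    inner_fderiv_gradient hh]
  exact (hh.contDiffAt.isSymmSndFDerivAt (by simp)).eq a b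

end Gradient

section PiLp

variable {ι E V : Type*} [Fintype ι] [NormedAddCommGroup E] [NormedSpace ℝ E]
  [NormedAddCommGroup V] [NormedSpace ℝ V]

/-- The linear map into a power with prescribed components. -/
noncomputable def piLpL (D : ι → E →L[ℝ] V) : E →L[ℝ] PiLp 2 (fun _ : ι => V) :=
  ((PiLp.continuousLinearEquiv 2 ℝ fun _ : ι => V).symm : (ι → V) →L[ℝ] PiLp 2 fun _ : ι => V).comp
    (ContinuousLinearMap.pi D)

lemma hasFDerivAt_piLpL {G : E → PiLp 2 (fun _ : ι => V)} {D : ι → E →L[ℝ] V} {x : E}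
    (hG : ∀ i, HasFDerivAt (fun y => G y i) (D i) x) : HasFDerivAt G (piLpL D) x := by
  rw [← hasFDerivWithinAt_univ, hasFDerivWithinAt_piLp]
  intro i
  exact (hG i).hasFDerivWithinAt

lemma hasFDerivAt_comp_apply {W : Type*} [NormedAddCommGroup W] [NormedSpace ℝ W] {k : V → W}
    {x : PiLp 2 (fun _ : ι => V)} {i : ι} (hk : DifferentiableAt ℝ k (x i)) :
    HasFDerivAt (fun y : PiLp 2 (fun _ : ι => V) => k (y i))
      ((fderiv ℝ k (x i)).comp (PiLp.proj 2 (fun _ : ι => V) i)) x :=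
  HasFDerivAt.comp (f := fun y : PiLp 2 (fun _ : ι => V) => y i) x hk.hasFDerivAt
    (PiLp.hasFDerivAt_apply 2 x i)

end PiLp

variable {τ nx nu : ℕ}

instance {n : ℕ} : ContinuousSMul ℝ (Traj τ n) := IsBoundedSMul.continuousSMul

lemma ctrlAt_of_lt {n : ℕ} (u : Traj τ n) {t : ℕ} (ht : t < τ) : ctrlAt u t = u ⟨t, ht⟩ :=
  dif_pos ht

@[simp] lemma ctrlAt_coe {n : ℕ} (u : Traj τ n) (i : Fin τ) : ctrlAt u i = u i := dif_pos i.2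

lemma ctrlAt_add {n : ℕ} (u v : Traj τ n) (t : ℕ) : ctrlAt (u + v) t = ctrlAt u t + ctrlAt v t := by
  unfold ctrlAt; split_ifs <;> simp

lemma ctrlAt_sub {n : ℕ} (u v : Traj τ n) (t : ℕ) : ctrlAt (u - v) t = ctrlAt u t - ctrlAt v t := by
  unfold ctrlAt; split_ifs <;> simp

/-- The evaluation of a control at a time, as a linear map. -/
noncomputable def ctrlL (τ n t : ℕ) : Traj τ n →L[ℝ] Vec n :=
  if ht : t < τ then PiLp.proj 2 (fun _ : Fin τ => Vec n) ⟨t, ht⟩ else 0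

lemma ctrlL_apply {n : ℕ} (u : Traj τ n) (t : ℕ) : ctrlL τ n t u = ctrlAt u t := by
  unfold ctrlL ctrlAt
  split_ifs <;> rfl

lemma traj_norm_sq {n : ℕ} (u : Traj τ n) : ‖u‖ ^ 2 = ∑ t ∈ Finset.range τ, ‖ctrlAt u t‖ ^ 2 := by
  rw [PiLp.norm_sq_eq_of_L2, Finset.sum_range]
  simp

lemma traj_inner {n : ℕ} (u v : Traj τ n) :
    inner ℝ u v = ∑ t ∈ Finset.range τ, inner ℝ (ctrlAt u t) (ctrlAt v t) := by
  rw [PiLp.inner_apply, Finset.sum_range]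
  simp

lemma norm_ctrlAt_le {n : ℕ} (u : Traj τ n) (t : ℕ) : ‖ctrlAt u t‖ ≤ ‖u‖ := by
  unfold ctrlAt
  split_ifs
  · exact PiLp.norm_apply_le u _
  · simp

namespace Problem

variable {P : Problem τ nx nu} {Lh Mh : ℝ≥0} {σf μh : ℝ}

/-! ### The total cost -/

section TotalCost

lemma mem_Icc_succ (i : Fin τ) : (i : ℕ) + 1 ∈ Finset.Icc 1 τ := by
  have := i.2
  simp only [Finset.mem_Icc]
  omega

lemma hasGradientAt_totalCost (hyp : P.StandingHypothesis Lh Mh σf) (x : Traj τ nx) :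
    HasGradientAt P.totalCost
      (WithLp.toLp 2 fun i : Fin τ => gradient (P.h ((i : ℕ) + 1)) (x i)) x := by
  rw [hasGradientAt_iff_hasFDerivAt]
  have h1 : ∀ i : Fin τ, HasFDerivAt (fun y : Traj τ nx => P.h ((i : ℕ) + 1) (y i))
      ((fderiv ℝ (P.h ((i : ℕ) + 1)) (x i)).comp (PiLp.proj 2 (fun _ : Fin τ => Vec nx) i)) x :=
    fun i => hasFDerivAt_comp_apply ((hyp.cost_smooth _ (mem_Icc_succ i)).differentiable
      (by norm_num) (x i))
  refine (HasFDerivAt.fun_sum fun i _ => h1 i).congr_fderiv ?_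
  ext a
  simp [PiLp.inner_apply, inner_gradient_left, InnerProductSpace.toDual_apply_apply]

lemma gradient_totalCost (hyp : P.StandingHypothesis Lh Mh σf) :
    gradient P.totalCost
      = fun x => WithLp.toLp 2 fun i : Fin τ => gradient (P.h ((i : ℕ) + 1)) (x i) :=
  funext fun x => (hasGradientAt_totalCost hyp x).gradient

lemma ctrlAt_gradient_totalCost (hyp : P.StandingHypothesis Lh Mh σf) (x : Traj τ nx) {t : ℕ}
    (ht : t < τ) :
    ctrlAt (gradient P.totalCost x) t = gradient (P.h (t + 1)) (ctrlAt x t) := by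
  rw [gradient_totalCost hyp, ctrlAt_of_lt _ ht, ctrlAt_of_lt _ ht]

lemma hasFDerivAt_gradient_totalCost (hyp : P.StandingHypothesis Lh Mh σf) (x : Traj τ nx) :
    HasFDerivAt (gradient P.totalCost)
      (piLpL fun i : Fin τ => (fderiv ℝ (gradient (P.h ((i : ℕ) + 1))) (x i)).comp
          (PiLp.proj 2 (fun _ : Fin τ => Vec nx) i)) x := by
  rw [gradient_totalCost hyp]
  exact hasFDerivAt_piLpL fun i => hasFDerivAt_comp_apply
    (differentiable_gradient (hyp.cost_smooth _ (mem_Icc_succ i)) (x i))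

lemma ctrlAt_hess_totalCost (hyp : P.StandingHypothesis Lh Mh σf) (x a : Traj τ nx) {t : ℕ}
    (ht : t < τ) :
    ctrlAt (fderiv ℝ (gradient P.totalCost) x a) t
      = fderiv ℝ (gradient (P.h (t + 1))) (ctrlAt x t) (ctrlAt a t) := by
  rw [(hasFDerivAt_gradient_totalCost hyp x).fderiv, ctrlAt_of_lt _ ht, ctrlAt_of_lt _ ht,
    ctrlAt_of_lt _ ht]
  rfl

lemma lt_mem_Icc {t : ℕ} (ht : t < τ) : t + 1 ∈ Finset.Icc 1 τ := mem_Icc_succ ⟨t, ht⟩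

/-- The total cost inherits the constants of the costs. -/
lemma smoothCost_totalCost (hyp : P.StandingHypothesis Lh Mh σf) (hμ : 0 < μh)
    (hconv : StrongConvexOn Set.univ μh P.totalCost) : SmoothCost P.totalCost Lh Mh μh where
  diff x := (hasGradientAt_totalCost hyp x).differentiableAt
  grad_diff x := (hasFDerivAt_gradient_totalCost hyp x).differentiableAt
  grad_lip := by
    refine LipschitzWith.of_dist_le_mul fun x y => ?_
    rw [dist_eq_norm, dist_eq_norm]
    refine abs_le_of_sq_le_sq' ?_ (by positivity) |>.2
    rw [mul_pow, traj_norm_sq, traj_norm_sq, Finset.mul_sum]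
    refine Finset.sum_le_sum fun t ht => ?_
    have ht' := Finset.mem_range.1 ht
    rw [ctrlAt_sub, ctrlAt_sub, ctrlAt_gradient_totalCost hyp _ ht',
      ctrlAt_gradient_totalCost hyp _ ht', ← mul_pow]
    exact pow_le_pow_left₀ (norm_nonneg _)
      ((hyp.cost_grad _ (lt_mem_Icc ht')).norm_sub_le _ _) 2
  hess_lip := by
    refine LipschitzWith.of_dist_le_mul fun x y => ?_
    rw [dist_eq_norm, dist_eq_norm]
    refine ContinuousLinearMap.opNorm_le_bound _ (by positivity) fun a => ?_
    refine abs_le_of_sq_le_sq' ?_ (by positivity) |>.2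
    rw [mul_pow, traj_norm_sq, traj_norm_sq a, Finset.mul_sum]
    refine Finset.sum_le_sum fun t ht => ?_
    have ht' := Finset.mem_range.1 ht
    rw [sub_apply, ctrlAt_sub, ctrlAt_hess_totalCost hyp _ _ ht',
      ctrlAt_hess_totalCost hyp _ _ ht', ← sub_apply, ← mul_pow]
    refine pow_le_pow_left₀ (norm_nonneg _) ?_ 2
    refine (ContinuousLinearMap.le_opNorm _ _).trans ?_
    gcongr
    refine ((hyp.cost_hess _ (lt_mem_Icc ht')).norm_sub_le _ _).trans ?_
    rw [← ctrlAt_sub]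
    gcongr
    exact norm_ctrlAt_le _ _
  symm x a b := by
    rw [traj_inner, traj_inner]
    refine Finset.sum_congr rfl fun t ht => ?_
    have ht' := Finset.mem_range.1 ht
    rw [ctrlAt_hess_totalCost hyp _ _ ht', ctrlAt_hess_totalCost hyp _ _ ht']
    exact inner_fderiv_gradient_symm (hyp.cost_smooth _ (lt_mem_Icc ht')) _ _ _
  pos := hμ
  convex := hconv

/-- The Hessian of each of the costs is bounded below. -/
lemma le_inner_hess_cost (hyp : P.StandingHypothesis Lh Mh σf) (hμ : 0 < μh)
    (hconv : StrongConvexOn Set.univ μh P.totalCost) {t : ℕ} (ht : t < τ) (x y : Vec nx) :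
    μh * ‖y‖ ^ 2 ≤ inner ℝ y (fderiv ℝ (gradient (P.h (t + 1))) x y) := by
  -- The Hessian of the total cost at a constant trajectory, tested on a direction supported at one
  -- time, isolates a single block.
  have h1 := (smoothCost_totalCost hyp hμ hconv).le_inner_hess
    (WithLp.toLp 2 fun _ : Fin τ => x) (PiLp.single 2 ⟨t, ht⟩ y)
  have hs : ∀ s : ℕ, ctrlAt (PiLp.single 2 (⟨t, ht⟩ : Fin τ) y : Traj τ nx) s
      = if s = t then y else 0 := by
    intro s
    by_cases hs : s < τ
    · rw [ctrlAt_of_lt _ hs]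
      split_ifs with h
      · subst h; exact PiLp.single_eq_same _ _ _
      · exact PiLp.single_eq_of_ne _ (by simpa using h) _
    · rw [if_neg (by omega)]
      exact dif_neg hs
  rw [traj_norm_sq, traj_inner, Finset.sum_eq_single_of_mem t (Finset.mem_range.2 ht),
    Finset.sum_eq_single_of_mem t (Finset.mem_range.2 ht), ctrlAt_hess_totalCost hyp _ _ ht, hs,
    if_pos rfl, ctrlAt_of_lt _ ht] at h1
  · exact h1
  · intro s _ hst
    rw [hs, if_neg hst, inner_zero_left]
  · intro s _ hst
    rw [hs, if_neg hst]
    simp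

end TotalCost

/-! ### The derivative of the trajectory map -/

section Trajectory

lemma ctrlAt_g (u : Traj τ nu) {t : ℕ} (ht : t < τ) : ctrlAt (P.g u) t = P.state u (t + 1) :=
  ctrlAt_of_lt _ ht

lemma hasFDerivAt_f (hd : Differentiable ℝ (fun z : Vec nx × Vec nu => P.f z.1 z.2))
    (x : Vec nx) (u : Vec nu) :
    HasFDerivAt (fun z : Vec nx × Vec nu => P.f z.1 z.2)
      ((P.jacX x u).coprod (P.jacU x u)) (x, u) := by
  have h0 := (hd (x, u)).hasFDerivAt
  have h1 : HasFDerivAt (fun z => P.f z u) ((fderiv ℝ (fun z : Vec nx × Vec nu => P.f z.1 z.2)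
      (x, u)).comp (ContinuousLinearMap.inl ℝ (Vec nx) (Vec nu))) x :=
    HasFDerivAt.comp (g := fun z : Vec nx × Vec nu => P.f z.1 z.2) (f := fun z => (z, u)) x h0
      (hasFDerivAt_prodMk_left x u)
  have h2 : HasFDerivAt (fun w => P.f x w) ((fderiv ℝ (fun z : Vec nx × Vec nu => P.f z.1 z.2)
      (x, u)).comp (ContinuousLinearMap.inr ℝ (Vec nx) (Vec nu))) u :=
    HasFDerivAt.comp (g := fun z : Vec nx × Vec nu => P.f z.1 z.2) (f := fun w => (x, w)) u h0
      (hasFDerivAt_prodMk_right x u)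
  refine h0.congr_fderiv ?_
  rw [jacX, jacU, h1.fderiv, h2.fderiv]
  ext z <;> simp

lemma hasFDerivAt_f_left (hd : Differentiable ℝ (fun z : Vec nx × Vec nu => P.f z.1 z.2))
    (x : Vec nx) (u : Vec nu) : HasFDerivAt (fun z => P.f z u) (P.jacX x u) x :=
  ((hd.comp (differentiable_id.prodMk (differentiable_const u))) x).hasFDerivAt

lemma hasFDerivAt_f_right (hd : Differentiable ℝ (fun z : Vec nx × Vec nu => P.f z.1 z.2))
    (x : Vec nx) (u : Vec nu) : HasFDerivAt (fun w => P.f x w) (P.jacU x u) u :=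
  ((hd.comp ((differentiable_const x).prodMk differentiable_id)) u).hasFDerivAt

variable (P) in
/-- The derivative of the states: the roll-out of the linearized dynamic. -/
noncomputable def dstate (u : Traj τ nu) : ℕ → Traj τ nu →L[ℝ] Vec nx
  | 0 => 0
  | t + 1 => (P.A u t).comp (dstate u t) + (P.B u t).comp (ctrlL τ nu t)

@[simp] lemma dstate_zero (u v : Traj τ nu) : P.dstate u 0 v = 0 := rfl

lemma dstate_succ (u v : Traj τ nu) (t : ℕ) :
    P.dstate u (t + 1) v = P.A u t (P.dstate u t v) + P.B u t (ctrlAt v t) := by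
  simp [dstate, ctrlL_apply]

lemma hasFDerivAt_state (hd : Differentiable ℝ (fun z : Vec nx × Vec nu => P.f z.1 z.2))
    (u : Traj τ nu) (t : ℕ) : HasFDerivAt (fun w => P.state w t) (P.dstate u t) u := by
  induction t with
  | zero => exact hasFDerivAt_const P.x₀ u
  | succ t ih =>
    have h1 : HasFDerivAt (fun w : Traj τ nu => ctrlAt w t) (ctrlL τ nu t) u := by
      rw [show (fun w : Traj τ nu => ctrlAt w t) = ctrlL τ nu t from
        funext fun w => (ctrlL_apply w t).symm]
      exact (ctrlL τ nu t).hasFDerivAt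
    have h2 := HasFDerivAt.comp (g := fun z : Vec nx × Vec nu => P.f z.1 z.2)
      (f := fun w => (P.state w t, ctrlAt w t)) u
      (hasFDerivAt_f hd (P.state u t) (ctrlAt u t)) (ih.prodMk h1)
    refine h2.congr_fderiv ?_
    ext v : 1
    simp [dstate, A, B]

lemma hasFDerivAt_g (hd : Differentiable ℝ (fun z : Vec nx × Vec nu => P.f z.1 z.2))
    (u : Traj τ nu) :
    HasFDerivAt P.g
      (piLpL fun i : Fin τ => P.dstate u ((i : ℕ) + 1)) u :=
  hasFDerivAt_piLpL fun _ => hasFDerivAt_state hd u _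

lemma ctrlAt_fderiv_g (hd : Differentiable ℝ (fun z : Vec nx × Vec nu => P.f z.1 z.2))
    (u v : Traj τ nu) {t : ℕ} (ht : t < τ) :
    ctrlAt (fderiv ℝ P.g u v) t = P.dstate u (t + 1) v := by
  rw [(hasFDerivAt_g hd u).fderiv, ctrlAt_of_lt _ ht]
  rfl

/-- The adjoint of the derivative of the trajectory map, by the recursion of the costates. -/
lemma ctrlAt_adjoint_fderiv_g (hd : Differentiable ℝ (fun z : Vec nx × Vec nu => P.f z.1 z.2))
    (u : Traj τ nu) (z : Traj τ nx) (φ : ℕ → Vec nx) (hφ : φ τ = 0)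
    (hφ' : ∀ t < τ, φ t
      = ctrlAt z t + ContinuousLinearMap.adjoint (P.A u (t + 1)) (φ (t + 1))) {t : ℕ} (ht : t < τ) :
    ctrlAt (ContinuousLinearMap.adjoint (fderiv ℝ P.g u) z) t
      = ContinuousLinearMap.adjoint (P.B u t) (φ t) := by
  have key : ContinuousLinearMap.adjoint (fderiv ℝ P.g u) z
      = WithLp.toLp 2 fun i : Fin τ => ContinuousLinearMap.adjoint (P.B u i) (φ i) := by
    refine ext_inner_right ℝ fun v => ?_
    rw [ContinuousLinearMap.adjoint_inner_left, traj_inner, traj_inner]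
    -- Summation by parts. The bracket telescopes, and both ends vanish since `dstate` starts at 0
    -- and φ ends at 0. The index is shifted: component t of z and φ t both belong to the state at
    -- time t + 1.
    have h1 : ∀ t ∈ Finset.range τ, inner ℝ (ctrlAt z t) (ctrlAt (fderiv ℝ P.g u v) t)
        = inner ℝ (φ t) (P.B u t (ctrlAt v t)) + (inner ℝ (φ t) (P.A u t (P.dstate u t v))
          - inner ℝ (φ (t + 1)) (P.A u (t + 1) (P.dstate u (t + 1) v))) := by
      intro t ht
      have ht := Finset.mem_range.1 ht
      have h2 : ctrlAt z t = φ t - ContinuousLinearMap.adjoint (P.A u (t + 1)) (φ (t + 1)) := by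
        rw [hφ' t ht]; abel
      rw [ctrlAt_fderiv_g hd u v ht, h2, inner_sub_left, ContinuousLinearMap.adjoint_inner_left]
      nth_rewrite 1 [dstate_succ]
      rw [inner_add_right]
      ring
    rw [Finset.sum_congr rfl h1, Finset.sum_add_distrib, Finset.sum_range_sub', hφ]
    simp only [dstate_zero, map_zero, inner_zero_right, inner_zero_left, sub_zero, add_zero]
    refine Finset.sum_congr rfl fun t ht => ?_
    rw [ctrlAt_of_lt (WithLp.toLp 2 fun i : Fin τ =>
      ContinuousLinearMap.adjoint (P.B u i) (φ i)) (Finset.mem_range.1 ht),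
      ContinuousLinearMap.adjoint_inner_left]
  rw [key, ctrlAt_of_lt _ ht]

end Trajectory

/-! ### The LQR oracle -/

section LQR

/-- For J ≥ 0 the operator νI + B* J B is coercive with constant ν, so the formal inverse is a true
one. This equation replaces all later manipulation of inverses. -/
lemma gain_spec {ν : ℝ} (hν : 0 < ν) (u : Traj τ nu) (t : ℕ) {J : Vec nx →L[ℝ] Vec nx}
    (hJ : ∀ y, 0 ≤ inner ℝ y (J y)) (y : Vec nx) :
    ν • P.gain ν u t J y + ContinuousLinearMap.adjoint (P.B u t) (J (P.B u t (P.gain ν u t J y)))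
      = ContinuousLinearMap.adjoint (P.B u t) y := by
  have h1 := apply_inverse_of_coercive (H := ν • ContinuousLinearMap.id ℝ (Vec nu)
      + (ContinuousLinearMap.adjoint (P.B u t)).comp (J.comp (P.B u t))) hν (fun w => by
    simp only [add_apply, smul_apply, ContinuousLinearMap.id_apply,
      ContinuousLinearMap.comp_apply, inner_add_right, real_inner_smul_right,
      real_inner_self_eq_norm_sq, ContinuousLinearMap.adjoint_inner_right]
    linarith [hJ (P.B u t w)]) (ContinuousLinearMap.adjoint (P.B u t) y)
  exact h1

lemma backward_succ {ν : ℝ} (u : Traj τ nu) {t : ℕ} (ht : t < τ) :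
    P.backward ν u (τ - t) =
      (let J := (P.backward ν u (τ - (t + 1))).1
       let j := (P.backward ν u (τ - (t + 1))).2
       let A := P.A u t
       let B := P.B u t
       let At := ContinuousLinearMap.adjoint A
       (P.hess u t + At.comp (J.comp A) - At.comp (J.comp (B.comp ((P.gain ν u t J).comp (J.comp A)))),
        P.p u t + At j - At (J (B (P.gain ν u t J j))))) := by
  obtain ⟨s, hs⟩ : ∃ s, τ - t = s + 1 := ⟨τ - t - 1, by omega⟩
  have h1 : τ - (t + 1) = s := by omega
  have h2 : τ - (s + 1) = t := by omega
  rw [hs, h1, backward, h2]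

/-- The cost-to-go matrices of the backward pass are coercive. -/
lemma backward_coercive (hyp : P.StandingHypothesis Lh Mh σf) (hμ : 0 < μh)
    (hconv : StrongConvexOn Set.univ μh P.totalCost) {ν : ℝ} (hν : 0 < ν) (u : Traj τ nu) :
    ∀ s < τ, ∀ y, μh * ‖y‖ ^ 2 ≤ inner ℝ y ((P.backward ν u s).1 y) := by
  -- Time 0 carries no cost, so `P.h 0` is arbitrary; hence the restriction to s < τ.
  have hP : ∀ t, 0 < t → t ≤ τ → ∀ y, μh * ‖y‖ ^ 2 ≤ inner ℝ y (P.hess u t y) := by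
    intro t ht ht' y
    obtain ⟨t, rfl⟩ : ∃ s, t = s + 1 := ⟨t - 1, by omega⟩
    exact le_inner_hess_cost hyp hμ hconv (by omega) _ y
  intro s
  induction s with
  | zero => intro hs y; exact hP τ hs le_rfl y
  | succ s ih =>
    intro hs y
    have ih := ih (by omega)
    have h0 := hP (τ - (s + 1)) (by omega) (by omega) y
    simp only [backward]
    set t := τ - (s + 1)
    set J := (P.backward ν u s).1
    have hJ : ∀ y, 0 ≤ inner ℝ y (J y) := fun y =>
      (mul_nonneg hμ.le (sq_nonneg _)).trans (ih y)
    set w := P.gain ν u t J (J (P.A u t y)) with hw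
    have h1 := gain_spec (P := P) hν u t hJ (J (P.A u t y))
    rw [← hw] at h1
    have h2 : ν * ‖w‖ ^ 2 + inner ℝ (P.B u t w) (J (P.B u t w))
        = inner ℝ (P.B u t w) (J (P.A u t y)) := by
      have h3 := congrArg (inner ℝ w) h1
      rwa [inner_add_right, real_inner_smul_right, real_inner_self_eq_norm_sq,
        ContinuousLinearMap.adjoint_inner_right, ContinuousLinearMap.adjoint_inner_right] at h3
    -- Completing the square: the quadratic form of the part added to the Hessian is ν|w|² plus the
    -- form of J at A y - B w, both nonnegative. Symmetry of J is not needed.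
    have h4 := hJ (P.A u t y - P.B u t w)
    rw [map_sub, inner_sub_left, inner_sub_right, inner_sub_right] at h4
    simp only [add_apply, sub_apply, ContinuousLinearMap.comp_apply, inner_add_right,
      inner_sub_right, ContinuousLinearMap.adjoint_inner_right, ← hw]
    have h5 : 0 ≤ ν * ‖w‖ ^ 2 := by positivity
    linarith

lemma backward_nonneg (hyp : P.StandingHypothesis Lh Mh σf) (hμ : 0 < μh)
    (hconv : StrongConvexOn Set.univ μh P.totalCost) {ν : ℝ} (hν : 0 < ν) (u : Traj τ nu)
    {s : ℕ} (hs : s < τ) (y : Vec nx) : 0 ≤ inner ℝ y ((P.backward ν u s).1 y) :=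
  (mul_nonneg hμ.le (sq_nonneg _)).trans (backward_coercive hyp hμ hconv hν u s hs y)

lemma ctrlAt_LQR (ν : ℝ) (u : Traj τ nu) {t : ℕ} (ht : t < τ) :
    ctrlAt (P.LQR ν u) t = P.policy ν u t (P.lqrRoll ν u t) := ctrlAt_of_lt _ ht

lemma ctrlAt_DDP (ν : ℝ) (u : Traj τ nu) {t : ℕ} (ht : t < τ) :
    ctrlAt (P.DDP ν u) t = P.policy ν u t (P.ddpRoll ν u t) := ctrlAt_of_lt _ ht

lemma lqrRoll_eq_dstate (ν : ℝ) (u : Traj τ nu) {t : ℕ} (ht : t ≤ τ) :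
    P.lqrRoll ν u t = P.dstate u t (P.LQR ν u) := by
  induction t with
  | zero => rfl
  | succ t ih =>
    have ih := ih (by omega)
    rw [lqrRoll, dstate_succ, ctrlAt_LQR ν u (by omega), ih]

/-- The LQR oracle minimizes the regularized linear quadratic model of the objective. -/
theorem regStep_LQR (hyp : P.StandingHypothesis Lh Mh σf) (hμ : 0 < μh)
    (hconv : StrongConvexOn Set.univ μh P.totalCost) {ν : ℝ} (hν : 0 < ν) (u : Traj τ nu) :
    RegStep (fderiv ℝ P.g u) (fderiv ℝ (gradient P.totalCost) (P.g u))
      (gradient P.totalCost (P.g u)) ν (P.LQR ν u) where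
  reg_pos := hν
  stationary := by
    set v := P.LQR ν u with hv
    -- the costates
    let φ : ℕ → Vec nx := fun t => if t < τ then
      (P.backward ν u (τ - (t + 1))).1 (P.lqrRoll ν u (t + 1)) + (P.backward ν u (τ - (t + 1))).2
      else 0
    have hφ : φ τ = 0 := if_neg (lt_irrefl τ)
    have hroll : ∀ t < τ, P.lqrRoll ν u (t + 1)
        = P.A u t (P.lqrRoll ν u t) + P.B u t (P.policy ν u t (P.lqrRoll ν u t)) :=
      fun t _ => rfl
    have hφ' : ∀ t < τ, φ t = ctrlAt (gradient P.totalCost (P.g u)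
        + fderiv ℝ (gradient P.totalCost) (P.g u) (fderiv ℝ P.g u v)) t
        + ContinuousLinearMap.adjoint (P.A u (t + 1)) (φ (t + 1)) := by
      intro t ht
      rw [ctrlAt_add, ctrlAt_gradient_totalCost hyp _ ht, ctrlAt_hess_totalCost hyp _ _ ht,
        ctrlAt_g u ht, ctrlAt_fderiv_g hyp.dyn_diff u v ht, hv, ← lqrRoll_eq_dstate ν u ht]
      simp only [φ, if_pos ht]
      rcases Nat.lt_or_ge (t + 1) τ with h | h
      -- Substituting the policy into J y + j turns the backward recursion into the costate
      -- recursion.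
      · rw [if_pos h, backward_succ u h]
        simp only [add_apply, sub_apply, ContinuousLinearMap.comp_apply]
        set J := (P.backward ν u (τ - (t + 1 + 1))).1
        set j := (P.backward ν u (τ - (t + 1 + 1))).2
        rw [hroll (t + 1) h]
        simp only [policy]
        simp only [map_add, map_sub, map_neg, p, hess]
        abel
      · obtain rfl : t + 1 = τ := by omega
        rw [if_neg (lt_irrefl _), Nat.sub_self, map_zero, add_zero, backward, add_comm]
        rfl
    have hadj := fun {t} ht => ctrlAt_adjoint_fderiv_g hyp.dyn_diff u _ φ hφ hφ' (t := t) ht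
    ext1 i
    have hi := i.2
    have h1 := hadj hi
    rw [ctrlAt_of_lt _ hi] at h1
    have hvi : v i = P.policy ν u i (P.lqrRoll ν u i) := rfl
    have h2 := fun y => gain_spec (P := P) hν u i
      (backward_nonneg hyp hμ hconv hν u (show τ - ((i : ℕ) + 1) < τ by omega)) y
    change ν • v i + ContinuousLinearMap.adjoint (fderiv ℝ P.g u) _ i = 0
    rw [h1, hvi]
    simp only [φ, if_pos hi, hroll i hi, policy]
    set J := (P.backward ν u (τ - ((i : ℕ) + 1))).1
    set j := (P.backward ν u (τ - ((i : ℕ) + 1))).2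
    set y := P.lqrRoll ν u i
    -- The policy is affine. The gain equation at J A y handles its linear part, and at j its
    -- constant part.
    have h3 := h2 (J (P.A u i y))
    have h4 := h2 j
    simp only [map_add, map_sub, map_neg, smul_sub, smul_neg, ← h3, ← h4]
    abel

end LQR

end Problem

end OptControl

/-! ### Constants of the trajectory map. -/

namespace OptControl

/-- Young's inequality for the solutions of a first order linear recursion. -/
lemma sum_sq_le_of_recursion {l : ℝ} (hl : 0 ≤ l) {a c : ℕ → ℝ} (ha : ∀ t, 0 ≤ a t)
    (ha0 : a 0 = 0) {n : ℕ} (hrec : ∀ t < n, a (t + 1) ≤ l * a t + c t) :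
    ∑ t ∈ Finset.range n, a (t + 1) ^ 2
      ≤ (∑ k ∈ Finset.range n, l ^ k) ^ 2 * ∑ t ∈ Finset.range n, c t ^ 2 := by
  let S : ℕ → ℝ := fun m => ∑ k ∈ Finset.range m, l ^ k
  -- b obeys the same linear recursion, driven by the squares of c. The invariant a_t² ≤ S_t b_t,
  -- from Young's inequality with weight S_t, reduces a bound on the sum of squares to a linear one
  -- on the sum of b.
  let b : ℕ → ℝ := fun m => Nat.rec 0 (fun t b => l * b + c t ^ 2) m
  have hb0 : b 0 = 0 := rfl
  have hbs : ∀ t, b (t + 1) = l * b t + c t ^ 2 := fun t => rfl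
  have hSs : ∀ m, S (m + 1) = l * S m + 1 := fun m => by
    simp only [S]
    rw [geom_sum_succ]
  have hS0 : ∀ m, 0 ≤ S m := fun m => Finset.sum_nonneg fun k _ => pow_nonneg hl k
  have hb : ∀ m, 0 ≤ b m := by
    intro m
    induction m with
    | zero => exact le_rfl
    | succ m ih => rw [hbs]; positivity
  have hSm : Monotone S := monotone_nat_of_le_succ fun m => by
    simp only [S, Finset.sum_range_succ]
    linarith [pow_nonneg hl m]
  have h1 : ∀ t ≤ n, a t ^ 2 ≤ S t * b t := by
    intro t
    induction t with
    | zero => intro _; simp [ha0, hb0]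
    | succ t ih =>
      intro ht
      have ih := ih (by omega)
      have h2 := pow_le_pow_left₀ (ha _) (hrec t ht) 2
      refine h2.trans ?_
      rw [hSs, hbs]
      have h3 : 2 * (a t * c t) ≤ S t * c t ^ 2 + b t := by
        refine abs_le_of_sq_le_sq' ?_ (add_nonneg (mul_nonneg (hS0 t) (sq_nonneg _)) (hb t)) |>.2
        have h4 : a t ^ 2 * c t ^ 2 ≤ S t * b t * c t ^ 2 := by gcongr
        nlinarith [sq_nonneg (S t * c t ^ 2 - b t)]
      have h5 := mul_le_mul_of_nonneg_left h3 hl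
      have h6 := mul_le_mul_of_nonneg_left ih (sq_nonneg l)
      nlinarith
  have h2 : ∀ m, ∑ t ∈ Finset.range m, b (t + 1) ≤ S m * ∑ t ∈ Finset.range m, c t ^ 2 := by
    intro m
    induction m with
    | zero => simp
    | succ m ih =>
      have h3 : ∑ t ∈ Finset.range (m + 1), b (t + 1)
          = l * ∑ t ∈ Finset.range m, b (t + 1) + ∑ t ∈ Finset.range (m + 1), c t ^ 2 := by
        simp only [hbs, Finset.sum_add_distrib]
        rw [← Finset.mul_sum, Finset.sum_range_succ' (fun t => b t), hb0, add_zero]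
        simp only [hbs, Finset.sum_add_distrib]
      have h4 : ∑ t ∈ Finset.range m, c t ^ 2 ≤ ∑ t ∈ Finset.range (m + 1), c t ^ 2 := by
        rw [Finset.sum_range_succ]; linarith [sq_nonneg (c m)]
      have h5 := ih.trans (mul_le_mul_of_nonneg_left h4 (hS0 m))
      rw [h3, hSs]
      linarith [mul_le_mul_of_nonneg_left h5 hl]
  calc ∑ t ∈ Finset.range n, a (t + 1) ^ 2 ≤ ∑ t ∈ Finset.range n, S n * b (t + 1) := by
        refine Finset.sum_le_sum fun t ht => ?_
        have ht := Finset.mem_range.1 ht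
        exact (h1 (t + 1) ht).trans (mul_le_mul_of_nonneg_right (hSm (Nat.succ_le_of_lt ht)) (hb (t + 1)))
    _ = S n * ∑ t ∈ Finset.range n, b (t + 1) := by rw [Finset.mul_sum]
    _ ≤ S n * (S n * ∑ t ∈ Finset.range n, c t ^ 2) :=
        mul_le_mul_of_nonneg_left (h2 n) (hS0 n)
    _ = _ := by ring

/-- Minkowski's inequality for finite sums of squares. -/
lemma sum_add_sq_le {ι : Type*} {s : Finset ι} {a b : ι → ℝ} {X Y : ℝ} (hX : 0 ≤ X) (hY : 0 ≤ Y)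
    (ha : ∑ i ∈ s, a i ^ 2 ≤ X ^ 2) (hb : ∑ i ∈ s, b i ^ 2 ≤ Y ^ 2) :
    ∑ i ∈ s, (a i + b i) ^ 2 ≤ (X + Y) ^ 2 := by
  have h1 := Finset.sum_mul_sq_le_sq_mul_sq s a b
  have h2 : ∑ i ∈ s, a i * b i ≤ X * Y := by
    refine abs_le_of_sq_le_sq' ?_ (by positivity) |>.2
    rw [mul_pow]
    exact h1.trans (mul_le_mul ha hb (Finset.sum_nonneg fun _ _ => sq_nonneg _) (sq_nonneg _))
  have h3 : ∑ i ∈ s, (a i + b i) ^ 2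
      = ∑ i ∈ s, a i ^ 2 + 2 * ∑ i ∈ s, a i * b i + ∑ i ∈ s, b i ^ 2 := by
    rw [Finset.mul_sum, ← Finset.sum_add_distrib, ← Finset.sum_add_distrib]
    exact Finset.sum_congr rfl fun i _ => by ring
  rw [h3]
  linarith

variable {τ nx nu : ℕ}

namespace Problem

variable {P : Problem τ nx nu} {Lh Mh lx lu Lxx Lxu Luu : ℝ≥0} {σf : ℝ}

namespace DynConstants

lemma norm_jacX_le (D : P.DynConstants lx lu Lxx Lxu Luu) (x : Vec nx) (u : Vec nu) :
    ‖P.jacX x u‖ ≤ lx := norm_fderiv_le_of_lipschitz ℝ (D.lip_x u)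

lemma norm_jacU_le (D : P.DynConstants lx lu Lxx Lxu Luu) (x : Vec nx) (u : Vec nu) :
    ‖P.jacU x u‖ ≤ lu := norm_fderiv_le_of_lipschitz ℝ (D.lip_u x)

/-- The two mixed Lipschitz constants of the derivative of the dynamic agree. -/
lemma smooth_ux (D : P.DynConstants lx lu Lxx Lxu Luu)
    (hd : Differentiable ℝ (fun z : Vec nx × Vec nu => P.f z.1 z.2)) (x : Vec nx)
    (u u' : Vec nu) : ‖P.jacX x u - P.jacX x u'‖ ≤ Lxu * ‖u - u'‖ := by
  -- The second difference of f is bounded by the mean value inequality in u, then read as a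
  -- Lipschitz bound in x; no second derivative of f is needed.
  have h1 : ∀ x x' : Vec nx,
      ‖(P.f x u - P.f x u') - (P.f x' u - P.f x' u')‖ ≤ Lxu * ‖u - u'‖ * ‖x - x'‖ := by
    intro x x'
    have h2 : ∀ w, HasFDerivAt (fun w => P.f x w - P.f x' w) (P.jacU x w - P.jacU x' w) w :=
      fun w => (hasFDerivAt_f_right hd x w).sub (hasFDerivAt_f_right hd x' w)
    have h3 := Convex.norm_image_sub_le_of_norm_hasFDerivWithin_le (s := Set.univ)
      (C := Lxu * ‖x - x'‖) (fun w _ => (h2 w).hasFDerivWithinAt)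
      (fun w _ => (D.smooth_xu w).norm_sub_le x x') convex_univ (Set.mem_univ u') (Set.mem_univ u)
    calc _ = ‖(P.f x u - P.f x' u) - (P.f x u' - P.f x' u')‖ := by congr 1; abel
      _ ≤ _ := h3
      _ = _ := by ring
  have h4 : LipschitzWith (Lxu * ‖u - u'‖₊) (fun x => P.f x u - P.f x u') :=
    LipschitzWith.of_dist_le_mul fun x x' => by
      rw [dist_eq_norm, dist_eq_norm]
      simpa using h1 x x'
  have h5 := norm_fderiv_le_of_lipschitz ℝ h4 (x₀ := x)
  rw [((hasFDerivAt_f_left hd x u).fun_sub (hasFDerivAt_f_left hd x u')).fderiv] at h5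
  simpa using h5

variable (D : P.DynConstants lx lu Lxx Lxu Luu)
include D

lemma norm_state_sub_sq_le (u u' : Traj τ nu) :
    ∑ t ∈ Finset.range τ, ‖P.state u (t + 1) - P.state u' (t + 1)‖ ^ 2
      ≤ (lu * (∑ k ∈ Finset.range τ, (lx : ℝ) ^ k) * ‖u - u'‖) ^ 2 := by
  have h1 := sum_sq_le_of_recursion (l := lx) (n := τ) lx.coe_nonneg
    (a := fun t => ‖P.state u t - P.state u' t‖) (c := fun t => lu * ‖ctrlAt (u - u') t‖)
    (fun t => norm_nonneg _) (by simp [state])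
    (fun t _ => by
      have e : P.state u (t + 1) - P.state u' (t + 1)
          = (P.f (P.state u t) (ctrlAt u t) - P.f (P.state u' t) (ctrlAt u t))
            + (P.f (P.state u' t) (ctrlAt u t) - P.f (P.state u' t) (ctrlAt u' t)) := by
        simp [state]
      rw [e, ctrlAt_sub]
      exact norm_add_le_of_le ((D.lip_x _).norm_sub_le _ _) ((D.lip_u _).norm_sub_le _ _))
  refine h1.trans_eq ?_
  simp only [mul_pow]
  rw [← Finset.mul_sum, ← traj_norm_sq]
  ring

lemma norm_dstate_sq_le (u v : Traj τ nu) :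
    ∑ t ∈ Finset.range τ, ‖P.dstate u (t + 1) v‖ ^ 2
      ≤ (lu * (∑ k ∈ Finset.range τ, (lx : ℝ) ^ k) * ‖v‖) ^ 2 := by
  have h1 := sum_sq_le_of_recursion (l := lx) (n := τ) lx.coe_nonneg
    (a := fun t => ‖P.dstate u t v‖) (c := fun t => lu * ‖ctrlAt v t‖)
    (fun t => norm_nonneg _) (by simp)
    (fun t _ => by
      rw [dstate_succ]
      exact norm_add_le_of_le (ContinuousLinearMap.le_of_opNorm_le _ (D.norm_jacX_le _ _) _)
        (ContinuousLinearMap.le_of_opNorm_le _ (D.norm_jacU_le _ _) _))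
  refine h1.trans_eq ?_
  simp only [mul_pow]
  rw [← Finset.mul_sum, ← traj_norm_sq]
  ring

lemma lipschitz_g {S lg : ℝ≥0} (hS : S = ∑ t ∈ Finset.range τ, lx ^ t) (hlg : lg = lu * S) :
    LipschitzWith lg P.g := by
  refine LipschitzWith.of_dist_le_mul fun u u' => ?_
  rw [dist_eq_norm, dist_eq_norm]
  refine abs_le_of_sq_le_sq' ?_ (by positivity) |>.2
  rw [traj_norm_sq, hlg, hS]
  push_cast
  refine le_trans (le_of_eq ?_) (D.norm_state_sub_sq_le u u')
  refine Finset.sum_congr rfl fun t ht => ?_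
  have ht := Finset.mem_range.1 ht
  rw [ctrlAt_sub, ctrlAt_g u ht, ctrlAt_g u' ht]

/-- The difference of two linearized roll-outs follows the linearized recursion, forced by the
differences of A and B. Each of these is controlled by the displacement of states, at most lg|u -
u'|, and of controls. Bounding states by the norm of the whole trajectory saves a factor S on the
`Lxx` term. -/
lemma lipschitz_fderiv_g (hd : Differentiable ℝ (fun z : Vec nx × Vec nu => P.f z.1 z.2))
    {S lg : ℝ≥0} (hS : S = ∑ t ∈ Finset.range τ, lx ^ t) (hlg : lg = lu * S) :
    LipschitzWith (S * (Lxx * lg ^ 2 + 2 * Lxu * lg + Luu)) (fderiv ℝ P.g) := by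
  have hSr : (S : ℝ) = ∑ k ∈ Finset.range τ, (lx : ℝ) ^ k := by rw [hS]; push_cast; rfl
  have hlgr : (lg : ℝ) = lu * ∑ k ∈ Finset.range τ, (lx : ℝ) ^ k := by
    rw [hlg]; push_cast; rw [hSr]
  refine LipschitzWith.of_dist_le_mul fun u u' => ?_
  rw [dist_eq_norm, dist_eq_norm]
  refine ContinuousLinearMap.opNorm_le_bound _ (by positivity) fun v => ?_
  set U := ‖u - u'‖
  have hU0 : 0 ≤ U := norm_nonneg _
  have hstate : ∀ t ≤ τ, ‖P.state u t - P.state u' t‖ ≤ lg * U := by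
    intro t ht
    rcases t with _ | t
    · simp only [state, sub_self, norm_zero]; positivity
    · refine abs_le_of_sq_le_sq' ?_ (by positivity) |>.2
      rw [hlgr]
      refine le_trans ?_ (D.norm_state_sub_sq_le u u')
      exact Finset.single_le_sum (f := fun t => ‖P.state u (t + 1) - P.state u' (t + 1)‖ ^ 2)
        (fun _ _ => sq_nonneg _) (Finset.mem_range.2 ht)
  set α : ℝ := Lxx * (lg * U) + Lxu * U with hα
  set β : ℝ := Lxu * (lg * U) + Luu * U with hβ
  have hα0 : 0 ≤ α := by positivity
  have hβ0 : 0 ≤ β := by positivity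
  have hA : ∀ t < τ, ‖P.A u t - P.A u' t‖ ≤ α := by
    intro t ht
    have e : P.A u t - P.A u' t
        = (P.jacX (P.state u t) (ctrlAt u t) - P.jacX (P.state u' t) (ctrlAt u t))
          + (P.jacX (P.state u' t) (ctrlAt u t) - P.jacX (P.state u' t) (ctrlAt u' t)) := by
      simp [A]
    rw [e]
    refine norm_add_le_of_le (((D.smooth_xx _).norm_sub_le _ _).trans ?_)
      ((D.smooth_ux hd _ _ _).trans ?_)
    · have := hstate t ht.le
      gcongr
    · rw [← ctrlAt_sub]
      have := norm_ctrlAt_le (u - u') t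
      gcongr
  have hB : ∀ t < τ, ‖P.B u t - P.B u' t‖ ≤ β := by
    intro t ht
    have e : P.B u t - P.B u' t
        = (P.jacU (P.state u t) (ctrlAt u t) - P.jacU (P.state u' t) (ctrlAt u t))
          + (P.jacU (P.state u' t) (ctrlAt u t) - P.jacU (P.state u' t) (ctrlAt u' t)) := by
      simp [B]
    rw [e]
    refine norm_add_le_of_le (((D.smooth_xu _).norm_sub_le _ _).trans ?_)
      (((D.smooth_uu _).norm_sub_le _ _).trans ?_)
    · have := hstate t ht.le
      gcongr
    · rw [← ctrlAt_sub]
      have := norm_ctrlAt_le (u - u') t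
      gcongr
  have h1 := sum_sq_le_of_recursion (l := lx) (n := τ) lx.coe_nonneg
    (a := fun t => ‖P.dstate u t v - P.dstate u' t v‖)
    (c := fun t => α * ‖P.dstate u' t v‖ + β * ‖ctrlAt v t‖)
    (fun t => norm_nonneg _) (by simp)
    (fun t ht => by
      have e : P.dstate u (t + 1) v - P.dstate u' (t + 1) v
          = P.A u t (P.dstate u t v - P.dstate u' t v)
            + ((P.A u t - P.A u' t) (P.dstate u' t v) + (P.B u t - P.B u' t) (ctrlAt v t)) := by
        simp only [dstate_succ, map_sub, sub_apply]
        abel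
      simp only [e]
      exact norm_add_le_of_le (ContinuousLinearMap.le_of_opNorm_le _ (D.norm_jacX_le _ _) _)
        (norm_add_le_of_le (ContinuousLinearMap.le_of_opNorm_le _ (hA t ht) _)
          (ContinuousLinearMap.le_of_opNorm_le _ (hB t ht) _)))
  have h2 : ∑ t ∈ Finset.range τ, (α * ‖P.dstate u' t v‖) ^ 2 ≤ (α * (lg * ‖v‖)) ^ 2 := by
    simp only [mul_pow α]
    rw [← Finset.mul_sum]
    refine mul_le_mul_of_nonneg_left ?_ (sq_nonneg _)
    rw [hlgr]
    refine le_trans ?_ (D.norm_dstate_sq_le u' v)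
    have h3 := Finset.sum_range_succ' (fun t => ‖P.dstate u' t v‖ ^ 2) τ
    rw [Finset.sum_range_succ] at h3
    simp only [dstate_zero, norm_zero] at h3
    linarith [sq_nonneg ‖P.dstate u' τ v‖]
  have h3 : ∑ t ∈ Finset.range τ, (β * ‖ctrlAt v t‖) ^ 2 ≤ (β * ‖v‖) ^ 2 := by
    simp only [mul_pow β]
    rw [← Finset.mul_sum, ← traj_norm_sq]
  have h4 := sum_add_sq_le (by positivity) (by positivity) h2 h3
  refine abs_le_of_sq_le_sq' ?_ (by positivity) |>.2
  rw [traj_norm_sq]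
  calc _ = ∑ t ∈ Finset.range τ, ‖P.dstate u (t + 1) v - P.dstate u' (t + 1) v‖ ^ 2 := by
        refine Finset.sum_congr rfl fun t ht => ?_
        have ht := Finset.mem_range.1 ht
        rw [sub_apply, ctrlAt_sub, ctrlAt_fderiv_g hd u v ht, ctrlAt_fderiv_g hd u' v ht]
    _ ≤ _ := h1
    _ ≤ (∑ k ∈ Finset.range τ, (lx : ℝ) ^ k) ^ 2 * (α * (lg * ‖v‖) + β * ‖v‖) ^ 2 := by gcongr
    _ = _ := by
        rw [← hSr, hα, hβ]
        push_cast
        ring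

/-- The adjoint of the derivative has components B_t* φ_t, so it controls the costates up to σf.
Conversely z_t = φ_t - A_{t+1}* φ_{t+1} involves only two costates, which costs 1 + lx and no
geometric sum. -/
lemma surj_fderiv_g (hyp : P.StandingHypothesis Lh Mh σf) (u : Traj τ nu) (z : Traj τ nx) :
    σf / (1 + lx) * ‖z‖ ≤ ‖ContinuousLinearMap.adjoint (fderiv ℝ P.g u) z‖ := by
  have hσ := hyp.surj_pos
  -- the costates, indexed by the number of remaining steps
  let χ : ℕ → Vec nx := fun s => Nat.rec 0 (fun s c =>
    ctrlAt z (τ - (s + 1)) + ContinuousLinearMap.adjoint (P.A u (τ - (s + 1) + 1)) c) s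
  let φ : ℕ → Vec nx := fun t => χ (τ - t)
  have hφ : φ τ = 0 := by simp [φ, χ]
  have hφ' : ∀ t < τ, φ t
      = ctrlAt z t + ContinuousLinearMap.adjoint (P.A u (t + 1)) (φ (t + 1)) := by
    intro t ht
    obtain ⟨s, hs⟩ : ∃ s, τ - t = s + 1 := ⟨τ - t - 1, by omega⟩
    have h1 : τ - (s + 1) = t := by omega
    have h2 : τ - (t + 1) = s := by omega
    have h3 : χ (s + 1) = ctrlAt z (τ - (s + 1))
      + ContinuousLinearMap.adjoint (P.A u (τ - (s + 1) + 1)) (χ s) := rfl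
    simp only [φ, hs, h2, h3, h1]
  have hadj := fun {t} ht => ctrlAt_adjoint_fderiv_g hyp.dyn_diff u z φ hφ hφ' (t := t) ht
  set G := ContinuousLinearMap.adjoint (fderiv ℝ P.g u) z
  have h1 : ∑ t ∈ Finset.range τ, ‖φ t‖ ^ 2 ≤ (‖G‖ / σf) ^ 2 := by
    rw [div_pow, le_div_iff₀ (by positivity), traj_norm_sq, Finset.sum_mul]
    refine Finset.sum_le_sum fun t ht => ?_
    rw [hadj (Finset.mem_range.1 ht)]
    have := pow_le_pow_left₀ (by positivity) (hyp.surj (P.state u t) (ctrlAt u t) (φ t)) 2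
    rw [mul_pow] at this
    rw [mul_comm]
    exact this
  have h2 : ∑ t ∈ Finset.range τ, (lx * ‖φ (t + 1)‖) ^ 2 ≤ (lx * (‖G‖ / σf)) ^ 2 := by
    simp only [mul_pow (lx : ℝ)]
    rw [← Finset.mul_sum]
    refine mul_le_mul_of_nonneg_left (le_trans ?_ h1) (sq_nonneg _)
    have h3 := Finset.sum_range_succ' (fun t => ‖φ t‖ ^ 2) τ
    rw [Finset.sum_range_succ, hφ, norm_zero] at h3
    linarith [sq_nonneg ‖φ 0‖]
  have h3 := sum_add_sq_le (by positivity) (by positivity) h1 h2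
  have h4 : ‖z‖ ≤ ‖G‖ / σf + lx * (‖G‖ / σf) := by
    refine abs_le_of_sq_le_sq' (le_trans ?_ h3) (by positivity) |>.2
    rw [traj_norm_sq]
    refine Finset.sum_le_sum fun t ht => pow_le_pow_left₀ (norm_nonneg _) ?_ 2
    have e : ctrlAt z t = φ t - ContinuousLinearMap.adjoint (P.A u (t + 1)) (φ (t + 1)) := by
      rw [hφ' t (Finset.mem_range.1 ht)]; abel
    rw [e]
    refine norm_sub_le_of_le le_rfl (ContinuousLinearMap.le_of_opNorm_le _ ?_ _)
    rw [LinearIsometryEquiv.norm_map]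
    exact D.norm_jacX_le _ _
  have h5 : ‖G‖ / σf + lx * (‖G‖ / σf) = (1 + lx) / σf * ‖G‖ := by ring
  rw [h5] at h4
  calc σf / (1 + lx) * ‖z‖ ≤ σf / (1 + lx) * ((1 + lx) / σf * ‖G‖) := by gcongr
    _ = ‖G‖ := by field_simp

/-- Constants of the trajectory map from those of the dynamic. -/
theorem trajConstants (hyp : P.StandingHypothesis Lh Mh σf) {S lg : ℝ≥0}
    (hS : S = ∑ t ∈ Finset.range τ, lx ^ t) (hlg : lg = lu * S) :
    P.TrajConstants lg (S * (Lxx * S * lg ^ 2 + 2 * Lxu * lg + Luu)) (σf / (1 + lx)) where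
  lip := D.lipschitz_g hS hlg
  smooth := by
    refine (D.lipschitz_fderiv_g hyp.dyn_diff hS hlg).weaken ?_
    -- For τ = 0 both constants vanish with S; otherwise S ≥ 1 and the additional factor S only
    -- weakens the bound.
    rcases Nat.eq_zero_or_pos τ with h0 | h0
    · subst h0; simp [hS]
    have h1 : 1 ≤ S := by
      rw [hS]
      have := Finset.single_le_sum (f := fun t => lx ^ t) (fun _ _ => zero_le)
        (Finset.mem_range.2 h0)
      simpa using this
    gcongr
    exact le_mul_of_one_le_right (zero_le) h1
  surj_pos := div_pos hyp.surj_pos (by positivity)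
  surj := D.surj_fderiv_g hyp

end DynConstants

end Problem

end OptControl

namespace OptControl

/-! ### Distance between the DDP and LQR oracles. -/

namespace Problem

variable {τ nx nu : ℕ} {P : Problem τ nx nu} {Lh Mh : ℝ≥0} {σf μh : ℝ}

lemma norm_jacX_le_of_lipschitz {K : ℝ≥0}
    (hK : LipschitzWith K (fun z : Vec nx × Vec nu => P.f z.1 z.2)) (x : Vec nx) (u : Vec nu) :
    ‖P.jacX x u‖ ≤ K := by
  refine norm_fderiv_le_of_lipschitz ℝ (LipschitzWith.of_dist_le_mul fun z z' => ?_)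
  simpa [Prod.dist_eq] using hK.dist_le_mul (z, u) (z', u)

lemma norm_jacU_le_of_lipschitz {K : ℝ≥0}
    (hK : LipschitzWith K (fun z : Vec nx × Vec nu => P.f z.1 z.2)) (x : Vec nx) (u : Vec nu) :
    ‖P.jacU x u‖ ≤ K := by
  refine norm_fderiv_le_of_lipschitz ℝ (LipschitzWith.of_dist_le_mul fun z z' => ?_)
  simpa [Prod.dist_eq] using hK.dist_le_mul (x, z) (x, z')

/-- The gain applied to y is a `RegStep` for the operators B_t and J and the gradient -y. The bound
on such steps is free of ν, whereas inverting with coercivity ν alone would give 1/ν. -/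
lemma norm_gain_le (hyp : P.StandingHypothesis Lh Mh σf) (hμ : 0 < μh)
    (hconv : StrongConvexOn Set.univ μh P.totalCost) {ν : ℝ} (hν : 0 < ν) (u : Traj τ nu)
    (t : ℕ) {s : ℕ} (hs : s < τ) :
    ‖P.gain ν u t (P.backward ν u s).1‖ ≤ (σf * μh)⁻¹ := by
  have hσ := hyp.surj_pos
  refine ContinuousLinearMap.opNorm_le_bound _ (by positivity) fun y => ?_
  set J := (P.backward ν u s).1
  have h1 := gain_spec (P := P) hν u t (backward_nonneg hyp hμ hconv hν u hs) y
  have h2 : RegStep (P.B u t) J (-y) ν (P.gain ν u t J y) := by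
    refine ⟨hν, ?_⟩
    rw [map_add, map_neg, ← h1]
    abel
  have h3 := h2.norm_le_of_gradient hμ (backward_coercive hyp hμ hconv hν u s hs)
    (hyp.surj (P.state u t) (ctrlAt u t))
  rw [norm_neg] at h3
  rw [inv_mul_eq_div, le_div_iff₀ (by positivity)]
  linarith

/-- The cost-to-go matrices are bounded, uniformly in the control and in the regularization. -/
lemma exists_norm_backward_le (hyp : P.StandingHypothesis Lh Mh σf) (hμ : 0 < μh)
    (hconv : StrongConvexOn Set.univ μh P.totalCost) :
    ∃ C : ℝ, 0 ≤ C ∧ ∀ (u : Traj τ nu) (ν : ℝ), 0 < ν → ∀ s < τ, ‖(P.backward ν u s).1‖ ≤ C := by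
  obtain ⟨K, hK⟩ := hyp.dyn_lip
  have hσ := hyp.surj_pos
  have hP : ∀ (u : Traj τ nu) (t : ℕ), 0 < t → t ≤ τ → ‖P.hess u t‖ ≤ Lh := fun u t ht ht' =>
    norm_fderiv_le_of_lipschitz ℝ (hyp.cost_grad t (Finset.mem_Icc.2 ⟨ht, ht'⟩))
  suffices h : ∀ n : ℕ, ∃ C : ℝ, 0 ≤ C ∧ ∀ (u : Traj τ nu) (ν : ℝ), 0 < ν →
      ∀ s < τ, s ≤ n → ‖(P.backward ν u s).1‖ ≤ C by
    obtain ⟨C, hC, h⟩ := h τ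
    exact ⟨C, hC, fun u ν hν s hs => h u ν hν s hs hs.le⟩
  intro n
  induction n with
  | zero =>
    refine ⟨Lh, Lh.coe_nonneg, fun u ν _ s hs hs0 => ?_⟩
    obtain rfl : s = 0 := by omega
    exact hP u τ hs le_rfl
  | succ n ih =>
    obtain ⟨C, hC, h⟩ := ih
    refine ⟨max C (Lh + K * (C * K) + K * (C * (K * ((σf * μh)⁻¹ * (C * K))))),
      le_max_of_le_left hC, fun u ν hν s hs hsn => ?_⟩
    rcases Nat.lt_or_ge n s with hns | hns
    · obtain rfl : s = n + 1 := by omega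
      refine le_max_of_le_right ?_
      have hJ := h u ν hν n (by omega) le_rfl
      have hg := fun t => norm_gain_le hyp hμ hconv hν u t (show n < τ by omega)
      simp only [backward]
      have hA : ‖P.A u (τ - (n + 1))‖ ≤ K := norm_jacX_le_of_lipschitz hK _ _
      have hB : ‖P.B u (τ - (n + 1))‖ ≤ K := norm_jacU_le_of_lipschitz hK _ _
      have hAt : ‖ContinuousLinearMap.adjoint (P.A u (τ - (n + 1)))‖ ≤ K := by
        rwa [LinearIsometryEquiv.norm_map]
      have hg := hg (τ - (n + 1))
      have hc : ∀ {X Y Z : Type} [NormedAddCommGroup X] [NormedSpace ℝ X] [NormedAddCommGroup Y]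
          [NormedSpace ℝ Y] [NormedAddCommGroup Z] [NormedSpace ℝ Z] {S : Y →L[ℝ] Z}
          {T : X →L[ℝ] Y} {a b : ℝ}, ‖S‖ ≤ a → ‖T‖ ≤ b → ‖S.comp T‖ ≤ a * b :=
        fun {X Y Z} _ _ _ _ _ _ {S T a b} hS hT =>
          (S.opNorm_comp_le T).trans (mul_le_mul hS hT (norm_nonneg _) ((norm_nonneg _).trans hS))
      exact norm_sub_le_of_le
        (norm_add_le_of_le (hP u _ (by omega) (by omega)) (hc hAt (hc hJ hA)))
        (hc hAt (hc hJ (hc hB (hc hg (hc hJ hA)))))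
    · exact le_max_of_le_left (h u ν hν s hs hns)

/-- The policies are Lipschitz continuous, uniformly in the control and in the regularization. -/
lemma exists_norm_policy_sub_le (hyp : P.StandingHypothesis Lh Mh σf) (hμ : 0 < μh)
    (hconv : StrongConvexOn Set.univ μh P.totalCost) :
    ∃ κ : ℝ, 0 ≤ κ ∧ ∀ (u : Traj τ nu) (ν : ℝ), 0 < ν → ∀ t < τ, ∀ y y',
      ‖P.policy ν u t y' - P.policy ν u t y‖ ≤ κ * ‖y' - y‖ := by
  obtain ⟨C, hC, hJ⟩ := exists_norm_backward_le hyp hμ hconv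
  obtain ⟨K, hK⟩ := hyp.dyn_lip
  have hσ := hyp.surj_pos
  refine ⟨(σf * μh)⁻¹ * (C * K), by positivity, fun u ν hν t ht y y' => ?_⟩
  have hs : τ - (t + 1) < τ := by omega
  have e : P.policy ν u t y' - P.policy ν u t y
      = -(P.gain ν u t (P.backward ν u (τ - (t + 1))).1
        ((P.backward ν u (τ - (t + 1))).1 (P.A u t (y' - y)))) := by
    simp only [policy, map_sub]
    abel
  rw [e, norm_neg, mul_assoc, mul_assoc]
  exact ContinuousLinearMap.le_of_opNorm_le_of_le _ (norm_gain_le hyp hμ hconv hν u t hs)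
    (ContinuousLinearMap.le_of_opNorm_le_of_le _ (hJ u ν hν _ hs)
      (ContinuousLinearMap.le_of_opNorm_le _ (norm_jacX_le_of_lipschitz hK _ _) _))

/-- The two roll-outs differ by a term quadratic in the LQR oracle. -/
lemma exists_norm_ddpRoll_sub_le (hyp : P.StandingHypothesis Lh Mh σf) (hμ : 0 < μh)
    (hconv : StrongConvexOn Set.univ μh P.totalCost) (n : ℕ) :
    ∃ C : ℝ, 0 ≤ C ∧ ∀ (u : Traj τ nu) (ν : ℝ), 0 < ν → ∀ t ≤ n, t ≤ τ →
      ‖P.lqrRoll ν u t‖ ≤ C * ‖P.LQR ν u‖ ∧ ‖P.ddpRoll ν u t‖ ≤ C * ‖P.LQR ν u‖ ∧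
      ‖P.ddpRoll ν u t - P.lqrRoll ν u t‖ ≤ C * ‖P.LQR ν u‖ ^ 2 := by
  obtain ⟨κ, hκ, hpol⟩ := exists_norm_policy_sub_le hyp hμ hconv
  obtain ⟨K, hK⟩ := hyp.dyn_lip
  obtain ⟨K', hK'⟩ := hyp.dyn_grad
  induction n with
  | zero =>
    refine ⟨0, le_rfl, fun u ν _ t ht _ => ?_⟩
    obtain rfl : t = 0 := by omega
    simp [lqrRoll, ddpRoll]
  | succ n ih =>
    obtain ⟨C, hC, h⟩ := ih
    set C₁ := 1 + κ * (C + C) with hC₁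
    have hC₁0 : 0 ≤ C₁ := by positivity
    set C₂ := K * (C + C₁) with hC₂
    set C₃ := K' / 2 * (C + C₁) ^ 2 + (K * C + K * (κ * C)) with hC₃
    have hC₂0 : 0 ≤ C₂ := by positivity
    have hC₃0 : 0 ≤ C₃ := by positivity
    refine ⟨C + C₂ + C₃, by positivity, fun u ν hν t ht htτ => ?_⟩
    set V := ‖P.LQR ν u‖
    have hV : 0 ≤ V := norm_nonneg _
    rcases Nat.lt_or_ge n t with hnt | hnt
    · obtain rfl : t = n + 1 := by omega
      obtain ⟨h1, h2, h3⟩ := h u ν hν n le_rfl (by omega)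
      set y := P.lqrRoll ν u n with hy
      set y' := P.ddpRoll ν u n with hy'
      set v := P.policy ν u n y with hv
      set v' := P.policy ν u n y' with hv'
      have hvV : ‖v‖ ≤ V := by
        have := norm_ctrlAt_le (P.LQR ν u) n
        rwa [ctrlAt_LQR ν u (by omega)] at this
      have hvv : ‖v' - v‖ ≤ κ * ‖y' - y‖ := hpol u ν hν n (by omega) y y'
      have hvV' : ‖v'‖ ≤ C₁ * V := by
        have h4 : ‖y' - y‖ ≤ C * V + C * V := norm_sub_le_of_le h2 h1
        have h5 : ‖v'‖ ≤ ‖v‖ + ‖v' - v‖ := norm_le_norm_add_norm_sub' v' v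
        have h6 : κ * ‖y' - y‖ ≤ κ * (C * V + C * V) := by gcongr
        rw [hC₁]
        linarith
      have hA : ‖P.A u n‖ ≤ K := norm_jacX_le_of_lipschitz hK _ _
      have hB : ‖P.B u n‖ ≤ K := norm_jacU_le_of_lipschitz hK _ _
      have hpair : ‖(y', v')‖ ≤ (C + C₁) * V := by
        rw [Prod.norm_mk]
        refine max_le ?_ ?_
        · linarith [mul_nonneg hC₁0 hV]
        · linarith [mul_nonneg hC hV]
      have e1 : P.lqrRoll ν u (n + 1) = P.A u n y + P.B u n v := rfl
      have e2 : P.ddpRoll ν u (n + 1)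
          = P.f (P.state u n + y') (ctrlAt u n + v') - P.f (P.state u n) (ctrlAt u n) := rfl
      have b1 : ‖P.lqrRoll ν u (n + 1)‖ ≤ C₂ * V := by
        rw [e1]
        refine (norm_add_le_of_le (ContinuousLinearMap.le_of_opNorm_le_of_le _ hA h1)
          (ContinuousLinearMap.le_of_opNorm_le_of_le _ hB hvV)).trans ?_
        have h7 : V ≤ C₁ * V := by
          refine le_mul_of_one_le_left hV ?_
          rw [hC₁]
          linarith [mul_nonneg hκ (add_nonneg hC hC)]
        have h8 : (K : ℝ) * V ≤ K * (C₁ * V) := by gcongr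
        rw [hC₂]
        linarith
      have b2 : ‖P.ddpRoll ν u (n + 1)‖ ≤ C₂ * V := by
        rw [e2]
        have h7 := hK.norm_sub_le (P.state u n + y', ctrlAt u n + v') (P.state u n, ctrlAt u n)
        rw [Prod.mk_sub_mk, add_sub_cancel_left, add_sub_cancel_left] at h7
        refine h7.trans ?_
        rw [hC₂, mul_assoc]
        gcongr
      -- The Taylor error of f along the DDP displacement is quadratic. The remainder is the
      -- linearized dynamic applied to the previous deviation and to its image under the uniformly
      -- Lipschitz policy.
      have b3 : ‖P.ddpRoll ν u (n + 1) - P.lqrRoll ν u (n + 1)‖ ≤ C₃ * V ^ 2 := by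
        have h7 := norm_sub_fderiv_le hyp.dyn_diff hK' (P.state u n, ctrlAt u n) (y', v')
        rw [(hasFDerivAt_f hyp.dyn_diff (P.state u n) (ctrlAt u n)).fderiv] at h7
        simp only [Prod.mk_add_mk, ContinuousLinearMap.coprod_apply] at h7
        have e3 : P.ddpRoll ν u (n + 1) - P.lqrRoll ν u (n + 1)
            = (P.f (P.state u n + y') (ctrlAt u n + v') - P.f (P.state u n) (ctrlAt u n)
                - (P.A u n y' + P.B u n v')) + (P.A u n (y' - y) + P.B u n (v' - v)) := by
          rw [e1, e2, map_sub, map_sub]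
          abel
        rw [e3, hC₃, add_mul]
        refine norm_add_le_of_le (h7.trans ?_) ?_
        · rw [mul_assoc, ← mul_pow]
          gcongr
        · have h8 : κ * ‖y' - y‖ ≤ κ * (C * V ^ 2) := by gcongr
          refine (norm_add_le_of_le (ContinuousLinearMap.le_of_opNorm_le_of_le _ hA h3)
            (ContinuousLinearMap.le_of_opNorm_le_of_le _ hB (hvv.trans h8))).trans_eq ?_
          ring
      refine ⟨b1.trans ?_, b2.trans ?_, b3.trans ?_⟩
      all_goals
        gcongr
        linarith
    · obtain ⟨h1, h2, h3⟩ := h u ν hν t hnt htτ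
      refine ⟨h1.trans ?_, h2.trans ?_, h3.trans ?_⟩
      all_goals
        gcongr
        linarith

/-- The DDP oracle approximates the LQR oracle up to a quadratic error. -/
lemma exists_norm_DDP_sub_LQR_le (hyp : P.StandingHypothesis Lh Mh σf) (hμ : 0 < μh)
    (hconv : StrongConvexOn Set.univ μh P.totalCost) :
    ∃ C : ℝ, 0 ≤ C ∧ ∀ (u : Traj τ nu) (ν : ℝ), 0 < ν →
      ‖P.DDP ν u - P.LQR ν u‖ ≤ C * ‖P.LQR ν u‖ ^ 2 := by
  obtain ⟨κ, hκ, hpol⟩ := exists_norm_policy_sub_le hyp hμ hconv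
  obtain ⟨C, hC, h⟩ := exists_norm_ddpRoll_sub_le hyp hμ hconv τ
  refine ⟨√τ * (κ * C), by positivity, fun u ν hν => ?_⟩
  refine abs_le_of_sq_le_sq' ?_ (by positivity) |>.2
  rw [traj_norm_sq]
  calc _ ≤ ∑ _t ∈ Finset.range τ, (κ * (C * ‖P.LQR ν u‖ ^ 2)) ^ 2 := by
        refine Finset.sum_le_sum fun t ht => pow_le_pow_left₀ (norm_nonneg _) ?_ 2
        have ht := Finset.mem_range.1 ht
        rw [ctrlAt_sub, ctrlAt_DDP ν u ht, ctrlAt_LQR ν u ht]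
        refine (hpol u ν hν t ht _ _).trans ?_
        have := (h u ν hν t ht.le ht.le).2.2
        gcongr
    _ = _ := by
        rw [Finset.sum_const, Finset.card_range, nsmul_eq_mul, mul_assoc (√(τ : ℝ)),
          mul_pow (√(τ : ℝ)),
          Real.sq_sqrt (Nat.cast_nonneg τ)]
        ring

theorem bddAbove_ratios (hyp : P.StandingHypothesis Lh Mh σf) (hμ : 0 < μh)
    (hconv : StrongConvexOn Set.univ μh P.totalCost) : BddAbove P.ratios := by
  obtain ⟨C, hC, h⟩ := exists_norm_DDP_sub_LQR_le hyp hμ hconv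
  refine ⟨C, ?_⟩
  rintro _ ⟨u, ν, hν, rfl⟩
  exact div_le_of_le_mul₀ (by positivity) hC (h u ν hν)

lemma eta_nonneg (P : Problem τ nx nu) : 0 ≤ P.eta := by
  refine Real.sSup_nonneg ?_
  rintro _ ⟨u, ν, _, rfl⟩
  positivity

theorem norm_DDP_sub_LQR_le (hyp : P.StandingHypothesis Lh Mh σf) (hμ : 0 < μh)
    (hconv : StrongConvexOn Set.univ μh P.totalCost) (u : Traj τ nu) {ν : ℝ} (hν : 0 < ν) :
    ‖P.DDP ν u - P.LQR ν u‖ ≤ P.eta * ‖P.LQR ν u‖ ^ 2 := by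
  -- If the LQR oracle vanishes, the ratio carries no information; the quadratic bound with the
  -- constant C shows that the DDP oracle vanishes too.
  rcases (sq_nonneg ‖P.LQR ν u‖).eq_or_lt with h0 | h0
  · obtain ⟨C, _, h⟩ := exists_norm_DDP_sub_LQR_le hyp hμ hconv
    have := h u ν hν
    rwa [← h0, mul_zero] at this ⊢
  · rw [← div_le_iff₀ h0]
    exact le_csSup (bddAbove_ratios hyp hμ hconv) ⟨u, ν, hν, rfl⟩

/-! ### Stationary points -/

/-- All p_t vanish, hence all j_t used by the policies do, whatever the gains are. So this covers ν
= 0, where the inverse may fail to exist. -/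
lemma policy_zero_of_gradient_eq_zero (hyp : P.StandingHypothesis Lh Mh σf) {u : Traj τ nu}
    (hu : gradient P.totalCost (P.g u) = 0) (ν : ℝ) {t : ℕ} (ht : t < τ) :
    P.policy ν u t 0 = 0 := by
  have hp : ∀ t, 0 < t → t ≤ τ → P.p u t = 0 := by
    intro t ht ht'
    obtain ⟨t, rfl⟩ : ∃ s, t = s + 1 := ⟨t - 1, by omega⟩
    have h1 := ctrlAt_gradient_totalCost hyp (P.g u) (show t < τ by omega)
    rw [hu, ctrlAt_g u (by omega)] at h1
    rw [p, ← h1, ctrlAt_of_lt _ (by omega)]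
    rfl
  have hj : ∀ s < τ, (P.backward ν u s).2 = 0 := by
    intro s
    induction s with
    | zero => intro hs; exact hp τ hs le_rfl
    | succ s ih =>
      intro hs
      simp only [backward]
      rw [ih (by omega), hp _ (by omega) (by omega)]
      simp
  simp only [policy]
  rw [hj _ (by omega)]
  simp

lemma DDP_eq_zero_of_gradient_eq_zero (hyp : P.StandingHypothesis Lh Mh σf) {u : Traj τ nu}
    (hu : gradient P.totalCost (P.g u) = 0) (ν : ℝ) : P.DDP ν u = 0 := by
  have h1 : ∀ t ≤ τ, P.ddpRoll ν u t = 0 := by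
    intro t
    induction t with
    | zero => intro _; rfl
    | succ t ih =>
      intro ht
      rw [ddpRoll, ih (by omega), policy_zero_of_gradient_eq_zero hyp hu ν ht]
      simp
  ext1 i
  change P.policy ν u i (P.ddpRoll ν u i) = 0
  rw [h1 i i.2.le, policy_zero_of_gradient_eq_zero hyp hu ν i.2]

/-- The iterative DDP algorithm is an approximate regularized Gauss-Newton method. -/
theorem gaussNewton_DDP (hyp : P.StandingHypothesis Lh Mh σf) (hμ : 0 < μh)
    (hconv : StrongConvexOn Set.univ μh P.totalCost) {lg Lg : ℝ≥0} {σg : ℝ}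
    (hg : P.TrajConstants lg Lg σg) (hLg : 0 < Lg) {c : Consts}
    (hc : c = ⟨μh, Lh, Mh, lg, Lg, σg, P.eta⟩) :
    GaussNewton P.totalCost P.g Lh Mh lg Lg μh σg P.eta c
      (fun u => P.LQR (c.reg (P.gradNorm u)) u) (fun u => P.DDP (c.reg (P.gradNorm u)) u) := by
  have hadm : c.Admissible := by
    rw [hc]
    exact ⟨hμ, Lh.2, Mh.2, lg.2, hLg, hg.surj_pos, P.eta_nonneg⟩
  have hreg : ∀ u, gradient P.totalCost (P.g u) ≠ 0 → 0 < c.reg (P.gradNorm u) := fun u hu =>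
    hadm.reg_pos (norm_pos_iff.2 hu)
  exact
  { consts := hc
    cost := smoothCost_totalCost hyp hμ hconv
    map := ⟨fun u => (hasFDerivAt_g hyp.dyn_diff u).differentiableAt, hg.lip, hg.smooth,
      hg.surj_pos, hg.surj⟩
    Lg_pos := hLg
    η_nonneg := P.eta_nonneg
    step := fun u hu => regStep_LQR hyp hμ hconv (hreg u hu) u
    near := fun u hu => norm_DDP_sub_LQR_le hyp hμ hconv u (hreg u hu)
    near_zero := fun u hu => DDP_eq_zero_of_gradient_eq_zero hyp hu _ }

end Problem

end OptControl

theorem mainTheorem4 {τ nx nu : ℕ} (P : OptControl.Problem τ nx nu)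
    (Lh Mh : ℝ≥0) (σf μh : ℝ)
    (hyp : P.StandingHypothesis Lh Mh σf)
    (hμ : 0 < μh)
    (hconv : StrongConvexOn Set.univ μh P.totalCost) :
    -- the constants of the dynamic yield constants of the trajectory map `g`
    (∀ lx lu Lxx Lxu Luu S lg : ℝ≥0, P.DynConstants lx lu Lxx Lxu Luu →
      S = ∑ t ∈ Finset.range τ, lx ^ t → lg = lu * S →
      P.TrajConstants lg (S * (Lxx * S * lg ^ 2 + 2 * Lxu * lg + Luu)) (σf / (1 + lx))) ∧
    -- the supremum `η` is finite
    BddAbove P.ratios ∧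
    (∀ (u : OptControl.Traj τ nu) (ν : ℝ), 0 < ν →
      ‖P.DDP ν u - P.LQR ν u‖ ≤ P.eta * ‖P.LQR ν u‖ ^ 2) ∧
    ∀ (lg Lg : ℝ≥0) (σg : ℝ), P.TrajConstants lg Lg σg → 0 < Lg →
      ∀ c : OptControl.Consts, c = ⟨μh, Lh, Mh, lg, Lg, σg, P.eta⟩ →
      ∀ ν : OptControl.Traj τ nu → ℝ, ν = (fun u => c.reg (P.gradNorm u)) →
      -- sufficient decrease
      (∀ u : OptControl.Traj τ nu,
        P.obj (u + P.DDP (ν u) u)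
          ≤ P.obj u + 1 / 2 * inner ℝ (gradient P.obj u) (P.LQR (ν u) u)) ∧
      -- quadratic convergence once the gap is at most `δ̄`
      (∀ u : OptControl.Traj τ nu, P.obj u - P.optVal ≤ c.δBar →
        P.newtonDecrement (P.g u) ≤ c.lamBar ∧
        P.newtonDecrement (P.g (u + P.DDP (ν u) u))
          ≤ c.lamBar⁻¹ * P.newtonDecrement (P.g u) ^ 2) ∧
      -- number of iterations
      ∃ r : ℝ → ℝ, r =O[𝓝[>] 0] (fun ε : ℝ => Real.log (Real.log (1 / ε))) ∧
        ∀ (u₀ : OptControl.Traj τ nu) (ε : ℝ), 0 < ε →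
          ∃ k : ℕ, (k : ℝ) ≤ c.phase (max (P.obj u₀ - P.optVal) c.δBar) c.δBar + r ε ∧
            ∀ m : ℕ, k ≤ m → P.obj (P.iddp ν u₀ m) - P.optVal ≤ ε := by
  refine ⟨fun lx lu Lxx Lxu Luu S lg D hS hlg => D.trajConstants hyp hS hlg,
    OptControl.Problem.bddAbove_ratios hyp hμ hconv,
    fun u ν hν => OptControl.Problem.norm_DDP_sub_LQR_le hyp hμ hconv u hν, ?_⟩
  rintro lg Lg σg hg hLg c hc ν rfl
  have H := OptControl.Problem.gaussNewton_DDP hyp hμ hconv hg hLg hc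
  refine ⟨fun u => ?_, fun u hu => ?_, ?_⟩
  · have h1 := OptControl.inner_gradient_comp (H.map.diff u) (H.cost.diff (P.g u))
      (P.LQR (c.reg (P.gradNorm u)) u)
    have h2 := H.decrease u
    rw [← h1] at h2
    exact h2
  · have h1 := H.decrement_le hu
    refine ⟨h1, (H.decrement_step_le h1).trans ?_⟩
    change OptControl.decrement P.totalCost (P.g u) ^ 2 / (2 * c.lamBar)
      ≤ c.lamBar⁻¹ * OptControl.decrement P.totalCost (P.g u) ^ 2
    have h3 := H.admissible.lamBar_nonneg
    -- The estimate proved is stronger by a factor 2 than the one claimed.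
    have h4 : 0 ≤ c.lamBar⁻¹ * OptControl.decrement P.totalCost (P.g u) ^ 2 := by positivity
    rw [div_eq_mul_inv, mul_inv]
    linarith
  · obtain ⟨r, hr, h⟩ := H.exists_complexity
    refine ⟨r, hr, fun u₀ ε hε => ?_⟩
    exact h (P.iddp (fun u => c.reg (P.gradNorm u)) u₀)
      (fun k => by rw [OptControl.Problem.iddp]) ε hε
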